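/- Let $k$ be a field of characteristic zero. For a $k$-algebra $A$ put $A^e=A\otimes_k A^{\mathrm{op}}$ and let $\nu$ be a $k$-algebra automorphism of $A$. The algebra $A$ is called $\nu$-twisted Calabi–Yau of dimension $d$ (and $\nu$ its Nakayama automorphism, unique up to inner automorphisms) if $A$ has a resolution of finite length by finitely generated projective $A^e$-modules, $\mathrm{Ext}^i_{A^e}(A,A^e)=0$ for $i\neq d$, and $\mathrm{Ext}^d_{A^e}(A,A^e)\cong A^{\nu}$ as $A$-bimodules. Here $\mathrm{Ext}$ is taken with respect to the outer structure $a(m\otimes n)b=am\otimes nb$ of $A^e$, its bimodule structure is induced by the inner one, $b\cdot(m\otimes n)\cdot a=ma\otimes bn$, and $A^\nu$ is $A$ with the action $b\cdot m\cdot a=bm\nu(a)$. The algebra $A$ is called Calabi–Yau if it is $\mathrm{id}$-twisted Calabi–Yau of some dimension. **Theorem.** 1. Let $p,q\in k\setminus\{0\}$ with $2p^4-p^2q+q^2=0$, and let $D=k\langle x,y\rangle/(r_1,r_2,r_3)$, where $$\begin{aligned} r_1&=x^3y+p\,x^2yx+q\,xyx^2-p(2p^2+q)\,yx^3,\\ r_2&=x^2y^2-p(p^2+q)\,yxyx-q^2\,y^2x^2+(q-p^2)\,xy^2x+(q-p^2)\,yx^2y,\\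 r_3&=xy^3+p\,yxy^2+q\,y^2xy-p(2p^2+q)\,y^3x. \end{aligned}$$ Then $D$ is twisted Calabi–Yau of dimension $5$ with Nakayama automorphism $\nu$ given by $\nu(x)=p^{-3}q^4x$, $\nu(y)=p^3q^{-4}y$. Moreover $D$ is Calabi–Yau if and only if $p^3=q^4$ and $2p^4-p^2q+q^2=0$. 2. Let $p,q,s,g\in k\setminus\{0\}$ with $ps^3g+qsg^2+s^5+g^3=0$, $p^3s=q^3$, $ps\ne q^2$, $q^2s^2\neq g^2$ and $s^5+g^3\neq0$, and let $G=k\langle x,y\rangle/(r_1,r_2,r_3)$, where $$\begin{aligned} r_1&=x^3y+p\,x^2yx+q\,xyx^2+s\,yx^3,\\ r_2&=x^2y^2+l_2\,xyxy+l_3\,yxyx+l_4\,y^2x^2+l_5\,xy^2x+l_5\,yx^2y,\\ r_3&=xy^3+p\,yxy^2+q\,y^2xy+s\,y^3x, \end{aligned}$$ $$l_2=-\frac{s^2(qs-g)}{g(qs+g)},\quad l_3=s-\frac{pg(ps-q^2)}{q(qs+g)},\quad l_4=-\frac{g^2}{s^2},\quad l_5=\frac{ps^2+qg}{qs+g}.$$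 Then $G$ is twisted Calabi–Yau of dimension $5$ with Nakayama automorphism $\nu$ given by $\nu(x)=gx$, $\nu(y)=g^{-1}y$. Moreover $G$ is Calabi–Yau if and only if $g=1$. -/

import Mathlib

open CategoryTheory TensorProduct MulOpposite

universe u v

noncomputable section

namespace TwistedCY

section General

variable (k : Type v) (A : Type u) [CommRing k] [Ring A] [Algebra k A]

/-- The enveloping algebra `A ⊗ Aᵒᵖ`; left modules over it are the `A`-`A`-bimodules
(on which the two actions of `k` agree). -/
abbrev Env : Type u := A ⊗[k] Aᵐᵒᵖ

/-- `A` as a left module over its enveloping algebra, `(a ⊗ b) • x = a * x * b`. -/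
abbrev diagonal : ModuleCat.{u} (Env k A) :=
  letI : Module (Env k A) A := instModuleTensorProductMop k A
  ModuleCat.of (Env k A) A

/-- The left regular module of the enveloping algebra: the outer bimodule structure
`a · (m ⊗ n) · b = am ⊗ nb` on `A ⊗ A`. -/
abbrev regular : ModuleCat.{u} (Env k A) := ModuleCat.of (Env k A) (Env k A)

variable {A} in
/-- Right multiplication by `w` on the enveloping algebra, a morphism of left modules.
For `w = a ⊗ b` it is the inner action `m ⊗ n ↦ ma ⊗ bn`, with `ma` and `bn` formed in `A`. -/
def rightMul (w : Env k A) : regular k A ⟶ regular k A :=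
  ModuleCat.ofHom (LinearMap.toSpanSingleton (Env k A) (Env k A) w)

lemma diagonal_smul (a b x : A) :
    letI : Module (Env k A) A := instModuleTensorProductMop k A
    ((a ⊗ₜ[k] op b : Env k A) • x : A) = a * x * b := by
  simp [TensorProduct.Algebra.smul_def, mul_assoc]

lemma rightMul_tmul (m n a b : A) :
    (rightMul k (a ⊗ₜ[k] op b)).hom (m ⊗ₜ[k] op n : Env k A) = (m * a) ⊗ₜ[k] op (b * n) := by
  simp [rightMul]

/-- `Ext^n(A, Aᵉ)` over the enveloping algebra `Aᵉ`, where `Aᵉ` carries the outer structure. -/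
abbrev ExtEnv (n : ℕ) : Type u := Abelian.Ext.{u} (diagonal k A) (regular k A) n

variable {k A} in
/-- The bimodule action `b · ξ · a` on `Ext^n(A, Aᵉ)` induced by the inner structure of `Aᵉ`:
functoriality of `Ext` in its second argument, applied to right multiplication by `a ⊗ b`. -/
def innerAct {n : ℕ} (b : A) (ξ : ExtEnv k A n) (a : A) : ExtEnv k A n :=
  ξ.comp (Abelian.Ext.mk₀ (rightMul k (a ⊗ₜ[k] op b))) (add_zero n)

/-- `A` is homologically smooth: as a module over its enveloping algebra it has a resolution of
finite length by finitely generated projective modules. -/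
def HomologicallySmooth : Prop :=
  ∃ P : ProjectiveResolution (diagonal k A),
    (∀ n, Module.Finite (Env k A) (P.complex.X n)) ∧
    ∃ N : ℕ, ∀ n, N < n → Limits.IsZero (P.complex.X n)

variable {A} in
/-- `A` is `ν`-twisted Calabi-Yau of dimension `d`: it is homologically smooth,
`Ext^i(A, Aᵉ) = 0` for `i ≠ d`, and `Ext^d(A, Aᵉ)` is isomorphic as a bimodule to `A^ν`, that is,
to `A` with the action `b · m · a = b * m * ν a`. -/
structure IsTwistedCalabiYau (ν : A ≃ₐ[k] A) (d : ℕ) : Prop where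
  smooth : HomologicallySmooth k A
  ext_eq_zero : ∀ i, i ≠ d → ∀ ξ : ExtEnv k A i, ξ = 0
  ext_top : ∃ e : ExtEnv k A d ≃+ A,
    ∀ (b : A) (ξ : ExtEnv k A d) (a : A), e (innerAct b ξ a) = b * e ξ * ν a

/-- `A` is Calabi-Yau of some dimension (in the sense of Ginzburg): it is homologically smooth and
`Ext^i(A, Aᵉ)` is `A` as a bimodule for `i = d` and `0` for `i ≠ d`. -/
def IsCalabiYau : Prop := ∃ d : ℕ, IsTwistedCalabiYau k (AlgEquiv.refl : A ≃ₐ[k] A) d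

end General

section Algebras

variable {k : Type u} [Field k]

/-- The free generator `x` of `k⟨x, y⟩`. -/
abbrev fx (k : Type u) [Field k] : FreeAlgebra k (Fin 2) := FreeAlgebra.ι k 0

/-- The free generator `y` of `k⟨x, y⟩`. -/
abbrev fy (k : Type u) [Field k] : FreeAlgebra k (Fin 2) := FreeAlgebra.ι k 1

/-- The element `x³y + p x²yx + q xyx² + s yx³`. -/
def cubicX (p q s : k) : FreeAlgebra k (Fin 2) :=
  let x := fx k; let y := fy k
  x ^ 3 * y + p • (x ^ 2 * y * x) + q • (x * y * x ^ 2) + s • (y * x ^ 3)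

/-- The element `xy³ + p yxy² + q y²xy + s y³x`. -/
def cubicY (p q s : k) : FreeAlgebra k (Fin 2) :=
  let x := fx k; let y := fy k
  x * y ^ 3 + p • (y * x * y ^ 2) + q • (y ^ 2 * x * y) + s • (y ^ 3 * x)

/-- The element `x²y² + l₂ xyxy + l₃ yxyx + l₄ y²x² + l₅ xy²x + l₅ yx²y`. -/
def mixed (l₂ l₃ l₄ l₅ : k) : FreeAlgebra k (Fin 2) :=
  let x := fx k; let y := fy k
  x ^ 2 * y ^ 2 + l₂ • (x * y * x * y) + l₃ • (y * x * y * x) + l₄ • (y ^ 2 * x ^ 2)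
    + l₅ • (x * y ^ 2 * x) + l₅ • (y * x ^ 2 * y)

/-- The defining relations of the algebra `D`. -/
inductive RelD (p q : k) : FreeAlgebra k (Fin 2) → FreeAlgebra k (Fin 2) → Prop
  | r₁ : RelD p q (cubicX p q (-(p * (2 * p ^ 2 + q)))) 0
  | r₂ : RelD p q (mixed 0 (-(p * (p ^ 2 + q))) (-q ^ 2) (q - p ^ 2)) 0
  | r₃ : RelD p q (cubicY p q (-(p * (2 * p ^ 2 + q)))) 0

/-- The defining relations of the algebra `G`. -/
inductive RelG (p q s g : k) : FreeAlgebra k (Fin 2) → FreeAlgebra k (Fin 2) → Prop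
  | r₁ : RelG p q s g (cubicX p q s) 0
  | r₂ : RelG p q s g
      (mixed (-(s ^ 2 * (q * s - g) / (g * (q * s + g))))
        (s - p * g * (p * s - q ^ 2) / (q * (q * s + g)))
        (-(g ^ 2 / s ^ 2))
        ((p * s ^ 2 + q * g) / (q * s + g))) 0
  | r₃ : RelG p q s g (cubicY p q s) 0

/-- The algebra `D = k⟨x, y⟩ / (r₁, r₂, r₃)`. -/
abbrev AlgD (p q : k) : Type u := RingQuot (RelD p q)

/-- The algebra `G = k⟨x, y⟩ / (r₁, r₂, r₃)`. -/
abbrev AlgG (p q s g : k) : Type u := RingQuot (RelG p q s g)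

/-- The image of the generator `x` in `D`. -/
def AlgD.x (p q : k) : AlgD p q := RingQuot.mkAlgHom k (RelD p q) (fx k)

/-- The image of the generator `y` in `D`. -/
def AlgD.y (p q : k) : AlgD p q := RingQuot.mkAlgHom k (RelD p q) (fy k)

/-- The image of the generator `x` in `G`. -/
def AlgG.x (p q s g : k) : AlgG p q s g := RingQuot.mkAlgHom k (RelG p q s g) (fx k)

/-- The image of the generator `y` in `G`. -/
def AlgG.y (p q s g : k) : AlgG p q s g := RingQuot.mkAlgHom k (RelG p q s g) (fy k)

end Algebras

end TwistedCY

end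

/-! Both algebras belong to one family with parameters `t`, `h` and `r`, where `r * h * (h - 1) = t
* (h ^ 3 + 1)`. Let `a` be a skew commutator of `X` and `Y`, `b` one of `X` and `a`, and `c` one of
`a` and `Y`. The two cubic relations then say that `X`, `b` and `c`, `Y` commute up to the factor `t
/ h`, and the third relation rewrites `b * Y` through `Y * b` and `a ^ 2`. When `h ^ 2 + 1 ≠ 0`, the
remaining commutation rules among `X, b, a, c, Y` follow (`SkewRel.relXBACY`). The algebra is
therefore an Ore extension iterated five times, adjoining `Y, c, a, b, X` in this order, and `d = 5`
counts the steps.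

The homological part is an induction along Ore extensions `A = B[x; σ, δ]`. A finite free bimodule
resolution is stored as one square-zero matrix over the enveloping algebra: exactness on row vectors
says that it resolves the algebra, and exactness on column vectors says that its dual resolves the
`ν`-twisted algebra. Such data compute all the groups `Ext` (`IsDualizing.isTwistedCalabiYau`). For
the step, the matrix of `B` is base changed to `A`, once plainly and once twisted by `σ`, and the
new matrix is the mapping cone of a comparison `Φ` between the two (`IsTorusOre.exists_dualizing`).
`Φ` is diagonal with entries `x ⊗ 1 - θ • 1 ⊗ x`, plus a correction over the enveloping algebra of
`B`, found by lifting through the resolution (`exists_connecting`).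

A two-dimensional torus acts throughout, and each `σ` is the action of a torus element. Bidegrees
force the correction to vanish at the two ends of the complex, because the degree of the new
generator lies outside a half plane containing all degrees of `B`. So the ends of `Φ` are explicit.
They give injectivity on the end homology, hence exactness of the cone, and they give the Nakayama
automorphism: it is `ν ∘ σ⁻¹` on `B` and scales `x` by the weight of the top degree. After five
steps it is `X ↦ t ^ 5 * h • X`, `Y ↦ (t ^ 5 * h)⁻¹ • Y`.

If the algebra is also Calabi–Yau, this automorphism is implemented by an element with a left
inverse. Mapping to `k[Y]` by `X ↦ 0` then forces the scalar to be `1`. -/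

namespace TwistedCY

/-! ### Evaluation maps on the enveloping algebra -/

section Evaluation

variable {k : Type u} {A : Type u} [Field k] [Ring A] [Algebra k A]

variable (k A) in
/-- The multiplication map `a ⊗ b ↦ a * b` on the enveloping algebra. -/
noncomputable def leftEval : Env k A →ₗ[k] A :=
  TensorProduct.lift (LinearMap.mk₂ k (fun a b => a * unop b)
    (by intros; simp [add_mul]) (by intros; simp) (by intros; simp [mul_add]) (by intros; simp))

/-- The map `a ⊗ b ↦ b * ν a` on the enveloping algebra. -/
noncomputable def rightEval (ν : A →ₐ[k] A) : Env k A →ₗ[k] A :=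
  TensorProduct.lift (LinearMap.mk₂ k (fun a b => unop b * ν a)
    (by intros; simp [mul_add]) (by intros; simp) (by intros; simp [add_mul]) (by intros; simp))

@[simp] lemma leftEval_tmul (a : A) (b : Aᵐᵒᵖ) : leftEval k A (a ⊗ₜ b) = a * unop b := by
  simp [leftEval]

@[simp] lemma rightEval_tmul (ν : A →ₐ[k] A) (a : A) (b : Aᵐᵒᵖ) :
    rightEval ν (a ⊗ₜ b) = unop b * ν a := by
  simp [rightEval]

/-- This makes `rightEval ν` a bimodule map from the inner structure to the twisted bimodule, so the
top `Ext` can be identified as its image. -/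
lemma rightEval_mul_tmul (ν : A →ₐ[k] A) (s : Env k A) (a b : A) :
    rightEval ν (s * (a ⊗ₜ op b)) = b * rightEval ν s * ν a := by
  induction s using TensorProduct.induction_on with
  | zero => simp
  | tmul m n => simp [mul_assoc]
  | add x y hx hy => simp [add_mul, mul_add, hx, hy]

lemma smul_one_eq_leftEval (r : Env k A) :
    letI : Module (Env k A) A := instModuleTensorProductMop k A
    (r • (1 : A) : A) = leftEval k A r := by
  let _ : Module (Env k A) A := instModuleTensorProductMop k A
  induction r using TensorProduct.induction_on with
  | zero => exact (zero_smul (Env k A) (1 : A)).trans (map_zero (leftEval k A)).symm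
  | tmul m n => simpa using diagonal_smul k A m (unop n) 1
  | add x y hx hy => rw [add_smul, hx, hy, map_add]

lemma rightEval_surjective (ν : A →ₐ[k] A) : Function.Surjective (rightEval ν) :=
  fun a => ⟨1 ⊗ₜ op a, by simp⟩

end Evaluation

/-! ### Self-dual resolutions encoded by a matrix -/

section Dualizing

variable {k : Type u} {A : Type u} [Field k] [Ring A] [Algebra k A]
variable {ι : Type} [Fintype ι] [DecidableEq ι]

/-- A finite complex of finitely generated free bimodules, given by its total differential `D`,
a matrix over the enveloping algebra, which resolves `A` and whose dual resolves the
`ν`-twisted bimodule `A`. The grading `h` is the homological degree, `o` and `t` index the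
generators in degrees `0` and `d`. -/
structure IsDualizing (ν : A →ₐ[k] A) (d : ℕ) (h : ι → ℕ) (o t : ι)
    (D : Matrix ι ι (Env k A)) : Prop where
  degree : ∀ r c, D r c ≠ 0 → h r = h c + 1
  bot_iff : ∀ r, h r = 0 ↔ r = o
  le_top : ∀ r, h r ≤ d
  top_iff : ∀ r, h r = d ↔ r = t
  sq : D * D = 0
  row : ∀ v, Matrix.vecMul v D = 0 → ∃ u s, v = Matrix.vecMul u D + Pi.single o s
  bottom : ∀ s, (∃ u, Matrix.vecMul u D = Pi.single o s) ↔ leftEval k A s = 0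
  col : ∀ v, D.mulVec v = 0 → ∃ u s, v = D.mulVec u + Pi.single t s
  top : ∀ s, (∃ u, D.mulVec u = Pi.single t s) ↔ rightEval ν s = 0

end Dualizing

/-! ### From a total differential to a chain complex -/

namespace MatrixComplex

variable {R : Type u} [Ring R] {ι : Type} (h : ι → ℕ) (D : Matrix ι ι R)

/-- The part of the index set in homological degree `n`. -/
abbrev Level (n : ℕ) : Type := {r : ι // h r = n}

/-- The differential from degree `n + 1` to degree `n`. -/
def block (n : ℕ) : Matrix (Level h (n + 1)) (Level h n) R :=
  D.submatrix Subtype.val Subtype.val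

variable {h}

/-- Extension by zero of a vector supported in one degree. -/
def extend {n : ℕ} (v : Level h n → R) : ι → R :=
  fun r => if hr : h r = n then v ⟨r, hr⟩ else 0

@[simp] lemma extend_coe {n : ℕ} (v : Level h n → R) (r : Level h n) : extend v r.1 = v r := by
  simp [extend, r.2]

lemma extend_of_ne {n : ℕ} (v : Level h n → R) {r : ι} (hr : h r ≠ n) : extend v r = 0 := by
  simp [extend, hr]

variable {D}

lemma _root_.Fintype.sum_eq_sum_subtype_of_ne_zero [Fintype ι] {M : Type*} [AddCommMonoid M]
    {p : ι → Prop} [DecidablePred p] (f : ι → M) (hf : ∀ r, f r ≠ 0 → p r) :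
    ∑ r, f r = ∑ r : {r // p r}, f r := by
  rw [← Finset.sum_subtype (Finset.univ.filter p) (by simp) f,
    Finset.sum_filter_of_ne fun r _ => hf r]

variable [Fintype ι]

lemma vecMul_apply_level (hD : ∀ r c, D r c ≠ 0 → h r = h c + 1) (u : ι → R) {n : ℕ}
    (c : Level h n) :
    Matrix.vecMul u D c = Matrix.vecMul (fun r : Level h (n + 1) => u r) (block h D n) c :=
  Fintype.sum_eq_sum_subtype_of_ne_zero (fun r => u r * D r c) fun r hr => by
    rw [hD r c (right_ne_zero_of_mul hr), c.2]

lemma mulVec_apply_level (hD : ∀ r c, D r c ≠ 0 → h r = h c + 1) (u : ι → R) {n : ℕ}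
    (r : Level h (n + 1)) :
    D.mulVec u r = (block h D n).mulVec (fun c : Level h n => u c) r :=
  Fintype.sum_eq_sum_subtype_of_ne_zero (fun c => D r c * u c) fun c hc => by
    have := hD r c (left_ne_zero_of_mul hc)
    have := r.2
    omega

lemma mulVec_apply_zero (hD : ∀ r c, D r c ≠ 0 → h r = h c + 1) (u : ι → R) {r : ι}
    (hr : h r = 0) : D.mulVec u r = 0 :=
  Finset.sum_eq_zero fun c _ => by
    by_contra hc
    have := hD r c (left_ne_zero_of_mul hc)
    omega

lemma vecMul_extend (hD : ∀ r c, D r c ≠ 0 → h r = h c + 1) {n : ℕ} (v : Level h (n + 1) → R) :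
    Matrix.vecMul (extend v) D = extend (Matrix.vecMul v (block h D n)) := by
  funext c
  by_cases hc : h c = n
  · have := vecMul_apply_level hD (extend v) (⟨c, hc⟩ : Level h n)
    simp only [extend_coe] at this
    rw [this]
    exact (extend_coe (Matrix.vecMul v (block h D n)) (⟨c, hc⟩ : Level h n)).symm
  · rw [extend_of_ne _ hc]
    refine Finset.sum_eq_zero fun r _ => ?_
    by_contra h0
    have h1 := hD r c (right_ne_zero_of_mul h0)
    exact left_ne_zero_of_mul h0 (extend_of_ne v (by omega))

lemma mulVec_extend (hD : ∀ r c, D r c ≠ 0 → h r = h c + 1) {n : ℕ} (v : Level h n → R) :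
    D.mulVec (extend v) = extend ((block h D n).mulVec v) := by
  funext r
  by_cases hr : h r = n + 1
  · have := mulVec_apply_level hD (extend v) (⟨r, hr⟩ : Level h (n + 1))
    simp only [extend_coe] at this
    rw [this]
    exact (extend_coe ((block h D n).mulVec v) (⟨r, hr⟩ : Level h (n + 1))).symm
  · rw [extend_of_ne _ hr]
    refine Finset.sum_eq_zero fun c _ => ?_
    by_contra h0
    have h1 := hD r c (left_ne_zero_of_mul h0)
    exact right_ne_zero_of_mul h0 (extend_of_ne v (by omega))

lemma block_mul_block (hD : ∀ r c, D r c ≠ 0 → h r = h c + 1) (hDD : D * D = 0) (n : ℕ) :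
    block h D (n + 1) * block h D n = 0 := by
  classical
  ext r c
  have h1 : (D * D) r c = 0 := by rw [hDD]; rfl
  rw [Matrix.mul_apply, Fintype.sum_eq_sum_subtype_of_ne_zero (p := fun j => h j = n + 1)] at h1
  · exact h1
  · intro j hj
    rw [hD j c (right_ne_zero_of_mul hj), c.2]

variable (h D)

/-- The chain complex of free modules with total differential `D`. -/
noncomputable abbrev chainComplex (hD : ∀ r c, D r c ≠ 0 → h r = h c + 1) (hDD : D * D = 0) :
    ChainComplex (ModuleCat.{u} R) ℕ :=
  ChainComplex.of (fun n => ModuleCat.of R (Level h n → R))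
    (fun n => ModuleCat.ofHom (Matrix.vecMulLinear (block h D n)))
    (fun n => by
      ext v : 2
      simp [Matrix.vecMul_vecMul, block_mul_block hD hDD])

variable (hD : ∀ r c, D r c ≠ 0 → h r = h c + 1) (hDD : D * D = 0)

lemma chainComplex_d (n : ℕ) : (chainComplex h D hD hDD).d (n + 1) n =
    ModuleCat.ofHom (Matrix.vecMulLinear (block h D n)) :=
  by simp [chainComplex]

end MatrixComplex

/-! ### Dualizing data compute the groups `Ext` -/

namespace IsDualizing

open MatrixComplex

variable {k : Type u} {A : Type u} [Field k] [Ring A] [Algebra k A]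
variable {ι : Type} [Fintype ι] [DecidableEq ι]
variable {ν : A →ₐ[k] A} {d : ℕ} {h : ι → ℕ} {o t : ι} {D : Matrix ι ι (Env k A)}
variable (H : IsDualizing ν d h o t D)

include H

lemma h_bot : h o = 0 := (H.bot_iff o).2 rfl

lemma h_top : h t = d := (H.top_iff t).2 rfl

/-- The correction term in `row` sits at `o`, in degree `0`, and is invisible in degree `n + 1`. -/
lemma block_exact (n : ℕ) (v : Level h (n + 1) → Env k A)
    (hv : Matrix.vecMul v (block h D n) = 0) :
    ∃ u, Matrix.vecMul u (block h D (n + 1)) = v := by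
  obtain ⟨u, s, hus⟩ := H.row (extend v) (by
    rw [vecMul_extend H.degree, hv]; funext r; simp [extend])
  refine ⟨fun r => u r, funext fun c => ?_⟩
  have h1 := congrFun hus c
  rw [extend_coe, Pi.add_apply, vecMul_apply_level H.degree, Pi.single_eq_of_ne, add_zero] at h1
  · exact h1.symm
  · intro h2
    have := c.2
    rw [h2, H.h_bot] at this
    omega

lemma extend_zero_eq (v : Level h 0 → Env k A) :
    extend v = Pi.single o (v ⟨o, H.h_bot⟩) := by
  funext r
  by_cases hr : r = o
  · subst hr
    simp [extend, H.h_bot]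
  · rw [Pi.single_eq_of_ne hr, extend_of_ne _ fun h0 => hr ((H.bot_iff r).1 h0)]

lemma extend_top_eq (v : Level h d → Env k A) :
    extend v = Pi.single t (v ⟨t, H.h_top⟩) := by
  funext r
  by_cases hr : r = t
  · subst hr
    simp [extend, H.h_top]
  · rw [Pi.single_eq_of_ne hr, extend_of_ne _ fun h0 => hr ((H.top_iff r).1 h0)]

lemma leftEval_vecMul_block (v : Level h 1 → Env k A) :
    leftEval k A (Matrix.vecMul v (block h D 0) ⟨o, H.h_bot⟩) = 0 :=
  (H.bottom _).1 ⟨extend v, by rw [vecMul_extend H.degree, H.extend_zero_eq]⟩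

lemma exists_vecMul_block (v : Level h 0 → Env k A)
    (hv : leftEval k A (v ⟨o, H.h_bot⟩) = 0) : ∃ u, Matrix.vecMul u (block h D 0) = v := by
  obtain ⟨u, hu⟩ := (H.bottom _).2 hv
  refine ⟨fun r => u r, funext fun c => ?_⟩
  rw [← vecMul_apply_level H.degree, hu, ← H.extend_zero_eq, extend_coe]

/-- The augmentation of the free complex. -/
noncomputable def augmentation : ModuleCat.of (Env k A) (Level h 0 → Env k A) ⟶ diagonal k A :=
  letI : Module (Env k A) A := instModuleTensorProductMop k A
  ModuleCat.ofHom (Y := A)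
    ((LinearMap.toSpanSingleton (Env k A) A 1).comp (LinearMap.proj ⟨o, H.h_bot⟩))

lemma augmentation_apply (v : Level h 0 → Env k A) :
    H.augmentation.hom v = leftEval k A (v ⟨o, H.h_bot⟩) :=
  smul_one_eq_leftEval _

lemma d_comp_augmentation :
    (chainComplex h D H.degree H.sq).d 1 0 ≫ H.augmentation = 0 := by
  rw [chainComplex_d]
  refine ModuleCat.hom_ext (DFunLike.ext _ _ fun v => ?_)
  exact (H.augmentation_apply _).trans (H.leftEval_vecMul_block v)

/-- The projective resolution of the diagonal bimodule given by the total differential `D`. -/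
noncomputable def resolution : ProjectiveResolution (diagonal k A) where
  complex := chainComplex h D H.degree H.sq
  projective n := by
    change Projective (ModuleCat.of (Env k A) (Level h n → Env k A))
    rw [← IsProjective.iff_projective]
    infer_instance
  π := (ChainComplex.toSingle₀Equiv _ _).symm ⟨H.augmentation, H.d_comp_augmentation⟩
  quasiIso := ⟨fun n => by
    have hd (m : ℕ) (v : Level h (m + 1) → Env k A) :
        ((chainComplex h D H.degree H.sq).d (m + 1) m).hom v = Matrix.vecMul v (block h D m) :=
      congrArg (fun φ => φ.hom v) (chainComplex_d h D H.degree H.sq m)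
    cases n with
    | zero =>
      rw [ChainComplex.quasiIsoAt₀_iff, ShortComplex.quasiIso_iff_of_zeros']
      · have h0 := ChainComplex.toSingle₀Equiv_symm_apply_f_zero
          (C := chainComplex h D H.degree H.sq) H.augmentation H.d_comp_augmentation
        have hπ (v : Level h 0 → Env k A) := (congrArg
          (fun φ : (chainComplex h D H.degree H.sq).X 0 ⟶ diagonal k A => φ.hom v) h0).trans
          (H.augmentation_apply v)
        constructor
        · rw [ShortComplex.moduleCat_exact_iff]
          intro (v : Level h 0 → Env k A) hv
          obtain ⟨u, hu⟩ := H.exists_vecMul_block v ((hπ v).symm.trans hv)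
          exact ⟨u, (hd 0 u).trans hu⟩
        · rw [ModuleCat.epi_iff_surjective]
          intro (a : A)
          refine ⟨(fun _ => a ⊗ₜ 1 : Level h 0 → Env k A), (hπ _).trans ?_⟩
          simp
      all_goals rfl
    | succ n =>
      rw [quasiIsoAt_iff_exactAt']
      · rw [HomologicalComplex.exactAt_iff' _ (n + 1 + 1) (n + 1) n (by simp) (by simp),
          ShortComplex.moduleCat_exact_iff]
        intro (v : Level h (n + 1) → Env k A) hv
        obtain ⟨u, hu⟩ := H.block_exact n v ((hd n v).symm.trans hv)
        exact ⟨u, (hd (n + 1) u).trans hu⟩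
      · apply ChainComplex.exactAt_succ_single_obj⟩

lemma homologicallySmooth : HomologicallySmooth k A := by
  refine ⟨H.resolution, fun n => ?_, d, fun n hn => ?_⟩
  · change Module.Finite (Env k A) (Level h n → Env k A)
    infer_instance
  · have : IsEmpty (Level h n) := ⟨fun r => by have := H.le_top r.1; have := r.2; omega⟩
    change Limits.IsZero (ModuleCat.of (Env k A) (Level h n → Env k A))
    exact ModuleCat.isZero_of_subsingleton _

/-- The morphism from a term of the resolution to the regular bimodule with given values on the
basis. -/
noncomputable def toRegular (n : ℕ) :
    (Level h n → Env k A) →+ (H.resolution.complex.X n ⟶ regular k A) where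
  toFun φ := ModuleCat.ofHom (X := Level h n → Env k A) (Fintype.linearCombination (Env k A) φ)
  map_zero' := by
    refine ModuleCat.hom_ext (DFunLike.ext _ _ fun (v : Level h n → Env k A) => ?_)
    refine (Fintype.linearCombination_apply (Env k A) _ v).trans ?_
    simp only [Pi.zero_apply, smul_zero, Finset.sum_const_zero]
    rfl
  map_add' φ ψ := by
    refine ModuleCat.hom_ext (DFunLike.ext _ _ fun (v : Level h n → Env k A) => ?_)
    refine (Fintype.linearCombination_apply (Env k A) _ v).trans ?_
    refine Eq.trans ?_ (congrArg₂ (· + ·) (Fintype.linearCombination_apply (Env k A) φ v)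
      (Fintype.linearCombination_apply (Env k A) ψ v)).symm
    simp [mul_add, Finset.sum_add_distrib]

lemma toRegular_apply (n : ℕ) (φ v : Level h n → Env k A) :
    (H.toRegular n φ).hom v = ∑ r, v r * φ r :=
  Fintype.linearCombination_apply (Env k A) φ v

lemma toRegular_injective (n : ℕ) : Function.Injective (H.toRegular n) := fun φ ψ hφ => by
  funext r
  have h1 := congrArg (fun f => ModuleCat.Hom.hom f (Pi.single r 1 : Level h n → Env k A)) hφ
  have h2 := (H.toRegular_apply n φ _).symm.trans (h1.trans (H.toRegular_apply n ψ _))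
  simpa [Pi.single_apply] using h2

lemma toRegular_surjective (n : ℕ) (f : H.resolution.complex.X n ⟶ regular k A) :
    ∃ φ, H.toRegular n φ = f := by
  let f' : (Level h n → Env k A) →ₗ[Env k A] Env k A := f.hom
  refine ⟨fun r => f' (Pi.single r 1), ModuleCat.hom_ext (DFunLike.ext _ _ fun v => ?_)⟩
  refine (H.toRegular_apply n _ v).trans ?_
  change _ = f' v
  conv_rhs => rw [pi_eq_sum_univ' v]
  rw [map_sum]
  refine Finset.sum_congr rfl fun r _ => ?_
  rw [map_smul, smul_eq_mul]

lemma d_toRegular (n : ℕ) (φ : Level h n → Env k A) :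
    H.resolution.complex.d (n + 1) n ≫ H.toRegular n φ =
      H.toRegular (n + 1) ((block h D n).mulVec φ) := by
  refine ModuleCat.hom_ext (DFunLike.ext _ _ fun (v : Level h (n + 1) → Env k A) => ?_)
  refine Eq.trans ?_ (H.toRegular_apply (n + 1) _ v).symm
  have hd : (H.resolution.complex.d (n + 1) n).hom v = Matrix.vecMul v (block h D n) :=
    congrArg (fun φ => φ.hom v) (chainComplex_d h D H.degree H.sq n)
  refine (congrArg (H.toRegular n φ).hom hd).trans ((H.toRegular_apply n _ _).trans ?_)
  exact (Matrix.dotProduct_mulVec v (block h D n) φ).symm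

lemma toRegular_comp_rightMul (n : ℕ) (φ : Level h n → Env k A) (w : Env k A) :
    H.toRegular n φ ≫ rightMul k w = H.toRegular n (fun r => φ r * w) := by
  refine ModuleCat.hom_ext (DFunLike.ext _ _ fun (v : Level h n → Env k A) => ?_)
  refine Eq.trans ?_ (H.toRegular_apply n _ v).symm
  refine (congrArg (rightMul k w).hom (H.toRegular_apply n φ v)).trans ?_
  simp [rightMul, mul_assoc]

lemma ext_eq_zero (i : ℕ) (hi : i ≠ d) (ξ : ExtEnv k A i) : ξ = 0 := by
  obtain ⟨f, hf, rfl⟩ := H.resolution.extMk_surjective ξ (i + 1) rfl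
  obtain ⟨φ, rfl⟩ := H.toRegular_surjective i f
  rw [d_toRegular, ← (H.toRegular (i + 1)).map_zero, (H.toRegular_injective _).eq_iff] at hf
  have h1 : D.mulVec (extend φ) = 0 := by
    rw [mulVec_extend H.degree, hf]; funext r; simp [extend]
  obtain ⟨u, s, hus⟩ := H.col _ h1
  -- The correction term in `col` sits at `t`, in degree `d`, which differs from `i`.
  have h2 (r : Level h i) : φ r = D.mulVec u r := by
    have h3 := congrFun hus r
    rwa [extend_coe, Pi.add_apply, Pi.single_eq_of_ne, add_zero] at h3
    intro h4
    have := r.2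
    rw [h4, H.h_top] at this
    exact hi this.symm
  cases i with
  | zero =>
    -- Nothing maps into cochain degree `0`, so the cocycle itself is zero.
    have h3 : φ = 0 := funext fun r => (h2 r).trans (mulVec_apply_zero H.degree u r.2)
    subst h3
    simp
  | succ p =>
    rw [H.resolution.extMk_eq_zero_iff _ _ _ _ p rfl]
    refine ⟨H.toRegular p fun r => u r, ?_⟩
    rw [d_toRegular]
    congr 1
    funext r
    rw [h2 r, mulVec_apply_level H.degree]

lemma d_comp_toRegular_top (s : Env k A) :
    H.resolution.complex.d (d + 1) d ≫ H.toRegular d (fun _ => s) = 0 := by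
  have : IsEmpty (Level h (d + 1)) :=
    ⟨fun r => by have := H.le_top r.1; have := r.2; omega⟩
  rw [d_toRegular, ← (H.toRegular (d + 1)).map_zero]
  congr 1
  exact Subsingleton.elim _ _

/-- The class in the top `Ext` group given by an element of the enveloping algebra. -/
noncomputable def topClass : Env k A →+ ExtEnv k A d where
  toFun s := H.resolution.extMk (H.toRegular d fun _ => s) (d + 1) rfl
    (H.d_comp_toRegular_top s)
  map_zero' := by
    simp only [← Pi.zero_def, map_zero, ProjectiveResolution.extMk_zero]
  map_add' x y := by
    rw [ProjectiveResolution.add_extMk]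
    congr 1
    exact (H.toRegular d).map_add (fun _ => x) (fun _ => y)

lemma topClass_surjective : Function.Surjective H.topClass := fun ξ => by
  obtain ⟨f, hf, rfl⟩ := H.resolution.extMk_surjective ξ (d + 1) rfl
  obtain ⟨φ, rfl⟩ := H.toRegular_surjective d f
  refine ⟨φ ⟨t, H.h_top⟩, ?_⟩
  have : φ = fun _ => φ ⟨t, H.h_top⟩ :=
    funext fun r => congrArg φ (Subtype.ext ((H.top_iff r.1).1 r.2))
  simp only [topClass, AddMonoidHom.coe_mk, ZeroHom.coe_mk]
  congr 2
  exact this.symm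

/-- A class vanishes when its representative is a coboundary from degree `d - 1`, which is what
`top` describes. The hypothesis `hd` provides that degree. -/
lemma topClass_eq_zero_iff (hd : d ≠ 0) (s : Env k A) :
    H.topClass s = 0 ↔ rightEval ν s = 0 := by
  obtain ⟨p, rfl⟩ := Nat.exists_eq_succ_of_ne_zero hd
  refine (H.resolution.extMk_eq_zero_iff _ (p + 1 + 1) rfl (H.d_comp_toRegular_top s) p rfl).trans (Iff.trans ?_ (H.top s))
  constructor
  · rintro ⟨g, hg⟩
    obtain ⟨φ, rfl⟩ := H.toRegular_surjective p g
    rw [d_toRegular, (H.toRegular_injective _).eq_iff] at hg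
    refine ⟨extend φ, ?_⟩
    rw [mulVec_extend H.degree, hg, H.extend_top_eq]
  · rintro ⟨u, hu⟩
    refine ⟨H.toRegular p fun r => u r, ?_⟩
    rw [d_toRegular]
    congr 1
    funext r
    rw [← mulVec_apply_level H.degree, hu, (H.top_iff r.1).1 r.2, Pi.single_eq_same]

lemma innerAct_topClass (b : A) (s : Env k A) (a : A) :
    innerAct b (H.topClass s) a = H.topClass (s * (a ⊗ₜ op b)) := by
  refine (H.resolution.extMk_comp_mk₀ _ (d + 1) rfl (H.d_comp_toRegular_top s) _).trans ?_
  simp only [topClass, AddMonoidHom.coe_mk, ZeroHom.coe_mk]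
  congr 1
  exact H.toRegular_comp_rightMul d _ _

-- `topClass` and `rightEval ν` are surjections from the enveloping algebra with the same kernel,
-- and both respect right multiplication by `a ⊗ b`; the isomorphism is the induced map on
-- quotients.
omit H in
theorem isTwistedCalabiYau {ν : A ≃ₐ[k] A} (H : IsDualizing (ν : A →ₐ[k] A) d h o t D)
    (hd : d ≠ 0) : IsTwistedCalabiYau k ν d where
  smooth := H.homologicallySmooth
  ext_eq_zero := H.ext_eq_zero
  ext_top := by
    let η : Env k A →+ A := (rightEval (ν : A →ₐ[k] A)).toAddMonoidHom
    have hker : H.topClass.ker = η.ker := by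
      ext s
      exact H.topClass_eq_zero_iff hd s
    let e₁ := QuotientAddGroup.quotientKerEquivOfSurjective H.topClass H.topClass_surjective
    let e₂ := QuotientAddGroup.quotientKerEquivOfSurjective η
      (rightEval_surjective (ν : A →ₐ[k] A))
    let e := e₁.symm.trans ((QuotientAddGroup.quotientAddEquivOfEq hker).trans e₂)
    have he (s : Env k A) : e (H.topClass s) = rightEval (ν : A →ₐ[k] A) s := by
      have : e₁.symm (H.topClass s) = QuotientAddGroup.mk s := by
        rw [AddEquiv.symm_apply_eq]; rfl
      simp only [e, AddEquiv.trans_apply, this]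
      rfl
    refine ⟨e, fun b ξ a => ?_⟩
    obtain ⟨s, rfl⟩ := H.topClass_surjective ξ
    rw [innerAct_topClass, he, he, rightEval_mul_tmul]
    rfl

end IsDualizing

/-! ### Exactness under free base change -/

section FreeBaseChange

variable {R S I : Type*} [Ring R] [Ring S]

/-- `S` is a free right module over `R` along `F` with basis `e`. -/
structure RightFree (F : R →+* S) (e : I → S) : Prop where
  span : ∀ s, ∃ p : I →₀ R, (p.sum fun i r => e i * F r) = s
  indep : ∀ p : I →₀ R, (p.sum fun i r => e i * F r) = 0 → p = 0

/-- `S` is a free left module over `R` along `F` with basis `e`. -/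
structure LeftFree (F : R →+* S) (e : I → S) : Prop where
  span : ∀ s, ∃ p : I →₀ R, (p.sum fun i r => F r * e i) = s
  indep : ∀ p : I →₀ R, (p.sum fun i r => F r * e i) = 0 → p = 0

variable {F : R →+* S} {e : I → S} {ι : Type*} [Fintype ι] [DecidableEq ι]
variable {D : Matrix ι ι R} {o : ι}

/-- The matrix acts on row vectors from the right, hence coefficientwise in expansions `∑ e i * F (p
i)`. Exactness over `R` is applied to each coefficient. -/
lemma RightFree.row_exact (hF : RightFree F e)
    (hD : ∀ v, Matrix.vecMul v D = 0 → ∃ u s, v = Matrix.vecMul u D + Pi.single o s)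
    (v : ι → S) (hv : Matrix.vecMul v (D.map F) = 0) :
    ∃ u s, v = Matrix.vecMul u (D.map F) + Pi.single o s := by
  classical
  choose p hp using fun r => hF.span (v r)
  have h1 (i : I) : Matrix.vecMul (fun r => p r i) D = 0 := by
    funext c
    have h2 : (∑ r, (p r).mapRange (· * D r c) (zero_mul _)) = 0 := by
      apply hF.indep
      rw [← Finsupp.sum_finsetSum_index (by simp) (by simp [mul_add])]
      refine Eq.trans ?_ (congrFun hv c)
      refine Finset.sum_congr rfl fun r _ => ?_
      rw [Finsupp.sum_mapRange_index (by simp), ← hp r, Finsupp.sum, Finsupp.sum, Finset.sum_mul]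
      simp [mul_assoc]
    simpa [Finsupp.finsetSum_apply, Matrix.vecMul, dotProduct] using DFunLike.congr_fun h2 i
  choose u s hus using fun i => hD _ (h1 i)
  -- Only finitely many basis elements occur in the finitely many coordinates of `v`.
  let T : Finset I := Finset.univ.biUnion fun r => (p r).support
  refine ⟨fun c => ∑ i ∈ T, e i * F (u i c), ∑ i ∈ T, e i * F (s i), funext fun r => ?_⟩
  have h3 : v r = ∑ i ∈ T, e i * F (p r i) := by
    rw [← hp r]
    refine Finsupp.sum_of_support_subset _ (fun i hi => ?_) _ (by simp)
    exact Finset.mem_biUnion.2 ⟨r, Finset.mem_univ _, hi⟩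
  have h4 : (Pi.single o (∑ i ∈ T, e i * F (s i)) : ι → S) r =
      ∑ i ∈ T, e i * F ((Pi.single o (s i) : ι → R) r) := by
    by_cases h : r = o
    · subst h; simp
    · simp [Pi.single_eq_of_ne h]
  rw [Pi.add_apply, h3, h4]
  simp only [Matrix.vecMul, dotProduct, Matrix.map_apply, Finset.sum_mul]
  rw [Finset.sum_comm, ← Finset.sum_add_distrib]
  refine Finset.sum_congr rfl fun i _ => ?_
  have h5 : p r i = _ := congrFun (hus i) r
  rw [h5]
  simp [Matrix.vecMul, dotProduct, mul_add, Finset.mul_sum, mul_assoc]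

lemma LeftFree.col_exact (hF : LeftFree F e)
    (hD : ∀ v, D.mulVec v = 0 → ∃ u s, v = D.mulVec u + Pi.single o s)
    (v : ι → S) (hv : (D.map F).mulVec v = 0) :
    ∃ u s, v = (D.map F).mulVec u + Pi.single o s := by
  classical
  choose p hp using fun r => hF.span (v r)
  have h1 (i : I) : D.mulVec (fun r => p r i) = 0 := by
    funext c
    have h2 : (∑ r, (p r).mapRange (D c r * ·) (mul_zero _)) = 0 := by
      apply hF.indep
      rw [← Finsupp.sum_finsetSum_index (by simp) (by simp [add_mul])]
      refine Eq.trans ?_ (congrFun hv c)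
      refine Finset.sum_congr rfl fun r _ => ?_
      rw [Finsupp.sum_mapRange_index (by simp), ← hp r, Finsupp.sum, Finsupp.sum, Finset.mul_sum]
      simp [mul_assoc]
    simpa [Finsupp.finsetSum_apply, Matrix.mulVec, dotProduct] using DFunLike.congr_fun h2 i
  choose u s hus using fun i => hD _ (h1 i)
  let T : Finset I := Finset.univ.biUnion fun r => (p r).support
  refine ⟨fun c => ∑ i ∈ T, F (u i c) * e i, ∑ i ∈ T, F (s i) * e i, funext fun r => ?_⟩
  have h3 : v r = ∑ i ∈ T, F (p r i) * e i := by
    rw [← hp r]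
    refine Finsupp.sum_of_support_subset _ (fun i hi => ?_) _ (by simp)
    exact Finset.mem_biUnion.2 ⟨r, Finset.mem_univ _, hi⟩
  have h4 : (Pi.single o (∑ i ∈ T, F (s i) * e i) : ι → S) r =
      ∑ i ∈ T, F ((Pi.single o (s i) : ι → R) r) * e i := by
    by_cases h : r = o
    · subst h; simp
    · simp [Pi.single_eq_of_ne h]
  rw [Pi.add_apply, h3, h4]
  simp only [Matrix.mulVec, dotProduct, Matrix.map_apply, Finset.mul_sum]
  rw [Finset.sum_comm, ← Finset.sum_add_distrib]
  refine Finset.sum_congr rfl fun i _ => ?_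
  have h5 : p r i = _ := congrFun (hus i) r
  rw [h5]
  simp [Matrix.mulVec, dotProduct, add_mul, Finset.sum_mul, mul_assoc]

/-- Precomposing with an automorphism of the base preserves freeness. -/
lemma RightFree.comp (hF : RightFree F e) (τ : R ≃+* R) :
    RightFree (F.comp (τ : R →+* R)) e where
  span s := by
    obtain ⟨p, hp⟩ := hF.span s
    refine ⟨p.mapRange τ.symm (map_zero _), ?_⟩
    rw [Finsupp.sum_mapRange_index (by simp)]
    simpa using hp
  indep p hp := by
    have := hF.indep (p.mapRange τ (map_zero _)) (by
      rw [Finsupp.sum_mapRange_index (by simp)]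
      simpa using hp)
    ext i
    simpa using DFunLike.congr_fun this i

lemma LeftFree.comp (hF : LeftFree F e) (τ : R ≃+* R) :
    LeftFree (F.comp (τ : R →+* R)) e where
  span s := by
    obtain ⟨p, hp⟩ := hF.span s
    refine ⟨p.mapRange τ.symm (map_zero _), ?_⟩
    rw [Finsupp.sum_mapRange_index (by simp)]
    simpa using hp
  indep p hp := by
    have := hF.indep (p.mapRange τ (map_zero _)) (by
      rw [Finsupp.sum_mapRange_index (by simp)]
      simpa using hp)
    ext i
    simpa using DFunLike.congr_fun this i

lemma LeftFree.opposite (hF : LeftFree F e) : RightFree (RingHom.op F) (fun i => op (e i)) where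
  span s := by
    obtain ⟨p, hp⟩ := hF.span (unop s)
    refine ⟨p.mapRange op (op_zero), ?_⟩
    rw [Finsupp.sum_mapRange_index (by simp)]
    apply unop_injective
    simpa [Finsupp.sum] using hp
  indep p hp := by
    have := hF.indep (p.mapRange unop (unop_zero)) (by
      rw [Finsupp.sum_mapRange_index (by simp)]
      apply op_injective
      simpa [Finsupp.sum] using hp)
    ext i
    apply unop_injective
    simpa using DFunLike.congr_fun this i

lemma RightFree.opposite (hF : RightFree F e) : LeftFree (RingHom.op F) (fun i => op (e i)) where
  span s := by
    obtain ⟨p, hp⟩ := hF.span (unop s)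
    refine ⟨p.mapRange op (op_zero), ?_⟩
    rw [Finsupp.sum_mapRange_index (by simp)]
    apply unop_injective
    simpa [Finsupp.sum] using hp
  indep p hp := by
    have := hF.indep (p.mapRange unop (unop_zero)) (by
      rw [Finsupp.sum_mapRange_index (by simp)]
      apply op_injective
      simpa [Finsupp.sum] using hp)
    ext i
    apply unop_injective
    simpa using DFunLike.congr_fun this i

end FreeBaseChange

/-! ### Freeness of tensor products of algebras -/

section FreeTensor

variable {k : Type*} [Field k] {A B A' B' : Type*} [Ring A] [Ring B] [Ring A'] [Ring B']
  [Algebra k A] [Algebra k B] [Algebra k A'] [Algebra k B'] {I I' : Type*}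

/-- The linear map `p ↦ ∑ i, e i * f (p i)`. -/
noncomputable def rightComb (f : B →ₐ[k] A) (e : I → A) : (I →₀ B) →ₗ[k] A :=
  Finsupp.lsum k fun i => (LinearMap.mulLeft k (e i)).comp f.toLinearMap

/-- The linear map `p ↦ ∑ i, f (p i) * e i`. -/
noncomputable def leftComb (f : B →ₐ[k] A) (e : I → A) : (I →₀ B) →ₗ[k] A :=
  Finsupp.lsum k fun i => (LinearMap.mulRight k (e i)).comp f.toLinearMap

lemma rightComb_apply (f : B →ₐ[k] A) (e : I → A) (p : I →₀ B) :
    rightComb f e p = p.sum fun i r => e i * f r := by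
  simp [rightComb, Function.comp_def]

lemma leftComb_apply (f : B →ₐ[k] A) (e : I → A) (p : I →₀ B) :
    leftComb f e p = p.sum fun i r => f r * e i := by
  simp [leftComb, Function.comp_def]

lemma rightFree_iff (f : B →ₐ[k] A) (e : I → A) :
    RightFree (f : B →+* A) e ↔ Function.Bijective (rightComb f e) := by
  constructor
  · refine fun h => ⟨(injective_iff_map_eq_zero _).2 fun p hp => h.indep p ?_, fun s => ?_⟩
    · simpa [rightComb_apply] using hp
    · simpa [rightComb_apply] using h.span s
  · refine fun h => ⟨fun s => ?_, fun p hp => (injective_iff_map_eq_zero _).1 h.1 p ?_⟩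
    · simpa [rightComb_apply] using h.2 s
    · simpa [rightComb_apply] using hp

lemma leftFree_iff (f : B →ₐ[k] A) (e : I → A) :
    LeftFree (f : B →+* A) e ↔ Function.Bijective (leftComb f e) := by
  constructor
  · refine fun h => ⟨(injective_iff_map_eq_zero _).2 fun p hp => h.indep p ?_, fun s => ?_⟩
    · simpa [leftComb_apply] using hp
    · simpa [leftComb_apply] using h.span s
  · refine fun h => ⟨fun s => ?_, fun p hp => (injective_iff_map_eq_zero _).1 h.1 p ?_⟩
    · simpa [leftComb_apply] using h.2 s
    · simpa [leftComb_apply] using hp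

/-- Over a field the tensor product of the two coordinate isomorphisms is again an isomorphism, and
it is the coordinate map of the product basis. -/
lemma RightFree.tensor {f : B →ₐ[k] A} {e : I → A} {f' : B' →ₐ[k] A'} {e' : I' → A'}
    (h : RightFree (f : B →+* A) e) (h' : RightFree (f' : B' →+* A') e') :
    RightFree (Algebra.TensorProduct.map f f' : B ⊗[k] B' →+* A ⊗[k] A')
      (fun i : I × I' => e i.1 ⊗ₜ[k] e' i.2) := by
  classical
  rw [rightFree_iff] at h h' ⊢
  let E := TensorProduct.congr (LinearEquiv.ofBijective _ h) (LinearEquiv.ofBijective _ h')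
  have hE : rightComb (Algebra.TensorProduct.map f f') (fun i : I × I' => e i.1 ⊗ₜ[k] e' i.2) =
      ((finsuppTensorFinsupp k k B B' I I').symm.trans E).toLinearMap := by
    refine Finsupp.lhom_ext' fun i => TensorProduct.ext' fun b b' => ?_
    simp [rightComb, E]
  rw [hE]
  exact LinearEquiv.bijective _

lemma LeftFree.tensor {f : B →ₐ[k] A} {e : I → A} {f' : B' →ₐ[k] A'} {e' : I' → A'}
    (h : LeftFree (f : B →+* A) e) (h' : LeftFree (f' : B' →+* A') e') :
    LeftFree (Algebra.TensorProduct.map f f' : B ⊗[k] B' →+* A ⊗[k] A')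
      (fun i : I × I' => e i.1 ⊗ₜ[k] e' i.2) := by
  classical
  rw [leftFree_iff] at h h' ⊢
  let E := TensorProduct.congr (LinearEquiv.ofBijective _ h) (LinearEquiv.ofBijective _ h')
  have hE : leftComb (Algebra.TensorProduct.map f f') (fun i : I × I' => e i.1 ⊗ₜ[k] e' i.2) =
      ((finsuppTensorFinsupp k k B B' I I').symm.trans E).toLinearMap := by
    refine Finsupp.lhom_ext' fun i => TensorProduct.ext' fun b b' => ?_
    simp [leftComb, E]
  rw [hE]
  exact LinearEquiv.bijective _

end FreeTensor

/-! ### Ore extensions -/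

section Ore

variable {k : Type*} [Field k] {A B : Type*} [Ring A] [Ring B] [Algebra k A] [Algebra k B]

/-- `A` is the Ore extension `B[x; σ, δ]`. -/
structure IsOre (f : B →ₐ[k] A) (x : A) (σ : B ≃ₐ[k] B) (δ : B →ₗ[k] B) : Prop where
  comm : ∀ b, x * f b = f (σ b) * x + f (δ b)
  free : LeftFree (f : B →+* A) (fun i : ℕ => x ^ i)

namespace IsOre

variable {f : B →ₐ[k] A} {x : A} {σ : B ≃ₐ[k] B} {δ : B →ₗ[k] B} (H : IsOre f x σ δ)

include H

lemma bijective : Function.Bijective (leftComb f fun i : ℕ => x ^ i) :=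
  (leftFree_iff _ _).1 H.free

/-- The coefficients of an element of an Ore extension. -/
noncomputable def coef : A ≃ₗ[k] (ℕ →₀ B) := (LinearEquiv.ofBijective _ H.bijective).symm

@[simp] lemma coef_mul_pow (b : B) (i : ℕ) : H.coef (f b * x ^ i) = Finsupp.single i b := by
  rw [coef, LinearEquiv.symm_apply_eq]
  simp [leftComb]

lemma induction {P : A → Prop} (hz : P 0) (hadd : ∀ a b, P a → P b → P (a + b))
    (hm : ∀ b i, P (f b * x ^ i)) (a : A) : P a := by
  obtain ⟨p, rfl⟩ := H.bijective.2 a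
  induction p using Finsupp.induction_linear with
  | zero => simpa using hz
  | add p q hp hq => rw [map_add]; exact hadd _ _ hp hq
  | single i b => simpa [leftComb] using hm b i

@[simp] lemma coef_coe (b : B) : H.coef (f b) = Finsupp.single 0 b := by
  simpa using H.coef_mul_pow b 0

lemma injective : Function.Injective f := fun b c h => by
  have := congrArg H.coef h
  exact Finsupp.single_injective 0 (by simpa using this)

lemma comm_mul_pow (b : B) (i : ℕ) :
    x * (f b * x ^ i) = f (σ b) * x ^ (i + 1) + f (δ b) * x ^ i := by
  rw [← mul_assoc, H.comm, add_mul, mul_assoc, ← pow_succ']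

lemma coef_mul_left_succ (a : A) (j : ℕ) :
    H.coef (x * a) (j + 1) = σ (H.coef a j) + δ (H.coef a (j + 1)) := by
  induction a using H.induction with
  | hz => simp
  | hadd a b ha hb => simp only [mul_add, map_add, Finsupp.add_apply, ha, hb]; abel
  | hm b i =>
    rw [H.comm_mul_pow]
    simp only [map_add, coef_mul_pow, Finsupp.add_apply, Finsupp.single_apply]
    split_ifs <;> first | omega | simp

lemma leibniz (b c : B) : δ (b * c) = σ b * δ c + δ b * c := by
  have h1 : x * f (b * c) = f (σ (b * c)) * x ^ 1 + f (σ b * δ c + δ b * c) * x ^ 0 := by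
    rw [map_mul, ← mul_assoc, H.comm, add_mul, mul_assoc, H.comm, mul_add]
    simp only [map_mul, map_add, pow_one, pow_zero, mul_one, mul_assoc, add_assoc]
  rw [H.comm] at h1
  simpa using H.injective (by simpa using h1)

lemma map_one : δ 1 = 0 := by
  simpa using H.leibniz 1 1

/-- Moving `b` leftwards past `x ^ n` keeps the degree and twists the leading coefficient by `σ ^
n`. -/
lemma coef_pow_mul (n : ℕ) (b : B) :
    (∀ j, n < j → H.coef (x ^ n * f b) j = 0) ∧ H.coef (x ^ n * f b) n = (σ ^ n) b := by
  induction n with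
  | zero => exact ⟨fun j hj => by simp [hj.ne], by simp⟩
  | succ n ih =>
    rw [pow_succ', mul_assoc]
    refine ⟨fun j hj => ?_, ?_⟩
    · obtain ⟨j, rfl⟩ := Nat.exists_eq_succ_of_ne_zero (by omega : j ≠ 0)
      rw [Nat.succ_eq_add_one, H.coef_mul_left_succ, ih.1 j (by omega), ih.1 (j + 1) (by omega)]
      simp
    · rw [H.coef_mul_left_succ, ih.2, ih.1 (n + 1) (by omega), pow_succ']
      simp

/-- Both halves rest on `σ` being bijective: a relation would have leading coefficient `σ ^ n` of a
nonzero element, and `f b * x` can be rewritten with `x` on the left by means of `σ.symm`. -/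
lemma rightFree : RightFree (f : B →+* A) (fun i : ℕ => x ^ i) := by
  rw [rightFree_iff]
  constructor
  · refine (injective_iff_map_eq_zero _).2 fun p hp => ?_
    by_contra h0
    let n := p.support.max' (Finsupp.support_nonempty_iff.2 h0)
    have hn : n ∈ p.support := Finset.max'_mem _ _
    have hle : ∀ i ∈ p.support, i ≤ n := fun i hi => Finset.le_max' _ _ hi
    have h1 : H.coef (rightComb f (fun i : ℕ => x ^ i) p) n = (σ ^ n) (p n) := by
      rw [rightComb_apply, Finsupp.sum, map_sum, Finsupp.finsetSum_apply,
        Finset.sum_eq_single_of_mem n hn, (H.coef_pow_mul n _).2]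
      exact fun i hi hne => (H.coef_pow_mul i _).1 n (lt_of_le_of_ne (hle i hi) hne)
    rw [hp] at h1
    have h2 : (σ ^ n) (p n) = 0 := by simpa using h1.symm
    exact Finsupp.mem_support_iff.1 hn ((map_eq_zero_iff _ (σ ^ n).injective).1 h2)
  · let M := LinearMap.range (rightComb f fun i : ℕ => x ^ i)
    have hM (i : ℕ) (c : B) : x ^ i * f c ∈ M := ⟨Finsupp.single i c, by simp [rightComb]⟩
    have hx (a : A) (ha : a ∈ M) : x * a ∈ M := by
      obtain ⟨p, rfl⟩ := ha
      induction p using Finsupp.induction_linear with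
      | zero => simp
      | add p q hp hq => rw [map_add, mul_add]; exact M.add_mem hp hq
      | single i b => simpa [rightComb, ← mul_assoc, ← pow_succ'] using hM (i + 1) b
    have key (i : ℕ) : ∀ b c, f b * (x ^ i * f c) ∈ M := by
      induction i with
      | zero => intro b c; simpa using hM 0 (b * c)
      | succ i ih =>
        intro b c
        have h1 : f b * x = x * f (σ.symm b) - f (δ (σ.symm b)) := by
          rw [H.comm]; simp
        have h2 : f b * (x ^ (i + 1) * f c) =
            x * (f (σ.symm b) * (x ^ i * f c)) - f (δ (σ.symm b)) * (x ^ i * f c) := by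
          rw [pow_succ', mul_assoc, ← mul_assoc, h1, sub_mul, mul_assoc]
        rw [h2]
        exact M.sub_mem (hx _ (ih _ _)) (ih _ _)
    intro a
    change a ∈ M
    induction a using H.induction with
    | hz => exact M.zero_mem
    | hadd a b ha hb => exact M.add_mem ha hb
    | hm b i => simpa using key i b 1

end IsOre

/-- The operator of left multiplication by the variable on `B[x; σ, δ]`. -/
noncomputable def oreShift (σ : B ≃ₐ[k] B) (δ : B →ₗ[k] B) : Module.End k (ℕ →₀ B) :=
  Finsupp.lsum k fun i => (Finsupp.lsingle (i + 1)).comp σ.toLinearMap + (Finsupp.lsingle i).comp δ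

lemma oreShift_single (σ : B ≃ₐ[k] B) (δ : B →ₗ[k] B) (i : ℕ) (b : B) :
    oreShift σ δ (Finsupp.single i b) = Finsupp.single (i + 1) (σ b) + Finsupp.single i (δ b) := by
  simp [oreShift]

lemma oreShift_mul_lsmul {σ : B ≃ₐ[k] B} {δ : B →ₗ[k] B}
    (hδ : ∀ b c, δ (b * c) = σ b * δ c + δ b * c) (b : B) :
    oreShift σ δ * Algebra.lsmul k k (ℕ →₀ B) b =
      Algebra.lsmul k k (ℕ →₀ B) (σ b) * oreShift σ δ + Algebra.lsmul k k (ℕ →₀ B) (δ b) := by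
  refine Finsupp.lhom_ext fun i c => ?_
  simp only [Module.End.mul_apply, LinearMap.add_apply, Algebra.lsmul_coe, Finsupp.smul_single,
    smul_eq_mul, oreShift_single, hδ, map_mul, Finsupp.single_add, smul_add, add_assoc]

/-- Independence of the powers of `x` is tested in the representation on `ℕ →₀ B`: an element `∑ f
(p i) * x ^ i` applied to the basis vector `1` returns `p`. Spanning uses only the commutation rule
and generation. -/
theorem isOre_of_model {f : B →ₐ[k] A} {x : A} {σ : B ≃ₐ[k] B} {δ : B →ₗ[k] B}
    (hδ : ∀ b c, δ (b * c) = σ b * δ c + δ b * c)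
    (comm : ∀ b, x * f b = f (σ b) * x + f (δ b))
    (gen : Algebra.adjoin k (insert x (Set.range f)) = ⊤)
    (φ : A →ₐ[k] Module.End k (ℕ →₀ B)) (hφ : ∀ b, φ (f b) = Algebra.lsmul k k (ℕ →₀ B) b)
    (hx : φ x = oreShift σ δ) : IsOre f x σ δ := by
  have hδ1 : δ 1 = 0 := by simpa using hδ 1 1
  refine ⟨comm, (leftFree_iff _ _).2 ⟨(injective_iff_map_eq_zero _).2 fun p hp => ?_, fun a => ?_⟩⟩
  · have hpow (i : ℕ) : (oreShift σ δ ^ i) (Finsupp.single 0 1) = Finsupp.single i 1 := by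
      induction i with
      | zero => simp
      | succ i ih => rw [pow_succ', Module.End.mul_apply, ih, oreShift_single]; simp [hδ1]
    have h1 := congrArg (fun g : Module.End k (ℕ →₀ B) => g (Finsupp.single 0 1)) (congrArg φ hp)
    rw [leftComb_apply, Finsupp.sum, map_sum] at h1
    simp only [map_mul, map_pow, hφ, hx, map_zero, LinearMap.zero_apply, LinearMap.sum_apply,
      Module.End.mul_apply, hpow, Algebra.lsmul_coe, Finsupp.smul_single, smul_eq_mul,
      mul_one] at h1
    rwa [← Finsupp.sum, Finsupp.sum_single] at h1
  · let M := LinearMap.range (leftComb f fun i : ℕ => x ^ i)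
    have hM (i : ℕ) (c : B) : f c * x ^ i ∈ M := ⟨Finsupp.single i c, by simp [leftComb]⟩
    have hMmul (a : A) (ha : ∀ c i, a * (f c * x ^ i) ∈ M) (m : A) (hm : m ∈ M) : a * m ∈ M := by
      obtain ⟨p, rfl⟩ := hm
      induction p using Finsupp.induction_linear with
      | zero => simp
      | add p q hp hq => rw [map_add, mul_add]; exact M.add_mem hp hq
      | single i b => simpa [leftComb] using ha b i
    have key : ∀ m ∈ M, a * m ∈ M := by
      have ha : a ∈ Algebra.adjoin k (insert x (Set.range f)) := by rw [gen]; trivial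
      induction ha using Algebra.adjoin_induction with
      | mem a ha =>
        refine hMmul a fun c i => ?_
        rcases ha with rfl | ⟨b, rfl⟩
        · rw [← mul_assoc, comm, add_mul, mul_assoc, ← pow_succ']
          exact M.add_mem (hM _ _) (hM _ _)
        · rw [← mul_assoc, ← map_mul]
          exact hM _ _
      | algebraMap r =>
        intro m hm
        rw [← Algebra.smul_def]
        exact M.smul_mem r hm
      | add a b _ _ ha hb => intro m hm; rw [add_mul]; exact M.add_mem (ha m hm) (hb m hm)
      | mul a b _ _ ha hb => intro m hm; rw [mul_assoc]; exact ha _ (hb m hm)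
    change a ∈ M
    simpa using key 1 (by simpa using hM 0 1)

/-- A hom to upper triangular matrices whose diagonal entries are `σ` and `id` on generators
yields a `σ`-derivation. -/
lemma exists_skewDerivation (σ : B ≃ₐ[k] B) (s : Set B) (hs : Algebra.adjoin k s = ⊤)
    (θ : B →ₐ[k] Matrix (Fin 2) (Fin 2) B)
    (hθ : ∀ b ∈ s, θ b 0 0 = σ b ∧ θ b 1 0 = 0 ∧ θ b 1 1 = b) :
    ∃ δ : B →ₗ[k] B, (∀ b, δ b = θ b 0 1) ∧ ∀ b c, δ (b * c) = σ b * δ c + δ b * c := by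
  have h (b : B) : θ b 0 0 = σ b ∧ θ b 1 0 = 0 ∧ θ b 1 1 = b := by
    have hb : b ∈ Algebra.adjoin k s := by rw [hs]; trivial
    induction hb using Algebra.adjoin_induction with
    | mem b hb => exact hθ b hb
    | algebraMap r => simp [Matrix.algebraMap_matrix_apply]
    | add b c _ _ hb hc => simp [hb, hc]
    | mul b c _ _ hb hc => simp [Matrix.mul_apply, Fin.sum_univ_two, hb, hc]
  refine ⟨{ toFun := fun b => θ b 0 1, map_add' := by simp, map_smul' := by simp },
    fun b => rfl, fun b c => ?_⟩
  simp [Matrix.mul_apply, Fin.sum_univ_two, h]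

end Ore

/-! ### Torus actions and bigradings -/

section Torus

variable {k : Type u} [Field k] {A : Type u} [Ring A] [Algebra k A]

/-- The character of the torus `kˣ × kˣ` given by a bidegree. -/
def weight (g : ℤ × ℤ) (p : kˣ × kˣ) : kˣ := p.1 ^ g.1 * p.2 ^ g.2

@[simp] lemma weight_zero (p : kˣ × kˣ) : weight 0 p = 1 := by simp [weight]

lemma weight_add (g h : ℤ × ℤ) (p : kˣ × kˣ) : weight (g + h) p = weight g p * weight h p := by
  simp only [weight, Prod.fst_add, Prod.snd_add, zpow_add]
  exact mul_mul_mul_comm _ _ _ _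

lemma weight_inv (g : ℤ × ℤ) (p : kˣ × kˣ) : weight g p⁻¹ = (weight g p)⁻¹ := by
  simp [weight, mul_comm]

lemma weight_sub (g h : ℤ × ℤ) (p : kˣ × kˣ) : weight (g - h) p = weight g p * (weight h p)⁻¹ := by
  rw [eq_mul_inv_iff_mul_eq, ← weight_add, sub_add_cancel]

/-- The elements of bidegree `g` under the action of the torus. -/
def homog (T : kˣ × kˣ → (A →ₐ[k] A)) (g : ℤ × ℤ) : Submodule k A where
  carrier := {a | ∀ p, T p a = (weight g p : k) • a}
  add_mem' ha hb p := by rw [map_add, ha p, hb p, smul_add]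
  zero_mem' p := by simp
  smul_mem' c a ha p := by rw [map_smul, ha p, smul_comm]

variable {T : kˣ × kˣ → (A →ₐ[k] A)}

lemma one_mem_homog : (1 : A) ∈ homog T 0 := fun p => by simp

lemma mul_mem_homog {g h : ℤ × ℤ} {a b : A} (ha : a ∈ homog T g) (hb : b ∈ homog T h) :
    a * b ∈ homog T (g + h) := fun p => by
  rw [map_mul, ha p, hb p, weight_add, smul_mul_smul_comm, Units.val_mul]

/-- The numbers `2 ^ m * 3 ^ n` are distinct, as their 2-adic and 3-adic valuations show. Hence one
torus element already separates all bidegrees. -/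
lemma weight_two_three_injective [CharZero k] :
    Function.Injective fun g : ℤ × ℤ =>
      (weight g (Units.mk0 (2 : k) two_ne_zero, Units.mk0 (3 : k) three_ne_zero) : k) := by
  intro g h hgh
  have h1 : ((2 : ℚ) ^ g.1 * 3 ^ g.2) = 2 ^ h.1 * 3 ^ h.2 := by
    have : (((2 : ℚ) ^ g.1 * 3 ^ g.2 : ℚ) : k) = ((2 ^ h.1 * 3 ^ h.2 : ℚ) : k) := by
      simpa [weight] using hgh
    exact_mod_cast this
  have h23 : padicValRat 2 3 = 0 := by
    rw [show (3 : ℚ) = ((3 : ℕ) : ℚ) by norm_num, padicValRat.of_nat,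
      padicValNat.eq_zero_of_not_dvd (by norm_num)]; rfl
  have h32 : padicValRat 3 2 = 0 := by
    rw [show (2 : ℚ) = ((2 : ℕ) : ℚ) by norm_num, padicValRat.of_nat,
      padicValNat.eq_zero_of_not_dvd (by norm_num)]; rfl
  have h22 : padicValRat 2 2 = 1 := by
    simpa using padicValRat.self (p := 2) (by norm_num)
  have h33 : padicValRat 3 3 = 1 := by
    simpa using padicValRat.self (p := 3) (by norm_num)
  have : Fact (Nat.Prime 2) := ⟨Nat.prime_two⟩
  have : Fact (Nat.Prime 3) := ⟨Nat.prime_three⟩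
  have e2 := congrArg (padicValRat 2) h1
  have e3 := congrArg (padicValRat 3) h1
  rw [padicValRat.mul (by positivity) (by positivity), padicValRat.mul (by positivity)
    (by positivity), padicValRat.zpow, padicValRat.zpow,
    padicValRat.zpow, padicValRat.zpow] at e2 e3
  rw [h22, h23] at e2
  rw [h32, h33] at e3
  exact Prod.ext (by simpa using e2) (by simpa using e3)

lemma iSupIndep_homog [CharZero k] : iSupIndep (homog T) := by
  let p : kˣ × kˣ := (Units.mk0 (2 : k) two_ne_zero, Units.mk0 (3 : k) three_ne_zero)
  refine ((Module.End.eigenspaces_iSupIndep (T p).toLinearMap).comp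
    weight_two_three_injective).mono fun g a ha => ?_
  exact Module.End.mem_eigenspace_iff.2 (ha p)

/-- The components with degree in `S` exhaust the algebra, and distinct components are independent.
-/
lemma homog_eq_bot [CharZero k] {S : AddSubmonoid (ℤ × ℤ)} (hS : ⨆ g ∈ S, homog T g = ⊤)
    {g : ℤ × ℤ} (hg : g ∉ S) {a : A} (ha : a ∈ homog T g) : a = 0 := by
  have h1 := iSupIndep_homog (T := T) g
  have h2 : (⨆ j, ⨆ (_ : j ≠ g), homog T j) = ⊤ := by
    rw [eq_top_iff, ← hS]
    refine iSup₂_le fun j hj => le_iSup₂_of_le j (fun h => hg (h ▸ hj)) le_rfl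
  rw [h2] at h1
  simpa [disjoint_top.1 h1] using ha

lemma homog_induction {S : AddSubmonoid (ℤ × ℤ)} (hS : ⨆ g ∈ S, homog T g = ⊤) {P : A → Prop}
    (h0 : P 0) (hadd : ∀ a b, P a → P b → P (a + b)) (hh : ∀ g ∈ S, ∀ a ∈ homog T g, P a)
    (a : A) : P a := by
  have ha : a ∈ ⨆ g ∈ S, homog T g := by rw [hS]; trivial
  rw [iSup_subtype'] at ha
  exact Submodule.iSup_induction (fun g : S => homog T g) (motive := P) ha
    (fun g a ha => hh g g.2 a ha) h0 hadd

lemma iSup_homog_eq_top_of_adjoin {S : AddSubmonoid (ℤ × ℤ)} {s : Set A}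
    (hs : Algebra.adjoin k s = ⊤) (h : ∀ a ∈ s, ∃ g ∈ S, a ∈ homog T g) :
    ⨆ g ∈ S, homog T g = ⊤ := by
  have hle {g} (hg : g ∈ S) : homog T g ≤ ⨆ g ∈ S, homog T g := le_iSup₂_of_le g hg le_rfl
  refine eq_top_iff.2 fun a ha => ?_
  clear ha
  -- Stability of the span under left multiplication is the form suited to induction on `adjoin`; it
  -- is evaluated at `m = 1`.
  have key : ∀ m ∈ ⨆ g ∈ S, homog T g, a * m ∈ ⨆ g ∈ S, homog T g := by
    have ha : a ∈ Algebra.adjoin k s := by rw [hs]; trivial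
    induction ha using Algebra.adjoin_induction with
    | mem a ha =>
      obtain ⟨g, hg, hag⟩ := h a ha
      intro m hm
      rw [iSup_subtype'] at hm
      refine Submodule.iSup_induction (fun g : S => homog T g)
        (motive := fun m => a * m ∈ ⨆ g ∈ S, homog T g) hm (fun j m hm => ?_) (by simp)
        (fun x y hx hy => by rw [mul_add]; exact Submodule.add_mem _ hx hy)
      exact hle (S.add_mem hg j.2) (mul_mem_homog hag hm)
    | algebraMap r => intro m hm; rw [← Algebra.smul_def]; exact Submodule.smul_mem _ r hm
    | add a b _ _ ha hb =>
      intro m hm; rw [add_mul]; exact Submodule.add_mem _ (ha m hm) (hb m hm)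
    | mul a b _ _ ha hb => intro m hm; rw [mul_assoc]; exact ha _ (hb m hm)
  simpa using key 1 (hle S.zero_mem one_mem_homog)

/-- The last property lets solutions of homogeneous linear systems be replaced by homogeneous ones.
-/
lemma exists_projection [CharZero k] {S : AddSubmonoid (ℤ × ℤ)} (hS : ⨆ g ∈ S, homog T g = ⊤) :
    ∃ π : ℤ × ℤ → A →+ A, (∀ g a, π g a ∈ homog T g) ∧ (∀ g, ∀ a ∈ homog T g, π g a = a) ∧
      ∀ g h a, ∀ r ∈ homog T h, π (g + h) (a * r) = π g a * r := by
  classical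
  have htop : ⨆ g, homog T g = ⊤ := by
    rw [eq_top_iff, ← hS]
    exact iSup₂_le fun g _ => le_iSup _ g
  let _ : GradedRing (homog T) :=
    { ((DirectSum.isInternal_submodule_iff_iSupIndep_and_iSup_eq_top _).2
        ⟨iSupIndep_homog, htop⟩).chooseDecomposition with
      one_mem := one_mem_homog
      mul_mem := fun _ _ _ _ => mul_mem_homog }
  refine ⟨fun g => GradedRing.proj (homog T) g, fun g a => ?_, fun g a ha => ?_, fun g h a r hr => ?_⟩
  · exact SetLike.coe_mem _
  · rw [GradedRing.proj_apply, DirectSum.decompose_of_mem_same _ ha]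
  · exact DirectSum.coe_decompose_mul_add_of_right_mem (homog T) hr

lemma torus_comm {S : AddSubmonoid (ℤ × ℤ)} (hS : ⨆ g ∈ S, homog T g = ⊤) (p q : kˣ × kˣ) (a : A) :
    T p (T q a) = T q (T p a) := by
  induction a using homog_induction hS with
  | h0 => simp
  | hadd a b ha hb => simp [ha, hb]
  | hh g _ a ha => rw [ha p, ha q, map_smul, map_smul, ha p, ha q, smul_comm]

lemma torus_inv {S : AddSubmonoid (ℤ × ℤ)} (hS : ⨆ g ∈ S, homog T g = ⊤) (p : kˣ × kˣ) (a : A) :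
    T p (T p⁻¹ a) = a := by
  induction a using homog_induction hS with
  | h0 => simp
  | hadd a b ha hb => simp [ha, hb]
  | hh g _ a ha => rw [ha p⁻¹, map_smul, ha p, weight_inv, smul_smul]; simp

/-- The automorphism given by an element of the torus. -/
noncomputable def torusEquiv {S : AddSubmonoid (ℤ × ℤ)} (hS : ⨆ g ∈ S, homog T g = ⊤)
    (p : kˣ × kˣ) : A ≃ₐ[k] A :=
  AlgEquiv.ofAlgHom (T p) (T p⁻¹) (AlgHom.ext fun a => torus_inv hS p a)
    (AlgHom.ext fun a => by simpa using torus_inv hS p⁻¹ a)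

@[simp] lemma torusEquiv_apply {S : AddSubmonoid (ℤ × ℤ)} (hS : ⨆ g ∈ S, homog T g = ⊤)
    (p : kˣ × kˣ) (a : A) : torusEquiv hS p a = T p a := rfl

variable (T) in
/-- The action of the torus on the enveloping algebra. -/
noncomputable def torusEnv (p : kˣ × kˣ) : Env k A →ₐ[k] Env k A :=
  Algebra.TensorProduct.map (T p) (T p).op

@[simp] lemma torusEnv_tmul (p : kˣ × kˣ) (a : A) (b : Aᵐᵒᵖ) :
    torusEnv T p (a ⊗ₜ b) = T p a ⊗ₜ op (T p (unop b)) := rfl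

lemma tmul_mem_homog {g h : ℤ × ℤ} {a b : A} (ha : a ∈ homog T g) (hb : b ∈ homog T h) :
    (a ⊗ₜ op b : Env k A) ∈ homog (torusEnv T) (g + h) := fun p => by
  rw [torusEnv_tmul, ha p, unop_op, hb p, weight_add, op_smul, TensorProduct.smul_tmul_smul,
    Units.val_mul]

lemma iSup_homog_torusEnv {S : AddSubmonoid (ℤ × ℤ)} (hS : ⨆ g ∈ S, homog T g = ⊤) :
    ⨆ g ∈ S, homog (torusEnv T) g = ⊤ := by
  have hle {g} (hg : g ∈ S) : homog (torusEnv T) g ≤ ⨆ g ∈ S, homog (torusEnv T) g :=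
    le_iSup₂_of_le g hg le_rfl
  refine eq_top_iff.2 fun r hr => ?_
  clear hr
  induction r using TensorProduct.induction_on with
  | zero => simp
  | add x y hx hy => exact Submodule.add_mem _ hx hy
  | tmul a b =>
    induction a using homog_induction hS with
    | h0 => simp
    | hadd a a' ha ha' => rw [TensorProduct.add_tmul]; exact Submodule.add_mem _ ha ha'
    | hh g hg a ha =>
      obtain ⟨b, rfl⟩ := op_surjective b
      induction b using homog_induction hS with
      | h0 => simp
      | hadd a a' ha ha' =>
        rw [MulOpposite.op_add, TensorProduct.tmul_add]; exact Submodule.add_mem _ ha ha'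
      | hh h hh b hb => exact hle (S.add_mem hg hh) (tmul_mem_homog ha hb)

end Torus

/-! ### Mapping cones and their exactness -/

section Cone

variable {S : Type*} [Ring S] {ι : Type*} [Fintype ι] [DecidableEq ι]

/-- The total differential of the mapping cone of `Φ`. -/
def coneMatrix (M N Φ : Matrix ι ι S) : Matrix (ι ⊕ ι) (ι ⊕ ι) S :=
  Matrix.fromBlocks M 0 Φ (-N)

variable {M N Φ : Matrix ι ι S}

lemma coneMatrix_sq (hM : M * M = 0) (hN : N * N = 0) (hΦ : Φ * M = N * Φ) :
    coneMatrix M N Φ * coneMatrix M N Φ = 0 := by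
  rw [coneMatrix, Matrix.fromBlocks_multiply]
  simp [hM, hN, hΦ]

lemma single_vecMul_eq {o : ι} {φ : S} (h : ∀ c, Φ o c = if c = o then φ else 0) (s : S) :
    Matrix.vecMul (Pi.single o s) Φ = Pi.single o (s * φ) := by
  funext c
  rw [Matrix.single_vecMul, Pi.smul_apply, Matrix.row_apply, h, smul_eq_mul, Pi.single_apply]
  split_ifs <;> simp

lemma mulVec_single_eq {t : ι} {φ : S} (h : ∀ r, Φ r t = if r = t then φ else 0) (s : S) :
    Φ.mulVec (Pi.single t s) = Pi.single t (φ * s) := by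
  funext r
  rw [Matrix.mulVec_single, Pi.smul_apply, Matrix.col_apply, h, Pi.single_apply]
  split_ifs <;> simp

/-- This is the long exact sequence of a cone. Both complexes have homology only at `o`, and `hinj`
says that multiplication by `φ` is injective from that of `N` to that of `M`; what survives is the
cokernel. -/
lemma coneMatrix_row {o : ι} {φ : S} (hΦ : Φ * M = N * Φ)
    (hrow : ∀ v, Matrix.vecMul v M = 0 → ∃ u s, v = Matrix.vecMul u M + Pi.single o s)
    (hrow' : ∀ v, Matrix.vecMul v N = 0 → ∃ u s, v = Matrix.vecMul u N + Pi.single o s)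
    (ho : ∀ c, Φ o c = if c = o then φ else 0)
    (hinj : ∀ s, (∃ u, Matrix.vecMul u M = Pi.single o (s * φ)) →
      ∃ u, Matrix.vecMul u N = Pi.single o s)
    (v : ι ⊕ ι → S) (hv : Matrix.vecMul v (coneMatrix M N Φ) = 0) :
    ∃ u s, v = Matrix.vecMul u (coneMatrix M N Φ) + Pi.single (Sum.inl o) s := by
  obtain ⟨v₁, v₂, rfl⟩ : ∃ v₁ v₂, v = Sum.elim v₁ v₂ := ⟨_, _, (Sum.elim_comp_inl_inr v).symm⟩
  rw [coneMatrix, Matrix.vecMul_fromBlocks, Sum.elim_comp_inl, Sum.elim_comp_inr,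
    Matrix.vecMul_zero, zero_add, Matrix.vecMul_neg] at hv
  have h1 : Matrix.vecMul v₁ M + Matrix.vecMul v₂ Φ = 0 := congrArg (· ∘ Sum.inl) hv
  have h2 : Matrix.vecMul v₂ N = 0 := neg_eq_zero.1 (congrArg (· ∘ Sum.inr) hv)
  have h3 : ∃ w, v₂ = Matrix.vecMul w N := by
    obtain ⟨w, s, rfl⟩ := hrow' v₂ h2
    obtain ⟨w', hw'⟩ := hinj s ⟨-(v₁ + Matrix.vecMul w Φ), by
      rw [Matrix.add_vecMul, Matrix.vecMul_vecMul, single_vecMul_eq ho, ← hΦ,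
        ← Matrix.vecMul_vecMul, ← add_assoc, ← Matrix.add_vecMul] at h1
      rw [Matrix.neg_vecMul, neg_eq_iff_add_eq_zero, h1]⟩
    exact ⟨w + w', by rw [Matrix.add_vecMul, hw']⟩
  obtain ⟨w, rfl⟩ := h3
  rw [Matrix.vecMul_vecMul, ← hΦ, ← Matrix.vecMul_vecMul, ← Matrix.add_vecMul] at h1
  obtain ⟨w₁, s, hw₁⟩ := hrow _ h1
  refine ⟨Sum.elim w₁ (-w), s, ?_⟩
  rw [coneMatrix, Matrix.vecMul_fromBlocks, Sum.elim_comp_inl, Sum.elim_comp_inr,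
    Matrix.vecMul_zero, zero_add, Matrix.vecMul_neg, Matrix.neg_vecMul, Matrix.neg_vecMul, neg_neg]
  have h4 : v₁ = Matrix.vecMul w₁ M + Pi.single o s + -Matrix.vecMul w Φ := by rw [← hw₁]; abel
  funext i
  rcases i with i | i
  · simp only [Sum.elim_inl, Pi.add_apply, congrFun h4 i, Pi.single_apply, Sum.inl.injEq]
    abel
  · simp

/-- The dual argument: the homology now sits at `t`, the map goes from `M` to `N`, and the survivor
is in the second summand. -/
lemma coneMatrix_col {t : ι} {φ : S} (hΦ : Φ * M = N * Φ)
    (hcol : ∀ v, M.mulVec v = 0 → ∃ u s, v = M.mulVec u + Pi.single t s)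
    (hcol' : ∀ v, N.mulVec v = 0 → ∃ u s, v = N.mulVec u + Pi.single t s)
    (ht : ∀ r, Φ r t = if r = t then φ else 0)
    (hinj : ∀ s, (∃ u, N.mulVec u = Pi.single t (φ * s)) → ∃ u, M.mulVec u = Pi.single t s)
    (v : ι ⊕ ι → S) (hv : (coneMatrix M N Φ).mulVec v = 0) :
    ∃ u s, v = (coneMatrix M N Φ).mulVec u + Pi.single (Sum.inr t) s := by
  obtain ⟨v₁, v₂, rfl⟩ : ∃ v₁ v₂, v = Sum.elim v₁ v₂ := ⟨_, _, (Sum.elim_comp_inl_inr v).symm⟩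
  rw [coneMatrix, Matrix.fromBlocks_mulVec, Sum.elim_comp_inl, Sum.elim_comp_inr,
    Matrix.zero_mulVec, add_zero, Matrix.neg_mulVec] at hv
  have h1 : M.mulVec v₁ = 0 := congrArg (· ∘ Sum.inl) hv
  have h2 : Φ.mulVec v₁ + -N.mulVec v₂ = 0 := congrArg (· ∘ Sum.inr) hv
  have h3 : ∃ w, v₁ = M.mulVec w := by
    obtain ⟨w, s, rfl⟩ := hcol v₁ h1
    obtain ⟨w', hw'⟩ := hinj s ⟨v₂ - Φ.mulVec w, by
      rw [Matrix.mulVec_add, Matrix.mulVec_mulVec, mulVec_single_eq ht, hΦ,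
        ← Matrix.mulVec_mulVec] at h2
      rw [Matrix.mulVec_sub, sub_eq_iff_eq_add, ← sub_eq_zero, ← neg_eq_zero, ← h2]
      abel⟩
    exact ⟨w + w', by rw [Matrix.mulVec_add, hw']⟩
  obtain ⟨w, rfl⟩ := h3
  rw [Matrix.mulVec_mulVec, hΦ, ← Matrix.mulVec_mulVec, ← Matrix.mulVec_neg, ← Matrix.mulVec_add]
    at h2
  obtain ⟨w₂, s, hw₂⟩ := hcol' _ h2
  refine ⟨Sum.elim w w₂, -s, ?_⟩
  rw [coneMatrix, Matrix.fromBlocks_mulVec, Sum.elim_comp_inl, Sum.elim_comp_inr,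
    Matrix.zero_mulVec, add_zero, Matrix.neg_mulVec]
  have h4 : v₂ = Φ.mulVec w - (N.mulVec w₂ + Pi.single t s) := by rw [← hw₂]; abel
  funext i
  rcases i with i | i
  · simp
  · simp only [Sum.elim_inr, Pi.add_apply, congrFun h4 i, Pi.single_apply, Sum.inr.injEq,
      Pi.sub_apply, Pi.neg_apply]
    split_ifs <;> abel

end Cone

/-! ### Enveloping algebras of Ore extensions -/

section EnvMaps

/-- Descending induction from the vanishing range. It later proves injectivity of multiplication by
`x ⊗ 1 - θ • 1 ⊗ x` on end homology. -/
lemma eq_zero_of_shift {A : Type*} [Ring A] {a : ℕ → A} {y : A} {N : ℕ} (hN : ∀ i, N ≤ i → a i = 0)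
    (h : ∀ i, a i = a (i + 1) * y) (i : ℕ) : a i = 0 := by
  by_cases hi : N ≤ i
  · exact hN i hi
  · induction hk : N - i generalizing i with
    | zero => omega
    | succ n ih =>
      rw [h i]
      by_cases hi' : N ≤ i + 1
      · rw [hN _ hi', zero_mul]
      · rw [ih (i + 1) hi' (by omega), zero_mul]

variable {k : Type u} [Field k] {A B : Type u} [Ring A] [Ring B] [Algebra k A] [Algebra k B]

/-- The map of enveloping algebras induced by a homomorphism. -/
noncomputable def envMap (f : B →ₐ[k] A) : Env k B →ₐ[k] Env k A :=
  Algebra.TensorProduct.map f f.op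

@[simp] lemma envMap_tmul (f : B →ₐ[k] A) (a : B) (b : Bᵐᵒᵖ) :
    envMap f (a ⊗ₜ b) = f a ⊗ₜ op (f (unop b)) := rfl

/-- The automorphism `τ ⊗ 1` of the enveloping algebra. -/
noncomputable def leftTwist (τ : B ≃ₐ[k] B) : Env k B ≃ₐ[k] Env k B :=
  Algebra.TensorProduct.congr τ AlgEquiv.refl

@[simp] lemma leftTwist_tmul (τ : B ≃ₐ[k] B) (a : B) (b : Bᵐᵒᵖ) :
    leftTwist τ (a ⊗ₜ b) = τ a ⊗ₜ b := rfl

namespace IsOre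

variable {f : B →ₐ[k] A} {x : A} {σ : B ≃ₐ[k] B} {δ : B →ₗ[k] B} (H : IsOre f x σ δ)

include H

lemma envMap_rightFree : RightFree (envMap f : Env k B →+* Env k A)
    (fun i : ℕ × ℕ => (x ^ i.1) ⊗ₜ[k] op (x ^ i.2)) :=
  RightFree.tensor H.rightFree (f' := f.op) (LeftFree.opposite H.free)

lemma envMap_leftFree : LeftFree (envMap f : Env k B →+* Env k A)
    (fun i : ℕ × ℕ => (x ^ i.1) ⊗ₜ[k] op (x ^ i.2)) :=
  LeftFree.tensor H.free (f' := f.op) (RightFree.opposite H.rightFree)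

lemma envMap_injective : Function.Injective (envMap f) := by
  refine (injective_iff_map_eq_zero _).2 fun r hr => ?_
  have := H.envMap_rightFree.indep (Finsupp.single 0 r) (by simp [hr])
  simpa using this

/-- The map `m ⊗ f (b) x ^ i ↦ m * f (τ b)`, zero on other powers of `x`. -/
noncomputable def leftCoef (τ : B ≃ₐ[k] B) (i : ℕ) : Env k A →ₗ[k] A :=
  TensorProduct.lift (LinearMap.mk₂ k (fun m n => m * f (τ (H.coef (unop n) i)))
    (by intros; simp [add_mul]) (by intros; simp) (by intros; simp [mul_add]) (by intros; simp))

/-- The map `f (b) x ^ i ⊗ n ↦ n * f (μ b)`, zero on other powers of `x`. -/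
noncomputable def rightCoef (μ : B →ₐ[k] B) (i : ℕ) : Env k A →ₗ[k] A :=
  TensorProduct.lift (LinearMap.mk₂ k (fun m n => unop n * f (μ (H.coef m i)))
    (by intros; simp [mul_add]) (by intros; simp) (by intros; simp [add_mul]) (by intros; simp))

@[simp] lemma leftCoef_tmul (τ : B ≃ₐ[k] B) (i : ℕ) (m : A) (n : Aᵐᵒᵖ) :
    H.leftCoef τ i (m ⊗ₜ n) = m * f (τ (H.coef (unop n) i)) := by simp [leftCoef]

@[simp] lemma rightCoef_tmul (μ : B →ₐ[k] B) (i : ℕ) (m : A) (n : Aᵐᵒᵖ) :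
    H.rightCoef μ i (m ⊗ₜ n) = unop n * f (μ (H.coef m i)) := by simp [rightCoef]

lemma coef_coe_mul (b : B) (a : A) (i : ℕ) : H.coef (f b * a) i = b * H.coef a i := by
  induction a using H.induction with
  | hz => simp
  | hadd a a' ha ha' => simp [mul_add, ha, ha']
  | hm c j =>
    rw [← mul_assoc, ← _root_.map_mul, H.coef_mul_pow, H.coef_mul_pow, Finsupp.single_apply,
      Finsupp.single_apply]
    split_ifs <;> simp

lemma leftCoef_mul_envMap (τ : B ≃ₐ[k] B) (i : ℕ) (s : Env k A) {j : Env k B}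
    (hj : leftEval k B j = 0) : H.leftCoef τ i (s * envMap f (leftTwist τ j)) = 0 := by
  induction s using TensorProduct.induction_on with
  | zero => simp
  | add s t hs ht => rw [add_mul, map_add, hs, ht, add_zero]
  | tmul m n =>
    have h : H.leftCoef τ i (m ⊗ₜ n * envMap f (leftTwist τ j)) =
        m * f (τ (leftEval k B j)) * f (τ (H.coef (unop n) i)) := by
      clear hj
      induction j using TensorProduct.induction_on with
      | zero => simp
      | add j j' hj hj' => simp only [map_add, mul_add, add_mul, hj, hj']
      | tmul b c => simp [H.coef_coe_mul, mul_assoc]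
    rw [h, hj]
    simp

lemma rightCoef_envMap_mul (τ : B ≃ₐ[k] B) {ν μ : B →ₐ[k] B} (hμ : ∀ b, μ (τ b) = ν b) (i : ℕ)
    (s : Env k A) {j : Env k B} (hj : rightEval ν j = 0) :
    H.rightCoef μ i (envMap f (leftTwist τ j) * s) = 0 := by
  induction s using TensorProduct.induction_on with
  | zero => simp
  | add s t hs ht => rw [mul_add, map_add, hs, ht, add_zero]
  | tmul m n =>
    have h : H.rightCoef μ i (envMap f (leftTwist τ j) * m ⊗ₜ n) =
        unop n * f (rightEval ν j) * f (μ (H.coef m i)) := by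
      clear hj
      induction j using TensorProduct.induction_on with
      | zero => simp
      | add j j' hj hj' => simp only [map_add, mul_add, add_mul, hj, hj']
      | tmul b c => simp [H.coef_coe_mul, mul_assoc, hμ]
    rw [h, hj]
    simp

/-- Modulo the left ideal `J`, elements of `B` can be carried from the right tensor factor to the
left one, leaving only powers of `x` on the right. So the functions `leftCoef τ i` detect membership
in `J`. -/
lemma leftCoef_decomposition (τ : B ≃ₐ[k] B) {J : Submodule (Env k A) (Env k A)}
    (hJ : ∀ b, (1 ⊗ₜ op (f b) - f (τ b) ⊗ₜ 1 : Env k A) ∈ J) (r : Env k A) :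
    ∃ N, ∀ M, N ≤ M → H.leftCoef τ M r = 0 ∧
      r - ∑ i ∈ Finset.range M, (H.leftCoef τ i r) ⊗ₜ[k] op (x ^ i) ∈ J := by
  induction r using TensorProduct.induction_on with
  | zero => exact ⟨0, fun M _ => by simp⟩
  | add r s hr hs =>
    obtain ⟨N, hN⟩ := hr
    obtain ⟨N', hN'⟩ := hs
    refine ⟨max N N', fun M hM => ?_⟩
    obtain ⟨h1, h2⟩ := hN M (le_of_max_le_left hM)
    obtain ⟨h3, h4⟩ := hN' M (le_of_max_le_right hM)
    refine ⟨by rw [map_add, h1, h3, add_zero], ?_⟩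
    simp only [map_add, TensorProduct.add_tmul, Finset.sum_add_distrib]
    rw [add_sub_add_comm]
    exact J.add_mem h2 h4
  | tmul m n =>
    obtain ⟨n, rfl⟩ := op_surjective n
    induction n using H.induction with
    | hz => exact ⟨0, fun M _ => by simp⟩
    | hadd r s hr hs =>
      obtain ⟨N, hN⟩ := hr
      obtain ⟨N', hN'⟩ := hs
      refine ⟨max N N', fun M hM => ?_⟩
      obtain ⟨h1, h2⟩ := hN M (le_of_max_le_left hM)
      obtain ⟨h3, h4⟩ := hN' M (le_of_max_le_right hM)
      rw [MulOpposite.op_add, TensorProduct.tmul_add]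
      refine ⟨by rw [map_add, h1, h3, add_zero], ?_⟩
      simp only [map_add, TensorProduct.add_tmul, Finset.sum_add_distrib]
      rw [add_sub_add_comm]
      exact J.add_mem h2 h4
    | hm b i =>
      refine ⟨i + 1, fun M hM => ⟨?_, ?_⟩⟩
      · simp [show i ≠ M by omega]
      · rw [Finset.sum_eq_single_of_mem i (by simp; omega)]
        · have := J.smul_mem (m ⊗ₜ op (x ^ i)) (hJ b)
          simpa [mul_sub] using this
        · intro j _ hj
          simp [hj.symm]

lemma rightCoef_decomposition (τ : B ≃ₐ[k] B) {ν μ : B →ₐ[k] B} (hμ : ∀ b, μ (τ b) = ν b)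
    {K : Set (Env k A)} (h0 : 0 ∈ K) (hadd : ∀ r ∈ K, ∀ s ∈ K, r + s ∈ K)
    (hmul : ∀ r ∈ K, ∀ s, r * s ∈ K)
    (hK : ∀ b, (f (τ b) ⊗ₜ 1 - 1 ⊗ₜ op (f (ν b)) : Env k A) ∈ K) (r : Env k A) :
    ∃ N, ∀ M, N ≤ M → H.rightCoef μ M r = 0 ∧
      r - ∑ i ∈ Finset.range M, (x ^ i) ⊗ₜ[k] op (H.rightCoef μ i r) ∈ K := by
  induction r using TensorProduct.induction_on with
  | zero => exact ⟨0, fun M _ => by simpa⟩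
  | add r s hr hs =>
    obtain ⟨N, hN⟩ := hr
    obtain ⟨N', hN'⟩ := hs
    refine ⟨max N N', fun M hM => ?_⟩
    obtain ⟨h1, h2⟩ := hN M (le_of_max_le_left hM)
    obtain ⟨h3, h4⟩ := hN' M (le_of_max_le_right hM)
    refine ⟨by rw [map_add, h1, h3, add_zero], ?_⟩
    simp only [map_add, MulOpposite.op_add, TensorProduct.tmul_add, Finset.sum_add_distrib]
    rw [add_sub_add_comm]
    exact hadd _ h2 _ h4
  | tmul m n =>
    obtain ⟨n, rfl⟩ := op_surjective n
    induction m using H.induction with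
    | hz => exact ⟨0, fun M _ => by simpa⟩
    | hadd r s hr hs =>
      obtain ⟨N, hN⟩ := hr
      obtain ⟨N', hN'⟩ := hs
      refine ⟨max N N', fun M hM => ?_⟩
      obtain ⟨h1, h2⟩ := hN M (le_of_max_le_left hM)
      obtain ⟨h3, h4⟩ := hN' M (le_of_max_le_right hM)
      rw [TensorProduct.add_tmul]
      refine ⟨by rw [map_add, h1, h3, add_zero], ?_⟩
      simp only [map_add, MulOpposite.op_add, TensorProduct.tmul_add, Finset.sum_add_distrib]
      rw [add_sub_add_comm]
      exact hadd _ h2 _ h4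
    | hm b i =>
      refine ⟨i + 1, fun M hM => ⟨?_, ?_⟩⟩
      · simp [show i ≠ M by omega]
      · rw [Finset.sum_eq_single_of_mem i (by simp; omega)]
        · have := hmul _ (hK (τ.symm b)) ((x ^ i) ⊗ₜ op n)
          simpa [sub_mul, ← hμ] using this
        · intro j _ hj
          simp [hj.symm]

/-- The two contributions of `δ`, one from each tensor factor, cancel. -/
lemma leftCoef_succ_mul (r : Env k A) (i : ℕ) :
    H.leftCoef AlgEquiv.refl (i + 1) (r * (x ⊗ₜ 1 - 1 ⊗ₜ op x)) =
      H.leftCoef σ (i + 1) r * x - H.leftCoef σ i r := by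
  induction r using TensorProduct.induction_on with
  | zero => simp
  | add r s hr hs => rw [add_mul, map_add, hr, hs, map_add, map_add, add_mul]; abel
  | tmul m n =>
    simp only [mul_sub, Algebra.TensorProduct.tmul_mul_tmul, mul_one, map_sub, leftCoef_tmul,
      unop_mul, unop_op, H.coef_mul_left_succ, AlgEquiv.coe_refl, id, map_add, mul_add, mul_assoc,
      H.comm]
    abel

/-- Here the contributions of `δ` cancel because `h2` supplies exactly the scalar `θ`. -/
lemma rightCoef_succ_mul {μ : B →ₐ[k] B} {θ : k} (h1 : ∀ b, σ (μ b) = μ (σ b))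
    (h2 : ∀ b, μ (δ b) = θ • δ (μ b)) (r : Env k A) (i : ℕ) :
    H.rightCoef μ (i + 1) ((x ⊗ₜ 1 - θ • 1 ⊗ₜ op x) * r) =
      H.rightCoef (μ.comp σ) i r - θ • (H.rightCoef (μ.comp σ) (i + 1) r * x) := by
  induction r using TensorProduct.induction_on with
  | zero => simp
  | add r s hr hs => rw [mul_add, map_add, hr, hs, map_add, map_add, add_mul, smul_add]; abel
  | tmul m n =>
    simp only [sub_mul, smul_mul_assoc, Algebra.TensorProduct.tmul_mul_tmul, one_mul, map_sub,
      map_smul, rightCoef_tmul, unop_mul, unop_op, H.coef_mul_left_succ, map_add, mul_add,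
      mul_assoc, H.comm, h1, h2, smul_add, AlgHom.comp_apply, AlgEquiv.coe_toAlgHom,
      mul_smul_comm]
    abel

end IsOre

end EnvMaps

/-! ### Derivations of the enveloping algebra and homogeneous lifting -/

section Chain

variable {k : Type u} [Field k] {A B : Type u} [Ring A] [Ring B] [Algebra k A] [Algebra k B]

/-- The derivation `δ ⊗ 1` of the enveloping algebra. -/
noncomputable def leftDer (δ : B →ₗ[k] B) : Env k B →ₗ[k] Env k B :=
  TensorProduct.map δ LinearMap.id

/-- The derivation `1 ⊗ δ` of the enveloping algebra. -/
noncomputable def rightDer (δ : B →ₗ[k] B) : Env k B →ₗ[k] Env k B :=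
  TensorProduct.map LinearMap.id
    ((opLinearEquiv k).toLinearMap ∘ₗ δ ∘ₗ (opLinearEquiv k).symm.toLinearMap)

@[simp] lemma leftDer_tmul (δ : B →ₗ[k] B) (a : B) (b : Bᵐᵒᵖ) :
    leftDer δ (a ⊗ₜ b) = δ a ⊗ₜ b := rfl

@[simp] lemma rightDer_tmul (δ : B →ₗ[k] B) (a : B) (b : Bᵐᵒᵖ) :
    rightDer δ (a ⊗ₜ b) = a ⊗ₜ op (δ (unop b)) := rfl

/-- An Ore extension which is equivariant for actions of the torus, whose twist comes from the
torus and whose new generator is homogeneous. -/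
structure IsTorusOre (TA : kˣ × kˣ → (A →ₐ[k] A)) (TB : kˣ × kˣ → (B →ₐ[k] B)) (f : B →ₐ[k] A)
    (x : A) (σ : B ≃ₐ[k] B) (δ : B →ₗ[k] B) (u : kˣ × kˣ) (g : ℤ × ℤ) : Prop
    extends IsOre f x σ δ where
  sigma_eq : ∀ b, σ b = TB u b
  torus_coe : ∀ p b, TA p (f b) = f (TB p b)
  mem_homog : x ∈ homog TA g

/-- Dualizing data with matrix entries homogeneous under an action of the torus. -/
structure IsGradedDualizing {ι : Type} [Fintype ι] [DecidableEq ι]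
    (T : kˣ × kˣ → (B →ₐ[k] B)) (ν : B →ₐ[k] B) (d : ℕ) (w : ℤ × ℤ)
    (h : ι → ℕ) (deg : ι → ℤ × ℤ) (o t : ι) (D : Matrix ι ι (Env k B)) : Prop
    extends IsDualizing ν d h o t D where
  homogeneous : ∀ r c, D r c ∈ homog (torusEnv T) (deg r - deg c)
  deg_bot : deg o = 0
  deg_top : deg t = w

namespace IsDualizing

variable {ι : Type} [Fintype ι] [DecidableEq ι] {ν : B →ₐ[k] B} {d : ℕ} {h : ι → ℕ} {o t : ι}
  {D : Matrix ι ι (Env k B)} (H : IsDualizing ν d h o t D)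

include H

lemma leftEval_apply_bot (c : ι) : leftEval k B (D c o) = 0 := by
  by_cases hc : D c o = 0
  · simp [hc]
  refine (H.bottom _).1 ⟨Pi.single c 1, funext fun c' => ?_⟩
  have h1 := H.degree c o hc
  rw [Matrix.single_one_vecMul, Matrix.row_apply, Pi.single_apply]
  split_ifs with h2
  · rw [h2]
  · by_contra h3
    have := H.degree c c' h3
    rw [H.h_bot] at h1
    exact h2 ((H.bot_iff c').1 (by omega))

lemma rightEval_apply_top (c : ι) : rightEval ν (D t c) = 0 := by
  by_cases hc : D t c = 0
  · simp [hc]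
  refine (H.top _).1 ⟨Pi.single c 1, funext fun r => ?_⟩
  have h1 := H.degree t c hc
  rw [Matrix.mulVec_single_one, Matrix.col_apply, Pi.single_apply]
  split_ifs with h2
  · rw [h2]
  · by_contra h3
    have := H.degree r c h3
    rw [H.h_top] at h1
    exact h2 ((H.top_iff r).1 (by omega))

end IsDualizing

namespace IsGradedDualizing

variable {ι : Type} [Fintype ι] [DecidableEq ι] {T : kˣ × kˣ → (B →ₐ[k] B)} {ν : B →ₐ[k] B}
  {d : ℕ} {w : ℤ × ℤ} {h : ι → ℕ} {deg : ι → ℤ × ℤ} {o t : ι}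
  {D : Matrix ι ι (Env k B)} (H : IsGradedDualizing T ν d w h deg o t D)

include H

/-- Exactness gives some lift, through `bottom` if `n = 1` and through `row` otherwise. Projecting
its entries to the right homological degree and bidegree does not change the product with the
homogeneous matrix `D` where it matters. -/
lemma exists_homogeneous_lift [CharZero k] {S : AddSubmonoid (ℤ × ℤ)}
    (hS : ⨆ g ∈ S, homog T g = ⊤) (n : ℕ) (g : ℤ × ℤ) (E : ι → Env k B)
    (hE : ∀ c, E c ≠ 0 → n = h c + 1) (hEg : ∀ c, E c ∈ homog (torusEnv T) (g - deg c))
    (hED : Matrix.vecMul E D = 0) (hE1 : leftEval k B (E o) = 0) :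
    ∃ v : ι → Env k B, (∀ c, v c ≠ 0 → h c = n) ∧
      (∀ c, v c ∈ homog (torusEnv T) (g - deg c)) ∧ Matrix.vecMul v D = E := by
  have key : ∃ v, ∀ c, n = h c + 1 → Matrix.vecMul v D c = E c := by
    by_cases h1 : n = 1
    · obtain ⟨v, hv⟩ := (H.bottom _).2 hE1
      refine ⟨v, fun c hc => ?_⟩
      obtain rfl := (H.bot_iff c).1 (by omega)
      rw [hv, Pi.single_eq_same]
    · obtain ⟨v, s, hv⟩ := H.row E hED
      refine ⟨v, fun c hc => ?_⟩
      have hco : c ≠ o := by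
        rintro rfl
        rw [H.h_bot] at hc
        exact h1 hc
      rw [hv, Pi.add_apply, Pi.single_eq_of_ne hco, add_zero]
  obtain ⟨v, hv⟩ := key
  obtain ⟨π, hπ, hπ', hπm⟩ := exists_projection (iSup_homog_torusEnv hS)
  refine ⟨fun c => if h c = n then π (g - deg c) (v c) else 0, fun c hc => ?_, fun c => ?_,
    funext fun c => ?_⟩
  · by_contra h1
    exact hc (if_neg h1)
  · dsimp only
    split_ifs
    · exact hπ _ _
    · exact Submodule.zero_mem _
  · by_cases hc : n = h c + 1
    · rw [← hπ' _ _ (hEg c), ← hv c hc]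
      simp only [Matrix.vecMul, dotProduct, map_sum]
      refine Finset.sum_congr rfl fun j _ => ?_
      by_cases hj : D j c = 0
      · simp [hj]
      · rw [if_pos (by rw [H.degree j c hj, hc]), ← hπm _ _ _ _ (H.homogeneous j c),
          sub_add_sub_cancel]
    · have hEc : E c = 0 := by
        by_contra h1
        exact hc (hE c h1)
      rw [hEc]
      refine Finset.sum_eq_zero fun j _ => ?_
      dsimp only
      split_ifs with h1
      · by_cases hj : D j c = 0
        · rw [hj, mul_zero]
        · exact absurd (h1.symm.trans (H.degree j c hj)) hc
      · rw [zero_mul]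

end IsGradedDualizing

namespace IsTorusOre

variable {TA : kˣ × kˣ → (A →ₐ[k] A)} {TB : kˣ × kˣ → (B →ₐ[k] B)} {f : B →ₐ[k] A} {x : A}
  {σ : B ≃ₐ[k] B} {δ : B →ₗ[k] B} {u : kˣ × kˣ} {g : ℤ × ℤ} (H : IsTorusOre TA TB f x σ δ u g)
  {S : AddSubmonoid (ℤ × ℤ)}

include H

lemma left_mul_envMap (r : Env k B) : (x ⊗ₜ 1) * envMap f r =
    envMap f (leftTwist σ r) * (x ⊗ₜ 1) + envMap f (leftDer δ r) := by
  induction r using TensorProduct.induction_on with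
  | zero => simp
  | add r s hr hs => simp only [map_add, mul_add, add_mul, hr, hs]; abel
  | tmul a b => simp [H.comm, TensorProduct.add_tmul]

lemma envMap_leftTwist_mul (r : Env k B) : envMap f (leftTwist σ r) * (1 ⊗ₜ op x) =
    (1 ⊗ₜ op x) * envMap f (torusEnv TB u r) + envMap f (rightDer δ (leftTwist σ r)) := by
  induction r using TensorProduct.induction_on with
  | zero => simp
  | add r s hr hs => simp only [map_add, mul_add, add_mul, hr, hs]; abel
  | tmul a b =>
    simp [← op_mul, H.comm, H.sigma_eq, TensorProduct.tmul_add]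

/-- The Leibniz rule for `δ`, read on the enveloping algebra. It shows that the cocycle below is
killed by the augmentation. -/
lemma leftEval_leftDer_add (r : Env k B) : leftEval k B (leftDer δ r) +
    leftEval k B (rightDer δ (leftTwist σ r)) = δ (leftEval k B r) := by
  induction r using TensorProduct.induction_on with
  | zero => simp
  | add r s hr hs => simp only [map_add, ← hr, ← hs]; abel
  | tmul a b => simp [H.leibniz, add_comm]

lemma torus_sigma (hS : ⨆ g ∈ S, homog TB g = ⊤) (p : kˣ × kˣ) (b : B) :
    TB p (σ b) = σ (TB p b) := by
  rw [H.sigma_eq, H.sigma_eq, torus_comm hS]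

/-- Apply the torus to the commutation rule and compare the terms free of `x`: `δ` has bidegree `g`.
-/
lemma torus_delta (hS : ⨆ g ∈ S, homog TB g = ⊤) (p : kˣ × kˣ) (b : B) :
    TB p (δ b) = (weight g p : k) • δ (TB p b) := by
  apply H.injective
  have h := congrArg (TA p) (H.comm b)
  rw [map_mul, map_add, map_mul, H.mem_homog p, H.torus_coe, H.torus_coe, H.torus_coe,
    H.torus_sigma hS, smul_mul_assoc, H.comm, smul_add, mul_smul_comm] at h
  rw [map_smul]
  exact (add_left_cancel h).symm

lemma leftTwist_mem_homog (hS : ⨆ g ∈ S, homog TB g = ⊤) {h : ℤ × ℤ} {r : Env k B}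
    (hr : r ∈ homog (torusEnv TB) h) : leftTwist σ r ∈ homog (torusEnv TB) h := fun p => by
  have key : torusEnv TB p (leftTwist σ r) = leftTwist σ (torusEnv TB p r) := by
    clear hr
    induction r using TensorProduct.induction_on with
    | zero => simp
    | add r s hr hs => simp only [map_add, hr, hs]
    | tmul a b => simp [H.torus_sigma hS]
  rw [key, hr p, map_smul]

lemma leftDer_mem_homog (hS : ⨆ g ∈ S, homog TB g = ⊤) {h : ℤ × ℤ} {r : Env k B}
    (hr : r ∈ homog (torusEnv TB) h) : leftDer δ r ∈ homog (torusEnv TB) (h + g) := fun p => by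
  have key : torusEnv TB p (leftDer δ r) = (weight g p : k) • leftDer δ (torusEnv TB p r) := by
    clear hr
    induction r using TensorProduct.induction_on with
    | zero => simp
    | add r s hr hs => simp only [map_add, hr, hs, smul_add]
    | tmul a b => simp [H.torus_delta hS, TensorProduct.smul_tmul']
  rw [key, hr p, map_smul, smul_smul, weight_add, Units.val_mul, mul_comm]

lemma rightDer_mem_homog (hS : ⨆ g ∈ S, homog TB g = ⊤) {h : ℤ × ℤ} {r : Env k B}
    (hr : r ∈ homog (torusEnv TB) h) : rightDer δ r ∈ homog (torusEnv TB) (h + g) := fun p => by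
  have key : torusEnv TB p (rightDer δ r) = (weight g p : k) • rightDer δ (torusEnv TB p r) := by
    clear hr
    induction r using TensorProduct.induction_on with
    | zero => simp
    | add r s hr hs => simp only [map_add, hr, hs, smul_add]
    | tmul a b => simp [H.torus_delta hS]
  rw [key, hr p, map_smul, smul_smul, weight_add, Units.val_mul, mul_comm]

lemma envMap_mem_homog {h : ℤ × ℤ} {r : Env k B} (hr : r ∈ homog (torusEnv TB) h) :
    envMap f r ∈ homog (torusEnv TA) h := fun p => by
  have key : torusEnv TA p (envMap f r) = envMap f (torusEnv TB p r) := by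
    clear hr
    induction r using TensorProduct.induction_on with
    | zero => simp
    | add r s hr hs => simp only [map_add, hr, hs]
    | tmul a b => simp [H.torus_coe]
  rw [key, hr p, map_smul]

end IsTorusOre

end Chain

/-! ### The comparison map between the two base changes -/

section Connecting

variable {k : Type u} [Field k] {A B : Type u} [Ring A] [Ring B] [Algebra k A] [Algebra k B]
variable {ι : Type} [Fintype ι] [DecidableEq ι]

/-- The failure of `x ⊗ 1 - 1 ⊗ x` to commute with `D`, as a matrix over the smaller algebra. -/
noncomputable def oreCocycle (σ : B ≃ₐ[k] B) (δ : B →ₗ[k] B) (u : kˣ × kˣ) (deg : ι → ℤ × ℤ)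
    (D : Matrix ι ι (Env k B)) : Matrix ι ι (Env k B) :=
  Matrix.of fun r c =>
    leftDer δ (D r c) + (weight (deg c) u : k) • rightDer δ (leftTwist σ (D r c))

/-- The diagonal matrix with entries `x ⊗ 1 - θ • 1 ⊗ x`. -/
noncomputable def oreDiagonal (x : A) (u : kˣ × kˣ) (deg : ι → ℤ × ℤ) : Matrix ι ι (Env k A) :=
  Matrix.diagonal fun r => x ⊗ₜ 1 - (weight (deg r) u : k) • 1 ⊗ₜ op x

namespace IsTorusOre

variable {TA : kˣ × kˣ → (A →ₐ[k] A)} {TB : kˣ × kˣ → (B →ₐ[k] B)} {f : B →ₐ[k] A} {x : A}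
  {σ : B ≃ₐ[k] B} {δ : B →ₗ[k] B} {u : kˣ × kˣ} {g : ℤ × ℤ} (H : IsTorusOre TA TB f x σ δ u g)
  {S : AddSubmonoid (ℤ × ℤ)}
  {ν : B →ₐ[k] B} {d : ℕ} {w : ℤ × ℤ} {h : ι → ℕ} {deg : ι → ℤ × ℤ} {o t : ι}
  {D : Matrix ι ι (Env k B)} (G : IsGradedDualizing TB ν d w h deg o t D)

include H G

/-- Moving `1 ⊗ x` past an entry of `D` produces the torus element `u`; homogeneity turns it into a
scalar, which the row-dependent factor in `oreDiagonal` absorbs. The defect then contains no `x`. -/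
lemma oreDiagonal_mul : oreDiagonal x u deg * D.map (envMap f) =
    (D.map (leftTwist σ)).map (envMap f) * oreDiagonal x u deg +
      (oreCocycle σ δ u deg D).map (envMap f) := by
  ext r c
  rw [oreDiagonal, Matrix.diagonal_mul, Matrix.add_apply, Matrix.mul_diagonal]
  simp only [Matrix.map_apply, oreCocycle, Matrix.of_apply, sub_mul, mul_sub, smul_mul_assoc,
    mul_smul_comm, H.left_mul_envMap, H.envMap_leftTwist_mul, map_add, map_smul, smul_add]
  rw [G.homogeneous r c u, map_smul, mul_smul_comm, smul_smul, weight_sub, Units.val_mul,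
    mul_left_comm, Units.mul_inv, mul_one]
  abel

/-- Formal from `Q * M = N * Q + P` with `M` and `N` of square zero; injectivity of `envMap f`
brings it back to `B`. -/
lemma oreCocycle_mul :
    oreCocycle σ δ u deg D * D + D.map (leftTwist σ) * oreCocycle σ δ u deg D = 0 := by
  have key : ∀ M N P Q : Matrix ι ι (Env k A), Q * M = N * Q + P → M * M = 0 → N * N = 0 →
      P * M + N * P = 0 := fun M N P Q h hM hN => by
    rw [eq_sub_of_add_eq' h.symm, sub_mul, mul_sub, mul_assoc, hM, mul_zero, ← mul_assoc N N, hN,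
      zero_mul, mul_assoc]
    abel
  have hN : D.map (leftTwist σ) * D.map (leftTwist σ) = 0 := by
    rw [← Matrix.map_mul, G.sq, Matrix.map_zero _ (map_zero _)]
  have h0 := key _ _ _ _ (H.oreDiagonal_mul G)
    (by rw [← Matrix.map_mul, G.sq, Matrix.map_zero _ (map_zero _)])
    (by rw [← Matrix.map_mul, hN, Matrix.map_zero _ (map_zero _)])
  rw [← Matrix.map_mul, ← Matrix.map_mul, ← Matrix.map_add _ (map_add _)] at h0
  exact Matrix.map_injective H.envMap_injective
    (h0.trans (Matrix.map_zero _ (map_zero _)).symm)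

lemma oreCocycle_mem_homog (hS : ⨆ g ∈ S, homog TB g = ⊤) (r c : ι) :
    oreCocycle σ δ u deg D r c ∈ homog (torusEnv TB) (deg r - deg c + g) :=
  Submodule.add_mem _ (H.leftDer_mem_homog hS (G.homogeneous r c))
    (Submodule.smul_mem _ _ (H.rightDer_mem_homog hS
      (H.leftTwist_mem_homog hS (G.homogeneous r c))))

lemma leftEval_oreCocycle (r : ι) : leftEval k B (oreCocycle σ δ u deg D r o) = 0 := by
  simp only [oreCocycle, Matrix.of_apply, G.deg_bot, weight_zero, Units.val_one, one_smul, map_add]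
  rw [H.leftEval_leftDer_add, G.leftEval_apply_bot, map_zero]

-- The only possible entry in this column is at `o` itself. Its bidegree is `g`, outside `S`.
omit H in
lemma connecting_bot [CharZero k] (hS : ⨆ g ∈ S, homog TB g = ⊤) (hg : g ∉ S)
    {γ : Matrix ι ι (Env k B)} (hγ : ∀ r c, γ r c ≠ 0 → h r = h c)
    (hγg : ∀ r c, γ r c ∈ homog (torusEnv TB) (deg r - deg c + g)) (r : ι) : γ r o = 0 := by
  by_contra h1
  have h2 := hγ r o h1
  rw [G.h_bot, G.bot_iff] at h2
  subst h2
  have h3 := hγg r r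
  rw [sub_self, zero_add] at h3
  exact h1 (homog_eq_bot (iSup_homog_torusEnv hS) hg h3)

omit H in
lemma connecting_top [CharZero k] (hS : ⨆ g ∈ S, homog TB g = ⊤) (hg : g ∉ S)
    {γ : Matrix ι ι (Env k B)} (hγ : ∀ r c, γ r c ≠ 0 → h r = h c)
    (hγg : ∀ r c, γ r c ∈ homog (torusEnv TB) (deg r - deg c + g)) (r : ι) : γ r t = 0 := by
  by_contra h1
  have h2 := hγ r t h1
  rw [G.h_top, G.top_iff] at h2
  subst h2
  have h3 := hγg r r
  rw [sub_self, zero_add] at h3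
  exact h1 (homog_eq_bot (iSup_homog_torusEnv hS) hg h3)

/-- The usual construction of a null homotopy, row by row in homological degree: each right-hand
side is a cycle by the cocycle identity and lifts through the exact rows of `D`. Homogeneity is
carried along to control the ends. -/
lemma exists_connecting_aux [CharZero k] (hS : ⨆ g ∈ S, homog TB g = ⊤) (hg : g ∉ S) (n : ℕ) :
    ∃ γ : Matrix ι ι (Env k B), (∀ r c, γ r c ≠ 0 → h r = h c) ∧
      (∀ r c, γ r c ∈ homog (torusEnv TB) (deg r - deg c + g)) ∧
      ∀ r, h r < n → Matrix.vecMul (γ r) D =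
        (D.map (leftTwist σ) * γ - oreCocycle σ δ u deg D) r := by
  induction n with
  | zero => exact ⟨0, fun r c h => absurd rfl h, fun r c => Submodule.zero_mem _,
      fun r hr => absurd hr (Nat.not_lt_zero _)⟩
  | succ n ih =>
    obtain ⟨γ, h1, h2, h3⟩ := ih
    have hE0 : ∀ r c, h r ≠ h c + 1 → (D.map (leftTwist σ) * γ - oreCocycle σ δ u deg D) r c = 0 := by
      intro r c hrc
      have hD : D r c = 0 := by
        by_contra h4
        exact hrc (G.degree r c h4)
      rw [Matrix.sub_apply, oreCocycle, Matrix.of_apply, hD, map_zero, map_zero, map_zero,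
        smul_zero, add_zero, sub_zero]
      refine Finset.sum_eq_zero fun j _ => ?_
      by_cases hj : D r j = 0
      · simp [hj]
      by_cases hj' : γ j c = 0
      · exact mul_eq_zero_of_right _ hj'
      · exact absurd ((G.degree r j hj).trans (by rw [h1 j c hj'])) hrc
    have hEg : ∀ r c, (D.map (leftTwist σ) * γ - oreCocycle σ δ u deg D) r c ∈
        homog (torusEnv TB) (deg r + g - deg c) := by
      intro r c
      rw [add_sub_right_comm]
      refine Submodule.sub_mem _ (Submodule.sum_mem _ fun j _ => ?_)
        (H.oreCocycle_mem_homog G hS r c)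
      have := mul_mem_homog (H.leftTwist_mem_homog hS (G.homogeneous r j)) (h2 j c)
      rwa [← add_assoc, sub_add_sub_cancel] at this
    -- In degree `1` being a cycle is replaced by vanishing under the augmentation; this needs the
    -- column of `γ` at `o` to be zero.
    have hEo : ∀ r, leftEval k B
        ((D.map (leftTwist σ) * γ - oreCocycle σ δ u deg D) r o) = 0 := by
      intro r
      rw [Matrix.sub_apply, map_sub, H.leftEval_oreCocycle G, sub_zero, Matrix.mul_apply,
        Finset.sum_eq_zero, map_zero]
      intro j _
      rw [connecting_bot G hS hg h1 h2, mul_zero]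
    have hED : ∀ r, h r = n → Matrix.vecMul
        ((D.map (leftTwist σ) * γ - oreCocycle σ δ u deg D) r) D = 0 := by
      intro r hr
      have h4 : Matrix.vecMul ((D.map (leftTwist σ) * γ) r) D =
          (D.map (leftTwist σ) * (D.map (leftTwist σ) * γ - oreCocycle σ δ u deg D)) r := by
        rw [Matrix.mul_apply_eq_vecMul, Matrix.vecMul_vecMul, Matrix.mul_apply_eq_vecMul]
        funext c
        simp only [Matrix.vecMul, dotProduct]
        refine Finset.sum_congr rfl fun j _ => ?_
        by_cases hj : D r j = 0
        · simp [hj]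
        · congr 1
          exact congrFun (h3 j (by have := G.degree r j hj; omega)) c
      have hN : D.map (leftTwist σ) * D.map (leftTwist σ) = 0 := by
        rw [← Matrix.map_mul, G.sq, Matrix.map_zero _ (map_zero _)]
      have h5 := congrFun (H.oreCocycle_mul G) r
      rw [mul_sub, ← mul_assoc, hN, zero_mul, zero_sub] at h4
      have h6 : (D.map (leftTwist σ) * γ - oreCocycle σ δ u deg D) r =
        (D.map (leftTwist σ) * γ) r - oreCocycle σ δ u deg D r := rfl
      rw [h6, Matrix.sub_vecMul, h4, ← Matrix.mul_apply_eq_vecMul]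
      rw [← neg_eq_zero]
      refine Eq.trans ?_ h5
      funext c
      simp
    choose v hv1 hv2 hv3 using fun r : {r : ι // h r = n} =>
      G.exists_homogeneous_lift hS n (deg r + g)
        ((D.map (leftTwist σ) * γ - oreCocycle σ δ u deg D) r)
        (fun c hc => by
          by_contra h4
          exact hc (hE0 _ _ (by rw [r.2]; exact h4)))
        (hEg r) (hED r r.2) (hEo r)
    -- Only the rows of degree `n` change. The right-hand sides up to degree `n` involve rows of
    -- degree below `n`, so they stay the same.
    let γ' : Matrix ι ι (Env k B) := Matrix.of fun r c => if hr : h r = n then v ⟨r, hr⟩ c else γ r c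
    have hγ' : ∀ r, h r < n → γ' r = γ r := fun r hr => funext fun c => dif_neg hr.ne
    have hγ'' : ∀ r (hr : h r = n), γ' r = v ⟨r, hr⟩ := fun r hr => funext fun c => dif_pos hr
    have hmul : ∀ r, h r < n + 1 → (D.map (leftTwist σ) * γ' - oreCocycle σ δ u deg D) r =
        (D.map (leftTwist σ) * γ - oreCocycle σ δ u deg D) r := by
      intro r hr
      funext c
      rw [Matrix.sub_apply, Matrix.sub_apply, Matrix.mul_apply, Matrix.mul_apply]
      congr 1
      refine Finset.sum_congr rfl fun j _ => ?_
      by_cases hj : D r j = 0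
      · simp [hj]
      · rw [hγ' j (by have := G.degree r j hj; omega)]
    refine ⟨γ', fun r c hrc => ?_, fun r c => ?_, fun r hr => ?_⟩
    · by_cases hr : h r = n
      · rw [hγ'' r hr] at hrc
        rw [hr, hv1 _ _ hrc]
      · exact h1 r c fun h4 => hrc ((dif_neg hr).trans h4)
    · by_cases hr : h r = n
      · rw [hγ'' r hr, ← add_sub_right_comm]
        exact hv2 ⟨r, hr⟩ c
      · have : γ' r c = γ r c := dif_neg hr
        rw [this]
        exact h2 r c
    · rw [hmul r hr]
      rcases (Nat.lt_succ_iff_lt_or_eq.1 hr) with hr | hr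
      · rw [hγ' r hr, h3 r hr]
      · rw [hγ'' r hr, hv3 ⟨r, hr⟩]

theorem exists_connecting [CharZero k] (hS : ⨆ g ∈ S, homog TB g = ⊤) (hg : g ∉ S) :
    ∃ γ : Matrix ι ι (Env k B), (∀ r c, γ r c ≠ 0 → h r = h c) ∧
      (∀ r c, γ r c ∈ homog (torusEnv TB) (deg r - deg c + g)) ∧
      (oreDiagonal x u deg + γ.map (envMap f)) * D.map (envMap f) =
        (D.map (leftTwist σ)).map (envMap f) * (oreDiagonal x u deg + γ.map (envMap f)) := by
  obtain ⟨γ, h1, h2, h3⟩ := H.exists_connecting_aux G hS hg (d + 1)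
  refine ⟨γ, h1, h2, ?_⟩
  have h4 : γ * D = D.map (leftTwist σ) * γ - oreCocycle σ δ u deg D := by
    ext r c
    exact congrFun (h3 r (Nat.lt_succ_of_le (G.le_top r))) c
  rw [add_mul, mul_add, H.oreDiagonal_mul G, ← Matrix.map_mul, h4, Matrix.map_sub _ (map_sub _),
    Matrix.map_mul]
  abel

end IsTorusOre

end Connecting

/-! ### Ideals describing the homology at the two ends -/

section Ideals

variable {k : Type u} [Field k] {A B : Type u} [Ring A] [Ring B] [Algebra k A] [Algebra k B]

lemma leftEval_mul_eq_zero (s : Env k A) {r : Env k A} (hr : leftEval k A r = 0) :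
    leftEval k A (s * r) = 0 := by
  induction s using TensorProduct.induction_on with
  | zero => simp
  | add s t hs ht => rw [add_mul, map_add, hs, ht, add_zero]
  | tmul a b =>
    have h : leftEval k A (a ⊗ₜ b * r) = a * leftEval k A r * unop b := by
      clear hr
      induction r using TensorProduct.induction_on with
      | zero => simp
      | add r s hr hs => simp only [map_add, mul_add, add_mul, hr, hs]
      | tmul c d => simp [mul_assoc]
    rw [h, hr]
    simp

lemma rightEval_mul_eq_zero (ν : A →ₐ[k] A) (s : Env k A) {r : Env k A} (hr : rightEval ν r = 0) :
    rightEval ν (r * s) = 0 := by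
  induction s using TensorProduct.induction_on with
  | zero => simp
  | add s t hs ht => rw [mul_add, map_add, hs, ht, add_zero]
  | tmul a b => rw [← op_unop b, rightEval_mul_tmul, hr]; simp

/-- The left annihilators of `1` in a quotient of the enveloping algebra by a left ideal. -/
def leftCenter (J : Submodule (Env k A) (Env k A)) : Subalgebra k A where
  carrier := {a | (a ⊗ₜ 1 - 1 ⊗ₜ op a : Env k A) ∈ J}
  mul_mem' {a b} ha hb := by
    have h := J.add_mem (J.smul_mem (a ⊗ₜ 1) hb) (J.smul_mem (1 ⊗ₜ op b) ha)
    simpa [mul_sub] using h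
  add_mem' {a b} ha hb := by
    have h := J.add_mem ha hb
    simpa [TensorProduct.add_tmul, TensorProduct.tmul_add, sub_add_sub_comm] using h
  algebraMap_mem' c := by
    simp [Algebra.algebraMap_eq_smul_one, TensorProduct.smul_tmul]

/-- The kernel of multiplication is generated as a left ideal by the elements `a ⊗ 1 - 1 ⊗ a`. As
`leftCenter J` is a subalgebra, only algebra generators have to be tested. -/
lemma mem_of_leftEval_eq_zero {J : Submodule (Env k A) (Env k A)} (hJ : leftCenter J = ⊤)
    {s : Env k A} (hs : leftEval k A s = 0) : s ∈ J := by
  have key : s - 1 ⊗ₜ op (leftEval k A s) ∈ J := by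
    clear hs
    induction s using TensorProduct.induction_on with
    | zero => simp
    | add s t hs ht =>
      have h := J.add_mem hs ht
      rw [map_add, MulOpposite.op_add, TensorProduct.tmul_add, add_sub_add_comm]
      exact h
    | tmul a b =>
      have ha : a ∈ leftCenter J := hJ ▸ Algebra.mem_top
      have h := J.smul_mem (1 ⊗ₜ b) ha
      simpa [mul_sub] using h
  simpa [hs] using key

/-- The elements acting alike on `1` in a quotient of the enveloping algebra by a right ideal. -/
def rightCenter (ν : A →ₐ[k] A) (K : Submodule (Env k A)ᵐᵒᵖ (Env k A)) : Subalgebra k A where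
  carrier := {a | (a ⊗ₜ 1 - 1 ⊗ₜ op (ν a) : Env k A) ∈ K}
  mul_mem' {a b} ha hb := by
    have h := K.add_mem (K.smul_mem (op (b ⊗ₜ 1)) ha) (K.smul_mem (op (1 ⊗ₜ op (ν a))) hb)
    simpa [sub_mul] using h
  add_mem' {a b} ha hb := by
    have h := K.add_mem ha hb
    simpa [TensorProduct.add_tmul, TensorProduct.tmul_add, sub_add_sub_comm] using h
  algebraMap_mem' c := by
    simp [Algebra.algebraMap_eq_smul_one, TensorProduct.smul_tmul]

lemma mem_of_rightEval_eq_zero {ν : A →ₐ[k] A} {K : Submodule (Env k A)ᵐᵒᵖ (Env k A)}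
    (hK : rightCenter ν K = ⊤) {s : Env k A} (hs : rightEval ν s = 0) : s ∈ K := by
  have key : s - 1 ⊗ₜ op (rightEval ν s) ∈ K := by
    clear hs
    induction s using TensorProduct.induction_on with
    | zero => simp
    | add s t hs ht =>
      have h := K.add_mem hs ht
      rw [map_add, MulOpposite.op_add, TensorProduct.tmul_add, add_sub_add_comm]
      exact h
    | tmul a b =>
      have ha : a ∈ rightCenter ν K := hK ▸ Algebra.mem_top
      have h := K.smul_mem (op (1 ⊗ₜ b)) ha
      simpa [sub_mul] using h
  simpa [hs] using key

variable {ι : Type} [Fintype ι] [DecidableEq ι]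

/-- The elements `s` for which `s` in position `o` is a combination of the rows of `M`. -/
def rowIdeal {R : Type*} [Ring R] (M : Matrix ι ι R) (o : ι) : Submodule R R :=
  (LinearMap.range M.vecMulLinear).comap (LinearMap.single R (fun _ => R) o)

/-- The elements `s` for which `s` in position `t` is a combination of the columns of `M`. -/
def colIdeal {R : Type*} [Ring R] (M : Matrix ι ι R) (t : ι) : Submodule Rᵐᵒᵖ R where
  carrier := {s | ∃ u, M.mulVec u = Pi.single t s}
  add_mem' := by
    rintro a b ⟨u, hu⟩ ⟨v, hv⟩
    exact ⟨u + v, by rw [Matrix.mulVec_add, hu, hv, Pi.single_add]⟩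
  zero_mem' := ⟨0, by simp⟩
  smul_mem' := by
    rintro c a ⟨u, hu⟩
    exact ⟨c • u, by rw [Matrix.mulVec_smul, hu, ← Pi.single_smul]⟩

lemma mem_rowIdeal {R : Type*} [Ring R] {M : Matrix ι ι R} {o : ι} {s : R} :
    s ∈ rowIdeal M o ↔ ∃ u, Matrix.vecMul u M = Pi.single o s := Iff.rfl

lemma mem_colIdeal {R : Type*} [Ring R] {M : Matrix ι ι R} {t : ι} {s : R} :
    s ∈ colIdeal M t ↔ ∃ u, M.mulVec u = Pi.single t s := Iff.rfl

lemma map_mem_rowIdeal {R R' : Type*} [Ring R] [Ring R'] (F : R →+* R') {M : Matrix ι ι R} {o : ι}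
    {s : R} (hs : s ∈ rowIdeal M o) : F s ∈ rowIdeal (M.map F) o := by
  obtain ⟨u, hu⟩ := mem_rowIdeal.1 hs
  refine mem_rowIdeal.2 ⟨fun i => F (u i), funext fun c => ?_⟩
  exact (F.map_vecMul M u c).symm.trans
    (by rw [hu]; exact Pi.apply_single (fun _ => F) (fun _ => map_zero F) o s c)

lemma map_mem_colIdeal {R R' : Type*} [Ring R] [Ring R'] (F : R →+* R') {M : Matrix ι ι R} {t : ι}
    {s : R} (hs : s ∈ colIdeal M t) : F s ∈ colIdeal (M.map F) t := by
  obtain ⟨u, hu⟩ := mem_colIdeal.1 hs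
  refine mem_colIdeal.2 ⟨fun i => F (u i), funext fun c => ?_⟩
  exact (F.map_mulVec M u c).symm.trans
    (by rw [hu]; exact Pi.apply_single (fun _ => F) (fun _ => map_zero F) t s c)

lemma leftTwist_refl : leftTwist (AlgEquiv.refl : B ≃ₐ[k] B) = AlgEquiv.refl := by
  ext r
  induction r using TensorProduct.induction_on with
  | zero => simp
  | add r s hr hs => simp only [map_add, hr, hs]
  | tmul a b => rfl

namespace IsOre

variable {f : B →ₐ[k] A} {x : A} {σ : B ≃ₐ[k] B} {δ : B →ₗ[k] B} (H : IsOre f x σ δ)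
  {ν : B →ₐ[k] B} {d : ℕ} {h : ι → ℕ} {o t : ι} {D : Matrix ι ι (Env k B)}

lemma envMap_mem_rowIdeal (f : B →ₐ[k] A) (G : IsDualizing ν d h o t D) (τ : B ≃ₐ[k] B)
    {j : Env k B} (hj : leftEval k B j = 0) :
    envMap f (leftTwist τ j) ∈ rowIdeal ((D.map (leftTwist τ)).map (envMap f)) o :=
  map_mem_rowIdeal (envMap f : Env k B →+* Env k A)
    (map_mem_rowIdeal (leftTwist τ : Env k B →+* Env k B) (mem_rowIdeal.2 ((G.bottom j).2 hj)))

lemma envMap_mem_colIdeal (f : B →ₐ[k] A) (G : IsDualizing ν d h o t D) (τ : B ≃ₐ[k] B)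
    {j : Env k B} (hj : rightEval ν j = 0) :
    envMap f (leftTwist τ j) ∈ colIdeal ((D.map (leftTwist τ)).map (envMap f)) t :=
  map_mem_colIdeal (envMap f : Env k B →+* Env k A)
    (map_mem_colIdeal (leftTwist τ : Env k B →+* Env k B) (mem_colIdeal.2 ((G.top j).2 hj)))

include H

/-- The quotient by this row ideal is `A` tensored over `B` with `A`, twisted by `τ`; the functions
`leftCoef τ i` are its coordinates in powers of `x`. -/
lemma mem_rowIdeal_iff (G : IsDualizing ν d h o t D) (τ : B ≃ₐ[k] B) (r : Env k A) :
    r ∈ rowIdeal ((D.map (leftTwist τ)).map (envMap f)) o ↔ ∀ i, H.leftCoef τ i r = 0 := by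
  refine ⟨fun hr i => ?_, fun hr => ?_⟩
  · obtain ⟨v, hv⟩ := mem_rowIdeal.1 hr
    have h1 := congrFun hv o
    rw [Pi.single_eq_same] at h1
    rw [← h1, Matrix.vecMul, dotProduct, map_sum]
    exact Finset.sum_eq_zero fun c _ =>
      H.leftCoef_mul_envMap τ i _ (G.leftEval_apply_bot c)
  · obtain ⟨N, hN⟩ := H.leftCoef_decomposition τ
      (J := rowIdeal ((D.map (leftTwist τ)).map (envMap f)) o) (fun b => by
        have := envMap_mem_rowIdeal f G τ (j := 1 ⊗ₜ op b - b ⊗ₜ 1) (by simp)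
        simpa using this) r
    simpa [hr] using (hN N le_rfl).2

lemma mem_colIdeal_iff (G : IsDualizing ν d h o t D) (τ : B ≃ₐ[k] B) {μ : B →ₐ[k] B}
    (hμ : ∀ b, μ (τ b) = ν b) (r : Env k A) :
    r ∈ colIdeal ((D.map (leftTwist τ)).map (envMap f)) t ↔ ∀ i, H.rightCoef μ i r = 0 := by
  refine ⟨fun hr i => ?_, fun hr => ?_⟩
  · obtain ⟨v, hv⟩ := mem_colIdeal.1 hr
    have h1 := congrFun hv t
    rw [Pi.single_eq_same] at h1
    rw [← h1, Matrix.mulVec, dotProduct, map_sum]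
    exact Finset.sum_eq_zero fun c _ =>
      H.rightCoef_envMap_mul τ hμ i _ (G.rightEval_apply_top c)
  · let K := colIdeal ((D.map (leftTwist τ)).map (envMap f)) t
    obtain ⟨N, hN⟩ := H.rightCoef_decomposition τ hμ (K := K) K.zero_mem
      (fun r hr s hs => K.add_mem hr hs) (fun r hr s => K.smul_mem (op s) hr) (fun b => by
        have := envMap_mem_colIdeal f G τ (j := b ⊗ₜ 1 - 1 ⊗ₜ op (ν b)) (by simp)
        simpa [K] using this) r
    simpa [hr, K] using (hN N le_rfl).2

/-- In coordinates the hypothesis reads `a i = a (i + 1) * x`, and almost all `a i` vanish. -/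
lemma rowIdeal_of_mul (G : IsDualizing ν d h o t D) (s : Env k A)
    (hs : s * (x ⊗ₜ 1 - 1 ⊗ₜ op x) ∈ rowIdeal (D.map (envMap f)) o) :
    s ∈ rowIdeal ((D.map (leftTwist σ)).map (envMap f)) o := by
  have h1 := H.mem_rowIdeal_iff G AlgEquiv.refl (s * (x ⊗ₜ 1 - 1 ⊗ₜ op x))
  rw [leftTwist_refl] at h1
  replace h1 := h1.1 hs
  obtain ⟨N, hN⟩ := H.leftCoef_decomposition σ (J := ⊤) (fun _ => trivial) s
  refine (H.mem_rowIdeal_iff G σ s).2 (eq_zero_of_shift (fun i hi => (hN i hi).1) (y := x)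
    fun i => ?_)
  have h2 := H.leftCoef_succ_mul s i
  rw [h1] at h2
  exact (sub_eq_zero.1 h2.symm).symm

/-- The same recursion for the dual complex, with `θ • x` in place of `x`. -/
lemma colIdeal_of_mul (G : IsDualizing ν d h o t D) {μ : B →ₐ[k] B} {θ : k}
    (hμ : ∀ b, μ (σ b) = ν b) (h1 : ∀ b, σ (μ b) = μ (σ b)) (h2 : ∀ b, μ (δ b) = θ • δ (μ b))
    (s : Env k A)
    (hs : (x ⊗ₜ 1 - θ • 1 ⊗ₜ op x) * s ∈ colIdeal ((D.map (leftTwist σ)).map (envMap f)) t) :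
    s ∈ colIdeal (D.map (envMap f)) t := by
  have hμσ : μ.comp (σ : B →ₐ[k] B) = ν := AlgHom.ext hμ
  have h3 := H.mem_colIdeal_iff G AlgEquiv.refl (μ := ν) (fun _ => rfl) s
  rw [leftTwist_refl] at h3
  have h4 := (H.mem_colIdeal_iff G σ hμ _).1 hs
  obtain ⟨N, hN⟩ := H.rightCoef_decomposition AlgEquiv.refl (μ := ν) (ν := ν) (fun _ => rfl)
    (K := Set.univ) trivial (fun _ _ _ _ => trivial) (fun _ _ _ => trivial) (fun _ => trivial) s
  refine h3.2 (eq_zero_of_shift (fun i hi => (hN i hi).1) (y := θ • x) fun i => ?_)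
  have h5 := H.rightCoef_succ_mul h1 h2 s i
  rw [h4, hμσ] at h5
  rw [sub_eq_zero.1 h5.symm, mul_smul_comm]

end IsOre

end Ideals

/-! ### The inductive step along an Ore extension -/

section Step

variable {k : Type u} [Field k] {A B : Type u} [Ring A] [Ring B] [Algebra k A] [Algebra k B]
variable {ι : Type} [Fintype ι] [DecidableEq ι]

lemma leftEval_envMap (f : B →ₐ[k] A) (r : Env k B) :
    leftEval k A (envMap f r) = f (leftEval k B r) := by
  induction r using TensorProduct.induction_on with
  | zero => simp
  | add r s hr hs => simp only [map_add, hr, hs]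
  | tmul a b => simp

lemma rightEval_envMap {f : B →ₐ[k] A} {σ : B ≃ₐ[k] B} {ν : B →ₐ[k] B} {νA : A →ₐ[k] A}
    (hν : ∀ b, νA (f (σ b)) = f (ν b)) (r : Env k B) :
    rightEval νA (envMap f (leftTwist σ r)) = f (rightEval ν r) := by
  induction r using TensorProduct.induction_on with
  | zero => simp
  | add r s hr hs => simp only [map_add, hr, hs]
  | tmul a b => simp [hν]

lemma IsOre.subalgebra_eq_top {f : B →ₐ[k] A} {x : A} {σ : B ≃ₐ[k] B} {δ : B →ₗ[k] B}
    (H : IsOre f x σ δ) (P : Subalgebra k A) (hf : ∀ b, f b ∈ P) (hx : x ∈ P) : P = ⊤ :=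
  eq_top_iff.2 fun a _ => H.induction P.zero_mem (fun _ _ => P.add_mem)
    (fun b i => P.mul_mem (hf b) (P.pow_mem hx i)) a

namespace IsTorusOre

variable {TA : kˣ × kˣ → (A →ₐ[k] A)} {TB : kˣ × kˣ → (B →ₐ[k] B)} {f : B →ₐ[k] A} {x : A}
  {σ : B ≃ₐ[k] B} {δ : B →ₗ[k] B} {u : kˣ × kˣ} {g : ℤ × ℤ} (H : IsTorusOre TA TB f x σ δ u g)
  {S : AddSubmonoid (ℤ × ℤ)}
  {ν : B →ₐ[k] B} {d : ℕ} {w : ℤ × ℤ} {h : ι → ℕ} {deg : ι → ℤ × ℤ} {o t : ι}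
  {D : Matrix ι ι (Env k B)} (G : IsGradedDualizing TB ν d w h deg o t D)

include H

lemma tmul_one_mem_homog : (x ⊗ₜ 1 : Env k A) ∈ homog (torusEnv TA) g := by
  have := tmul_mem_homog H.mem_homog (one_mem_homog (T := TA))
  rwa [add_zero] at this

lemma one_tmul_mem_homog : (1 ⊗ₜ op x : Env k A) ∈ homog (torusEnv TA) g := by
  have := tmul_mem_homog (one_mem_homog (T := TA)) H.mem_homog
  rwa [zero_add] at this

/-- Apply `νA` to the commutation rule and compare the terms free of `x`. This is the compatibility
required by `colIdeal_of_mul`. -/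
lemma twisted_delta {νA : A →ₐ[k] A} {θ : kˣ} (hν : ∀ b, νA (f (σ b)) = f (ν b))
    (hx : νA x = (θ : k) • x) (hσν : ∀ b, σ (ν b) = ν (σ b)) (b : B) :
    ν (σ.symm (δ b)) = (θ : k) • δ (ν (σ.symm b)) := by
  have hν' : ∀ b, νA (f b) = f (ν (σ.symm b)) := fun b => by rw [← hν, σ.apply_symm_apply]
  apply H.injective
  have h := congrArg νA (H.comm b)
  rw [map_mul, map_add, map_mul, hx, hν', hν', hν', smul_mul_assoc, H.comm, smul_add, mul_smul_comm,
    hσν, σ.symm_apply_apply, σ.apply_symm_apply] at h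
  rw [map_smul]
  exact (add_left_cancel h).symm

include G

/-- The cone of `Φ` has the required exactness because the end entries of `Φ` are exactly `x ⊗ 1 - 1
⊗ x` and `x ⊗ 1 - θ • 1 ⊗ x`, with `θ` the weight of the top degree. The second of these dictates
`νA x = θ • x`. -/
theorem exists_dualizing [CharZero k] (hS : ⨆ g ∈ S, homog TB g = ⊤) (hg : g ∉ S)
    {νA : A →ₐ[k] A} (hν : ∀ b, νA (f (σ b)) = f (ν b)) (hx : νA x = (weight w u : k) • x)
    (hσν : ∀ b, σ (ν b) = ν (σ b)) :
    ∃ D', IsGradedDualizing TA νA (d + 1) (w + g) (Sum.elim h fun r => h r + 1)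
      (Sum.elim deg fun r => deg r + g) (Sum.inl o) (Sum.inr t) D' := by
  obtain ⟨γ, hγ, hγg, hΦ⟩ := H.exists_connecting G hS hg
  set M := D.map (envMap f) with hM
  set N := (D.map (leftTwist σ)).map (envMap f) with hN
  set Φ := oreDiagonal x u deg + γ.map (envMap f) with hΦdef
  have hΦapp : ∀ r c, Φ r c = (if r = c then x ⊗ₜ 1 - (weight (deg r) u : k) • 1 ⊗ₜ op x else 0) +
      envMap f (γ r c) := fun r c => by
    rw [hΦdef, Matrix.add_apply, oreDiagonal, Matrix.diagonal_apply, Matrix.map_apply]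
  have hγo := connecting_bot G hS hg hγ hγg
  have hγt := connecting_top G hS hg hγ hγg
  have hγo' : ∀ c, γ o c = 0 := fun c => by
    by_contra h1
    have h2 := hγ o c h1
    rw [G.h_bot, eq_comm, G.bot_iff] at h2
    exact h1 (h2 ▸ hγo o)
  have hγt' : ∀ c, γ t c = 0 := fun c => by
    by_contra h1
    have h2 := hγ t c h1
    rw [G.h_top, eq_comm, G.top_iff] at h2
    exact h1 (h2 ▸ hγt t)
  have hΦdeg : ∀ r c, Φ r c ≠ 0 → h r = h c := fun r c hrc => by
    by_contra h1
    rw [hΦapp, if_neg (by rintro rfl; exact h1 rfl),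
      show γ r c = 0 by by_contra h2; exact h1 (hγ r c h2)] at hrc
    simp at hrc
  have hΦo : ∀ c, Φ o c = if c = o then x ⊗ₜ 1 - 1 ⊗ₜ op x else 0 := fun c => by
    rw [hΦapp, hγo', G.deg_bot]
    simp [eq_comm]
  have hΦt : ∀ r, Φ r t = if r = t then x ⊗ₜ 1 - (weight w u : k) • 1 ⊗ₜ op x else 0 := fun r => by
    rw [hΦapp, hγt, ← G.deg_top]
    split_ifs with h1 <;> simp [h1]
  have hΦo' : ∀ r, Φ r o = if r = o then x ⊗ₜ 1 - 1 ⊗ₜ op x else 0 := fun r => by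
    rw [hΦapp, hγo]
    split_ifs with h1
    · simp [h1, G.deg_bot]
    · simp
  have hΦt' : ∀ c, Φ t c = if c = t then x ⊗ₜ 1 - (weight w u : k) • 1 ⊗ₜ op x else 0 := fun c => by
    rw [hΦapp, hγt', G.deg_top]
    simp [eq_comm]
  have hMM : M * M = 0 := by
    rw [hM, ← Matrix.map_mul, G.sq, Matrix.map_zero _ (map_zero _)]
  have hNN : N * N = 0 := by
    rw [hN, ← Matrix.map_mul, ← Matrix.map_mul, G.sq, Matrix.map_zero _ (map_zero _),
      Matrix.map_zero _ (map_zero _)]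
  have hν' : ∀ b, νA (f b) = f (ν (σ.symm b)) := fun b => by rw [← hν, σ.apply_symm_apply]
  refine ⟨coneMatrix M N Φ, ⟨⟨?_, ?_, ?_, ?_, coneMatrix_sq hMM hNN hΦ, ?_, ?_, ?_, ?_⟩, ?_, ?_, ?_⟩⟩
  · rintro (r | r) (c | c) hrc
    · refine G.degree r c fun h1 => hrc ?_
      change envMap f (D r c) = 0
      rw [h1, map_zero]
    · exact absurd rfl hrc
    · exact congrArg (· + 1) (hΦdeg r c hrc)
    · refine congrArg (· + 1) (G.degree r c fun h1 => hrc ?_)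
      change -envMap f (leftTwist σ (D r c)) = 0
      rw [h1, map_zero, map_zero, neg_zero]
  · rintro (r | r)
    · simpa using G.bot_iff r
    · simp
  · rintro (r | r)
    · exact (G.le_top r).trans (Nat.le_succ d)
    · exact Nat.succ_le_succ (G.le_top r)
  · rintro (r | r)
    · have := G.le_top r
      simp only [Sum.elim_inl, reduceCtorEq, iff_false]
      omega
    · simpa using G.top_iff r
  · exact coneMatrix_row hΦ (H.envMap_rightFree.row_exact G.row)
      ((H.envMap_rightFree.comp (leftTwist σ : Env k B ≃+* Env k B)).row_exact G.row) hΦo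
      (H.rowIdeal_of_mul G.toIsDualizing)
  · intro s
    refine ⟨fun ⟨v, hv⟩ => ?_, fun hs => ?_⟩
    · have h1 := congrFun hv (Sum.inl o)
      rw [Pi.single_eq_same] at h1
      rw [← h1, Matrix.vecMul, dotProduct, map_sum]
      refine Finset.sum_eq_zero fun r _ => leftEval_mul_eq_zero _ ?_
      rcases r with r | r
      · exact (leftEval_envMap f (D r o)).trans (by rw [G.leftEval_apply_bot, map_zero])
      · change leftEval k A (Φ r o) = 0
        rw [hΦo']
        split_ifs <;> simp
    · refine mem_of_leftEval_eq_zero (J := rowIdeal (coneMatrix M N Φ) (Sum.inl o))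
        (H.subalgebra_eq_top _ (fun b => ?_) ?_) hs
      · obtain ⟨v, hv⟩ := mem_rowIdeal.1 (map_mem_rowIdeal (envMap f : Env k B →+* Env k A)
          (mem_rowIdeal.2 ((G.bottom (b ⊗ₜ 1 - 1 ⊗ₜ op b)).2 (by simp))))
        refine mem_rowIdeal.2 ⟨Sum.elim v 0, funext fun c => ?_⟩
        rw [coneMatrix, Matrix.vecMul_fromBlocks]
        rcases c with c | c
        · simpa [Pi.single_apply] using congrFun hv c
        · simp
      -- This row of the cone is `x ⊗ 1 - 1 ⊗ x` at the bottom and zero elsewhere.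
      · refine mem_rowIdeal.2 ⟨Pi.single (Sum.inr o) 1, funext fun c => ?_⟩
        rw [Matrix.single_one_vecMul, Matrix.row_apply]
        rcases c with c | c
        · exact (hΦo c).trans (by simp [Pi.single_apply])
        · change -envMap f (leftTwist σ (D o c)) = _
          rw [show D o c = 0 by
            by_contra h1
            have := G.degree o c h1
            rw [G.h_bot] at this
            omega]
          simp
  · exact coneMatrix_col hΦ (H.envMap_leftFree.col_exact G.col)
      ((H.envMap_leftFree.comp (leftTwist σ : Env k B ≃+* Env k B)).col_exact G.col) hΦt
      (H.colIdeal_of_mul G.toIsDualizing (μ := ν.comp (σ.symm : B →ₐ[k] B))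
        (fun b => congrArg ν (σ.symm_apply_apply b))
        (fun b => by simp [hσν])
        (H.twisted_delta hν hx hσν))
  · intro s
    refine ⟨fun ⟨v, hv⟩ => ?_, fun hs => ?_⟩
    · have h1 := congrFun hv (Sum.inr t)
      rw [Pi.single_eq_same] at h1
      rw [← h1, Matrix.mulVec, dotProduct, map_sum]
      refine Finset.sum_eq_zero fun c _ => rightEval_mul_eq_zero _ _ ?_
      rcases c with c | c
      · change rightEval νA (Φ t c) = 0
        rw [hΦt']
        split_ifs <;> simp [hx]
      · change rightEval νA (-envMap f (leftTwist σ (D t c))) = 0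
        rw [map_neg, rightEval_envMap hν, G.rightEval_apply_top, map_zero, neg_zero]
    · refine mem_of_rightEval_eq_zero (K := colIdeal (coneMatrix M N Φ) (Sum.inr t)) (ν := νA)
        (H.subalgebra_eq_top _ (fun b => ?_) ?_) hs
      · obtain ⟨v, hv⟩ := mem_colIdeal.1 (IsOre.envMap_mem_colIdeal f G.toIsDualizing σ
          (j := σ.symm b ⊗ₜ 1 - 1 ⊗ₜ op (ν (σ.symm b))) (by simp))
        -- The sign compensates for the block `-N`.
        refine mem_colIdeal.2 ⟨Sum.elim 0 (-v), funext fun r => ?_⟩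
        rw [coneMatrix, Matrix.fromBlocks_mulVec]
        rcases r with r | r
        · simp
        · simpa [Pi.single_apply, Matrix.mulVec_neg, Matrix.neg_mulVec, hν', hN] using congrFun hv r
      -- The block `M` has nothing in column `t`, so this column of the cone is the top entry of `Φ`
      -- alone.
      · refine mem_colIdeal.2 ⟨Pi.single (Sum.inl t) 1, funext fun r => ?_⟩
        rw [Matrix.mulVec_single_one, Matrix.col_apply]
        rcases r with r | r
        · change envMap f (D r t) = _
          rw [show D r t = 0 by
            by_contra h1
            have := G.degree r t h1
            rw [G.h_top] at this
            have := G.le_top r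
            omega]
          simp
        · exact (hΦt r).trans (by simp [Pi.single_apply, hx])
  · rintro (r | r) (c | c)
    · exact H.envMap_mem_homog (G.homogeneous r c)
    · exact Submodule.zero_mem _
    · change Φ r c ∈ homog (torusEnv TA) (deg r + g - deg c)
      rw [hΦapp, add_sub_right_comm]
      refine Submodule.add_mem _ ?_ (H.envMap_mem_homog (hγg r c))
      split_ifs with h1
      · rw [h1, sub_self, zero_add]
        exact Submodule.sub_mem _ H.tmul_one_mem_homog
          (Submodule.smul_mem _ _ H.one_tmul_mem_homog)
      · exact Submodule.zero_mem _
    · change -envMap f (leftTwist σ (D r c)) ∈ homog (torusEnv TA) (deg r + g - (deg c + g))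
      rw [add_sub_add_right_eq_sub]
      exact Submodule.neg_mem _
        (H.envMap_mem_homog (H.leftTwist_mem_homog hS (G.homogeneous r c)))
  · exact G.deg_bot
  · exact congrArg (· + g) G.deg_top

end IsTorusOre

/-- Existence of graded dualizing data. -/
def HasGradedDualizing (T : kˣ × kˣ → (B →ₐ[k] B)) (ν : B →ₐ[k] B) (d : ℕ) (w : ℤ × ℤ) : Prop :=
  ∃ (ι : Type) (_ : Fintype ι) (_ : DecidableEq ι) (h : ι → ℕ) (deg : ι → ℤ × ℤ) (o t : ι)
    (D : Matrix ι ι (Env k B)), IsGradedDualizing T ν d w h deg o t D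

lemma torus_mul {T : kˣ × kˣ → (B →ₐ[k] B)} {S : AddSubmonoid (ℤ × ℤ)}
    (hS : ⨆ g ∈ S, homog T g = ⊤) (p q : kˣ × kˣ) (b : B) : T p (T q b) = T (p * q) b := by
  induction b using homog_induction hS with
  | h0 => simp
  | hadd a b ha hb => simp only [map_add, ha, hb]
  | hh g _ a ha =>
    rw [ha, map_smul, ha, ha, smul_smul]
    congr 1
    simp [weight, mul_zpow]
    ring

/-- With `ν` and `σ` both from the torus, the new Nakayama automorphism is again a torus element,
provided that it scales `x` correctly; that is the condition `hn`. -/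
theorem HasGradedDualizing.step [CharZero k] {TA : kˣ × kˣ → (A →ₐ[k] A)}
    {TB : kˣ × kˣ → (B →ₐ[k] B)} {f : B →ₐ[k] A} {x : A} {σ : B ≃ₐ[k] B} {δ : B →ₗ[k] B}
    {u n : kˣ × kˣ} {g w : ℤ × ℤ} {d : ℕ} {S : AddSubmonoid (ℤ × ℤ)}
    (G : HasGradedDualizing TB (TB n) d w) (H : IsTorusOre TA TB f x σ δ u g)
    (hS : ⨆ g ∈ S, homog TB g = ⊤) (hg : g ∉ S) (hn : weight g (n * u⁻¹) = weight w u) :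
    HasGradedDualizing TA (TA (n * u⁻¹)) (d + 1) (w + g) := by
  obtain ⟨ι, _, _, h, deg, o, t, D, G⟩ := G
  obtain ⟨D', G'⟩ := H.exists_dualizing G hS hg (νA := TA (n * u⁻¹))
    (fun b => by rw [H.torus_coe, H.sigma_eq, torus_mul hS, inv_mul_cancel_right])
    (by rw [H.mem_homog, hn]) (fun b => (H.torus_sigma hS n b).symm)
  exact ⟨ι ⊕ ι, inferInstance, inferInstance, _, _, _, _, D', G'⟩

lemma hasGradedDualizing_base :
    HasGradedDualizing (fun _ => AlgHom.id k k) (AlgHom.id k k) 0 0 := by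
  have key : ∀ s : Env k k, s = 1 ⊗ₜ op (leftEval k k s) := fun s => by
    induction s using TensorProduct.induction_on with
    | zero => simp
    | add r s hr hs =>
      rw [map_add, MulOpposite.op_add, TensorProduct.tmul_add, ← hr, ← hs]
    | tmul a b =>
      conv_lhs => rw [← mul_one a, ← smul_eq_mul, TensorProduct.smul_tmul]
      rfl
  have hl : ∀ s : Env k k, leftEval k k s = 0 ↔ s = 0 :=
    fun s => ⟨fun h => by rw [key s, h]; simp, fun h => by simp [h]⟩
  have hr : ∀ s : Env k k, rightEval (AlgHom.id k k) s = leftEval k k s := fun s => by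
    induction s using TensorProduct.induction_on with
    | zero => simp
    | add r s hr hs => rw [map_add, map_add, hr, hs]
    | tmul a b => simp [mul_comm]
  refine ⟨Unit, inferInstance, inferInstance, fun _ => 0, fun _ => 0, (), (), 0,
    ⟨⟨fun r c h => absurd rfl h, by simp, by simp, by simp, by simp, fun v _ => ?_, fun s => ?_,
      fun v _ => ?_, fun s => ?_⟩, fun r c => Submodule.zero_mem _, rfl, rfl⟩⟩
  · exact ⟨0, v (), funext fun _ => by simp⟩
  · rw [hl]
    exact ⟨fun ⟨u, hu⟩ => by simpa using (congrFun hu ()).symm, fun h => ⟨0, by simp [h]⟩⟩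
  · exact ⟨0, v (), funext fun _ => by simp⟩
  · rw [hr, hl]
    exact ⟨fun ⟨u, hu⟩ => by simpa using (congrFun hu ()).symm, fun h => ⟨0, by simp [h]⟩⟩

end Step

/-! ### Existence and universal property of Ore extensions -/

section OreExistence

variable {k : Type u} [Field k] {A B C : Type u} [Ring A] [Ring B] [Ring C] [Algebra k A]
  [Algebra k B] [Algebra k C]

namespace IsOre

variable {f : B →ₐ[k] A} {x : A} {σ : B ≃ₐ[k] B} {δ : B →ₗ[k] B}

theorem exists_lift (H : IsOre f x σ δ) {s : Set B} (hs : Algebra.adjoin k s = ⊤) (φ : B →ₐ[k] C)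
    (c : C) (hc : ∀ b ∈ s, c * φ b = φ (σ b) * c + φ (δ b)) :
    ∃ ψ : A →ₐ[k] C, (∀ b, ψ (f b) = φ b) ∧ ψ x = c := by
  have hc' : ∀ b, c * φ b = φ (σ b) * c + φ (δ b) := by
    intro b
    have hb : b ∈ Algebra.adjoin k s := hs ▸ Algebra.mem_top
    induction hb using Algebra.adjoin_induction with
    | mem b hb => exact hc b hb
    | algebraMap r =>
      rw [Algebra.algebraMap_eq_smul_one, map_smul, map_smul, map_smul, map_smul, H.map_one]
      simp
    | add a b _ _ ha hb => simp only [map_add, mul_add, add_mul, ha, hb]; abel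
    | mul a b _ _ ha hb =>
      rw [map_mul, ← mul_assoc, ha, add_mul, mul_assoc, hb, H.leibniz, map_add, map_mul, map_mul,
        map_mul, map_mul, mul_add, mul_assoc, add_assoc]
  let L : A →ₗ[k] C := leftComb φ (fun i : ℕ => c ^ i) ∘ₗ H.coef.toLinearMap
  have hL : ∀ b i, L (f b * x ^ i) = φ b * c ^ i := fun b i => by simp [L, leftComb]
  have hLf : ∀ b a, L (f b * a) = φ b * L a := fun b a => by
    induction a using H.induction with
    | hz => simp
    | hadd a a' ha ha' => simp only [mul_add, map_add, ha, ha']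
    | hm d i => rw [← mul_assoc, ← map_mul, hL, hL, map_mul, mul_assoc]
  have hLx : ∀ a, L (x * a) = c * L a := fun a => by
    induction a using H.induction with
    | hz => simp
    | hadd a a' ha ha' => simp only [mul_add, map_add, ha, ha']
    | hm d i =>
      rw [H.comm_mul_pow, map_add, hL, hL, hL, ← mul_assoc, hc', add_mul, mul_assoc, pow_succ']
  have hLp : ∀ i a, L (x ^ i * a) = c ^ i * L a := fun i a => by
    induction i with
    | zero => simp
    | succ i ih => rw [pow_succ', mul_assoc, hLx, ih, pow_succ', mul_assoc]
  have hL1 : L 1 = 1 := by simpa using hL 1 0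
  refine ⟨AlgHom.ofLinearMap L hL1 fun a a' => ?_, fun b => by simpa using hL b 0,
    by simpa using hL 1 1⟩
  induction a using H.induction with
  | hz => simp
  | hadd a b ha hb => simp only [add_mul, map_add, ha, hb]
  | hm b i => rw [mul_assoc, hLf, hLp, hL, mul_assoc]

lemma adjoin_eq_top (H : IsOre f x σ δ) {s : Set B} (hs : Algebra.adjoin k s = ⊤) :
    Algebra.adjoin k (insert x (f '' s)) = ⊤ := by
  refine H.subalgebra_eq_top _ (fun b => ?_) (Algebra.subset_adjoin (Set.mem_insert _ _))
  have hb : f b ∈ (Algebra.adjoin k s).map f := ⟨b, by rw [hs]; trivial, rfl⟩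
  rw [AlgHom.map_adjoin] at hb
  exact Algebra.adjoin_mono (Set.subset_insert _ _) hb

lemma comp_equiv (H : IsOre f x σ δ) (e : A ≃ₐ[k] C) :
    IsOre ((e : A →ₐ[k] C).comp f) (e x) σ δ where
  comm b := by simpa using congrArg e (H.comm b)
  free := by
    rw [leftFree_iff]
    have : leftComb ((e : A →ₐ[k] C).comp f) (fun i : ℕ => e x ^ i) =
        (e : A →ₐ[k] C).toLinearMap ∘ₗ leftComb f (fun i : ℕ => x ^ i) := by
      ext i b
      simp [leftComb]
    rw [this]
    exact e.bijective.comp H.bijective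

end IsOre

/-- The extension is realized inside the endomorphisms of `ℕ →₀ B`, generated by `oreShift` and the
multiplications by `B`. -/
lemma exists_isOre {σ : B ≃ₐ[k] B} {δ : B →ₗ[k] B}
    (hδ : ∀ b c, δ (b * c) = σ b * δ c + δ b * c) :
    ∃ (A : Type u) (_ : Ring A) (_ : Algebra k A) (f : B →ₐ[k] A) (x : A), IsOre f x σ δ := by
  let E : Subalgebra k (Module.End k (ℕ →₀ B)) := Algebra.adjoin k
    (insert (oreShift σ δ) (Set.range (Algebra.lsmul k k (ℕ →₀ B) : B →ₐ[k] _)))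
  let _ : Ring E := @Subalgebra.toRing k (Module.End k (ℕ →₀ B)) _ _ _ E
  let f : B →ₐ[k] E := (Algebra.lsmul k k (ℕ →₀ B)).codRestrict E
    fun b => Algebra.subset_adjoin (Set.mem_insert_of_mem _ ⟨b, rfl⟩)
  let x : E := ⟨oreShift σ δ, Algebra.subset_adjoin (Set.mem_insert _ _)⟩
  refine ⟨E, ‹_›, E.algebra, f, x, isOre_of_model hδ
    (fun b => Subtype.ext (oreShift_mul_lsmul hδ b)) ?_ E.val (fun b => rfl) rfl⟩
  apply Subalgebra.map_injective (f := E.val) Subtype.val_injective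
  rw [AlgHom.map_adjoin, Set.image_insert_eq, ← Set.range_comp, Algebra.map_top, E.range_val]
  rfl

lemma IsOre.exists_torus {T : kˣ × kˣ → (B →ₐ[k] B)} {S : AddSubmonoid (ℤ × ℤ)}
    {f : B →ₐ[k] A} {x : A} {σ : B ≃ₐ[k] B} {δ : B →ₗ[k] B} (H : IsOre f x σ δ)
    (hS : ⨆ g ∈ S, homog T g = ⊤) {u : kˣ × kˣ} {g : ℤ × ℤ} (hσ : ∀ b, σ b = T u b)
    {s : Set B} (hs : Algebra.adjoin k s = ⊤)
    (hδ : ∀ b ∈ s, ∃ h, b ∈ homog T h ∧ δ b ∈ homog T (h + g)) :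
    ∃ TA : kˣ × kˣ → (A →ₐ[k] A), IsTorusOre TA T f x σ δ u g := by
  have h1 : ∀ p, ∃ ψ : A →ₐ[k] A, (∀ b, ψ (f b) = f (T p b)) ∧ ψ x = (weight g p : k) • x := by
    refine fun p => H.exists_lift hs (f.comp (T p)) ((weight g p : k) • x) fun b hb => ?_
    obtain ⟨h, hb, hδb⟩ := hδ b hb
    simp only [AlgHom.comp_apply]
    rw [hδb p, hσ, torus_comm hS, ← hσ, hb, map_smul, map_smul, map_smul, map_smul, smul_mul_smul_comm,
      H.comm, smul_mul_smul_comm, smul_add, weight_add, Units.val_mul,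
      mul_comm (weight g p : k)]
  choose TA h2 h3 using h1
  exact ⟨TA, H, hσ, h2, h3⟩

end OreExistence

/-! ### Presented algebras with dualizing data -/

section Presentation

variable {k : Type u} [Field k] {A B : Type u} [Ring A] [Ring B] [Algebra k A] [Algebra k B]

/-- An algebra presented by generators `z` and relations `P`, with an action of the torus for
which the generators are homogeneous with degrees in `S`, and with graded dualizing data. -/
structure IsPresentedDualizing {m : ℕ}
    (P : ∀ (C : Type u) [Ring C] [Algebra k C], (Fin m → C) → Prop)
    (deg : Fin m → ℤ × ℤ) (S : AddSubmonoid (ℤ × ℤ)) (T : kˣ × kˣ → (B →ₐ[k] B)) (n : kˣ × kˣ)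
    (w : ℤ × ℤ) (d : ℕ) (z : Fin m → B) : Prop where
  natural : ∀ (C D : Type u) [Ring C] [Algebra k C] [Ring D] [Algebra k D] (φ : C →ₐ[k] D) v,
    P C v → P D fun i => φ (v i)
  rel : P B z
  gen : Algebra.adjoin k (Set.range z) = ⊤
  lift : ∀ (C : Type u) [Ring C] [Algebra k C] v, P C v → ∃ φ : B →ₐ[k] C, ∀ i, φ (z i) = v i
  homogeneous : ∀ i, z i ∈ homog T (deg i)
  deg_mem : ∀ i, deg i ∈ S
  dual : HasGradedDualizing T (T n) d w

/-- The relations `v₀ vᵢ = χᵢ vᵢ v₀ + qᵢ` added to the relations `P` in an Ore extension. -/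
def OreRel {m : ℕ} (P : ∀ (C : Type u) [Ring C] [Algebra k C], (Fin m → C) → Prop)
    (χ : Fin m → k) (q : Fin m → FreeAlgebra k (Fin m)) (C : Type u) [Ring C] [Algebra k C]
    (v : Fin (m + 1) → C) : Prop :=
  P C (Fin.tail v) ∧ ∀ i : Fin m,
    v 0 * v i.succ = χ i • (v i.succ * v 0) + FreeAlgebra.lift k (Fin.tail v) (q i)

lemma map_freeAlgebra_lift {I : Type*} (φ : A →ₐ[k] B) (v : I → A) (q : FreeAlgebra k I) :
    φ (FreeAlgebra.lift k v q) = FreeAlgebra.lift k (fun i => φ (v i)) q := by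
  have : φ.comp (FreeAlgebra.lift k v) = FreeAlgebra.lift k (fun i => φ (v i)) := by
    ext i
    simp
  exact DFunLike.congr_fun this q

namespace IsPresentedDualizing

variable {m : ℕ} {P : ∀ (C : Type u) [Ring C] [Algebra k C], (Fin m → C) → Prop}
  {deg : Fin m → ℤ × ℤ} {S : AddSubmonoid (ℤ × ℤ)} {T : kˣ × kˣ → (B →ₐ[k] B)} {n : kˣ × kˣ}
  {w : ℤ × ℤ} {d : ℕ} {z : Fin m → B} (st : IsPresentedDualizing P deg S T n w d z)

include st

lemma span : ⨆ g ∈ S, homog T g = ⊤ :=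
  iSup_homog_eq_top_of_adjoin st.gen (by rintro _ ⟨i, rfl⟩; exact ⟨_, st.deg_mem i, st.homogeneous i⟩)

/-- A skew derivation is a homomorphism into upper triangular matrices, so it exists once those
matrices satisfy the defining relations `P`. -/
theorem exists_ore (u : kˣ × kˣ) (q : Fin m → FreeAlgebra k (Fin m))
    (hθ : P (Matrix (Fin 2) (Fin 2) B) fun i => !![T u (z i), FreeAlgebra.lift k z (q i); 0, z i]) :
    ∃ (A : Type u) (_ : Ring A) (_ : Algebra k A) (f : B →ₐ[k] A) (x : A) (σ : B ≃ₐ[k] B)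
      (δ : B →ₗ[k] B), IsOre f x σ δ ∧ (∀ b, σ b = T u b) ∧
        ∀ i, δ (z i) = FreeAlgebra.lift k z (q i) := by
  obtain ⟨θ, hθ⟩ := st.lift _ _ hθ
  obtain ⟨δ, hδ, hδ'⟩ := exists_skewDerivation (torusEquiv st.span u) _ st.gen θ
    (by rintro _ ⟨i, rfl⟩; simp [hθ])
  obtain ⟨A, _, _, f, x, H⟩ := exists_isOre hδ'
  exact ⟨A, _, _, f, x, _, _, H, fun b => rfl, fun i => by simp [hδ, hθ]⟩

theorem step [CharZero k] {f : B →ₐ[k] A} {x : A} {σ : B ≃ₐ[k] B} {δ : B →ₗ[k] B}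
    (H : IsOre f x σ δ) {u : kˣ × kˣ} (hσ : ∀ b, σ b = T u b) {q : Fin m → FreeAlgebra k (Fin m)}
    (hδ : ∀ i, δ (z i) = FreeAlgebra.lift k z (q i)) {χ : Fin m → k}
    (hχ : ∀ i, (weight (deg i) u : k) = χ i) {g : ℤ × ℤ} (hg : g ∉ S)
    (hq : ∀ i, FreeAlgebra.lift k z (q i) ∈ homog T (deg i + g))
    {S' : AddSubmonoid (ℤ × ℤ)} (hS : ∀ i, deg i ∈ S') (hgS : g ∈ S') {n' : kˣ × kˣ}
    (hn' : n' * u = n) {w' : ℤ × ℤ} (hw' : w + g = w') (hn : weight g n' = weight w u) :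
    ∃ TA, IsPresentedDualizing (OreRel P χ q) (Fin.cons g deg) S' TA n' w' (d + 1)
      (Fin.cons x fun i => f (z i)) := by
  obtain rfl := eq_mul_inv_of_mul_eq hn'
  subst hw'
  obtain ⟨TA, HT⟩ := H.exists_torus st.span hσ st.gen (g := g)
    (by rintro _ ⟨i, rfl⟩; exact ⟨_, st.homogeneous i, by rw [hδ]; exact hq i⟩)
  have hσz : ∀ i, σ (z i) = χ i • z i := fun i => by rw [hσ, st.homogeneous i, hχ]
  refine ⟨TA, ?_, ⟨?_, fun i => ?_⟩, ?_, ?_, ?_, ?_, st.dual.step HT st.span hg hn⟩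
  · intro C D _ _ _ _ φ v hv
    refine ⟨st.natural C D φ _ hv.1, fun i => ?_⟩
    have := congrArg φ (hv.2 i)
    rw [map_add, map_smul, map_mul, map_mul, map_freeAlgebra_lift] at this
    exact this
  · exact st.natural B A f z st.rel
  · rw [Fin.cons_zero, Fin.cons_succ, H.comm, hσz, hδ, map_smul, smul_mul_assoc,
      map_freeAlgebra_lift]
    rfl
  · rw [Fin.range_cons, Set.range_comp' f z]
    exact H.adjoin_eq_top st.gen
  · intro C _ _ v hv
    obtain ⟨φ, hφ⟩ := st.lift C _ hv.1
    obtain ⟨ψ, hψ, hψx⟩ := H.exists_lift st.gen φ (v 0) (by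
      rintro _ ⟨i, rfl⟩
      rw [hσz, hδ, map_smul, map_freeAlgebra_lift, funext hφ, hφ, smul_mul_assoc]
      exact hv.2 i)
    refine ⟨ψ, fun i => Fin.cases ?_ (fun i => ?_) i⟩
    · rw [Fin.cons_zero, hψx]
    · rw [Fin.cons_succ, hψ, hφ]
      rfl
  · refine fun i => Fin.cases HT.mem_homog (fun i p => ?_) i
    rw [Fin.cons_succ, Fin.cons_succ, HT.torus_coe, st.homogeneous i, map_smul]
  · exact fun i => Fin.cases hgS hS i

end IsPresentedDualizing

/-- The empty set of relations on the empty set of generators. -/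
def EmptyRel (k : Type u) [Field k] (C : Type u) [Ring C] [Algebra k C] (_ : Fin 0 → C) : Prop :=
  True

lemma isPresentedDualizing_base :
    IsPresentedDualizing (EmptyRel k) ![] ⊥ (fun _ => AlgHom.id k k) 1 0 0 ![] where
  natural _ _ _ _ _ _ _ _ _ := trivial
  rel := trivial
  gen := by
    rw [eq_top_iff]
    intro a _
    exact Subalgebra.algebraMap_mem _ a
  lift C _ _ v _ := ⟨Algebra.ofId k C, fun i => i.elim0⟩
  homogeneous i := i.elim0
  deg_mem i := i.elim0
  dual := hasGradedDualizing_base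

end Presentation

/-! ### The first four Ore extensions -/

section Tower

variable {k : Type u} [Field k]

/-- The relations on `y`. -/
abbrev RelY (k : Type u) [Field k] := OreRel (EmptyRel k) ![] ![]

/-- The relations on `c, y`. -/
abbrev RelCY (t h : kˣ) := OreRel (RelY k) ![(t / h : k)] ![0]

/-- The relations on `a, c, y`. -/
abbrev RelACY (t h : kˣ) := OreRel (RelCY t h) ![(t / h : k), (-t : k)] ![0, FreeAlgebra.ι k 0]

/-- The relations on `b, a, c, y`. -/
abbrev RelBACY (t h : kˣ) (r : k) := OreRel (RelACY t h) ![(t / h : k), -t ^ 3, -t ^ 2 * h]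
  ![0, -(r * (t / h + t)) • FreeAlgebra.ι k 0 ^ 3, -r • FreeAlgebra.ι k 0 ^ 2]

/-- The relations on `x, b, a, c, y`. -/
abbrev RelXBACY (t h : kˣ) (r : k) := OreRel (RelBACY t h r) ![(t / h : k), -t, -t ^ 2 * h, t * h]
  ![0, FreeAlgebra.ι k 0, -r • FreeAlgebra.ι k 1 ^ 2, FreeAlgebra.ι k 1]

lemma relCY_iff {t h : kˣ} {C : Type u} [Ring C] [Algebra k C] {v : Fin 2 → C} :
    RelCY t h C v ↔ v 0 * v 1 = (t / h : k) • (v 1 * v 0) := by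
  simp [OreRel, EmptyRel, Fin.forall_fin_succ, Fin.tail]

lemma relACY_iff {t h : kˣ} {C : Type u} [Ring C] [Algebra k C] {v : Fin 3 → C} :
    RelACY t h C v ↔ v 1 * v 2 = (t / h : k) • (v 2 * v 1) ∧
      v 0 * v 1 = (t / h : k) • (v 1 * v 0) ∧
      v 0 * v 2 = (-t : k) • (v 2 * v 0) + v 1 := by
  refine (and_congr relCY_iff Iff.rfl).trans ?_
  simp [Fin.forall_fin_succ, Fin.tail]

lemma relBACY_iff {t h : kˣ} {r : k} {C : Type u} [Ring C] [Algebra k C] {v : Fin 4 → C} :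
    RelBACY t h r C v ↔ (v 2 * v 3 = (t / h : k) • (v 3 * v 2) ∧
      v 1 * v 2 = (t / h : k) • (v 2 * v 1) ∧
      v 1 * v 3 = (-t : k) • (v 3 * v 1) + v 2) ∧
      v 0 * v 1 = (t / h : k) • (v 1 * v 0) ∧
      v 0 * v 2 = (-t ^ 3 : k) • (v 2 * v 0) + (-(r * (t / h + t))) • v 1 ^ 3 ∧
      v 0 * v 3 = (-t ^ 2 * h : k) • (v 3 * v 0) + (-r) • v 1 ^ 2 := by
  refine (and_congr relACY_iff Iff.rfl).trans ?_
  simp [Fin.forall_fin_succ, Fin.tail]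

lemma relXBACY_iff {t h : kˣ} {r : k} {C : Type u} [Ring C] [Algebra k C] {v : Fin 5 → C} :
    RelXBACY t h r C v ↔ ((v 3 * v 4 = (t / h : k) • (v 4 * v 3) ∧
      v 2 * v 3 = (t / h : k) • (v 3 * v 2) ∧
      v 2 * v 4 = (-t : k) • (v 4 * v 2) + v 3) ∧
      v 1 * v 2 = (t / h : k) • (v 2 * v 1) ∧
      v 1 * v 3 = (-t ^ 3 : k) • (v 3 * v 1) + (-(r * (t / h + t))) • v 2 ^ 3 ∧
      v 1 * v 4 = (-t ^ 2 * h : k) • (v 4 * v 1) + (-r) • v 2 ^ 2) ∧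
      v 0 * v 1 = (t / h : k) • (v 1 * v 0) ∧
      v 0 * v 2 = (-t : k) • (v 2 * v 0) + v 1 ∧
      v 0 * v 3 = (-t ^ 2 * h : k) • (v 3 * v 0) + (-r) • v 2 ^ 2 ∧
      v 0 * v 4 = (t * h : k) • (v 4 * v 0) + v 2 := by
  refine (and_congr relBACY_iff Iff.rfl).trans ?_
  simp [Fin.forall_fin_succ, Fin.tail]

/-- The bidegrees on which a linear form is nonnegative. -/
def halfPlane (a b : ℤ) : AddSubmonoid (ℤ × ℤ) where
  carrier := {g | 0 ≤ a * g.1 + b * g.2}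
  add_mem' {g h} hg hh := by
    simp only [Set.mem_ofPred_eq, Prod.fst_add, Prod.snd_add] at *
    linarith
  zero_mem' := by simp

@[simp] lemma mem_halfPlane {a b : ℤ} {g : ℤ × ℤ} : g ∈ halfPlane a b ↔ 0 ≤ a * g.1 + b * g.2 :=
  Iff.rfl

/-- The half plane here, and in each later stage before `x`, contains the degrees of the generators
so far and misses the degree of the next one. -/
lemma exists_tower_y [CharZero k] :
    ∃ (B : Type u) (_ : Ring B) (_ : Algebra k B) (T : kˣ × kˣ → (B →ₐ[k] B)) (z : Fin 1 → B),
      IsPresentedDualizing (RelY k) ![(0, 1)] (halfPlane (-1) 0) T 1 (0, 1) 1 z := by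
  obtain ⟨A, _, _, f, x, σ, δ, H, hσ, hδ⟩ :=
    (isPresentedDualizing_base (k := k)).exists_ore 1 ![] trivial
  obtain ⟨T, hT⟩ := isPresentedDualizing_base.step H (u := 1) hσ hδ (χ := ![]) (g := (0, 1))
    (S' := halfPlane (-1) 0) (fun i => i.elim0) (by simp) (fun i => i.elim0) (fun i => i.elim0)
    (by simp) (mul_one 1) (zero_add _) (by simp [weight])
  exact ⟨A, _, _, T, _, hT⟩

lemma exists_tower_cy [CharZero k] (t h : kˣ) :
    ∃ (B : Type u) (_ : Ring B) (_ : Algebra k B) (T : kˣ × kˣ → (B →ₐ[k] B)) (z : Fin 2 → B),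
      IsPresentedDualizing (RelCY t h) ![(1, 2), (0, 1)] (halfPlane (-2) 1) T
        ((t / h) ^ 3, (t / h)⁻¹) (1, 3) 2 z := by
  obtain ⟨B, _, _, T, z, st⟩ := exists_tower_y (k := k)
  obtain ⟨A, _, _, f, x, σ, δ, H, hσ, hδ⟩ :=
    -- The second coordinate is the scalar on `y`. The first acts trivially on `y` and is chosen to
    -- satisfy the weight condition on the Nakayama automorphism.
    st.exists_ore (((t / h) ^ 3)⁻¹, t / h) ![0] ⟨trivial, fun i => i.elim0⟩
  obtain ⟨T', hT⟩ := st.step H hσ hδ (χ := ![(t / h : k)]) (g := (1, 2))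
    (S' := halfPlane (-2) 1) (by simp [weight]) (by simp) (by simp) (by simp) (by simp)
    (n' := ((t / h) ^ 3, (t / h)⁻¹)) (w' := (1, 3)) (by ext <;> simp) (by simp)
    (by ext; simp [weight]; field_simp)
  exact ⟨A, _, _, T', _, hT⟩

/-- Upper triangular matrices. -/
def upper {R : Type*} [Ring R] (p q s : R) : Matrix (Fin 2) (Fin 2) R := !![p, q; 0, s]

section Upper

variable {R : Type*} [Ring R] [Algebra k R]

lemma upper_mul (p q s p' q' s' : R) :
    upper p q s * upper p' q' s' = upper (p * p') (p * q' + q * s') (s * s') := by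
  ext i j; fin_cases i <;> fin_cases j <;> simp [upper, Matrix.mul_apply, Fin.sum_univ_two]

lemma upper_add (p q s p' q' s' : R) :
    upper p q s + upper p' q' s' = upper (p + p') (q + q') (s + s') := by
  ext i j; fin_cases i <;> fin_cases j <;> simp [upper]

lemma smul_upper (c : k) (p q s : R) : c • upper p q s = upper (c • p) (c • q) (c • s) := by
  ext i j; fin_cases i <;> fin_cases j <;> simp [upper]

lemma upper_congr {p q s p' q' s' : R} (h1 : p = p') (h2 : q = q') (h3 : s = s') :
    upper p q s = upper p' q' s' := by rw [h1, h2, h3]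

end Upper

lemma pow_mem_homog {B : Type u} [Ring B] [Algebra k B] {T : kˣ × kˣ → (B →ₐ[k] B)} {g : ℤ × ℤ}
    {b : B} (hb : b ∈ homog T g) (n : ℕ) : b ^ n ∈ homog T (n • g) := by
  induction n with
  | zero => simpa using one_mem_homog
  | succ n ih => rw [pow_succ, succ_nsmul]; exact mul_mem_homog ih hb

lemma mul_mul_of_eq {R : Type*} [Ring R] {a b c : R} (h : a * b = c) (d : R) :
    a * (b * d) = c * d := by rw [← h, mul_assoc]

lemma exists_tower_acy [CharZero k] (t h : kˣ) :
    ∃ (B : Type u) (_ : Ring B) (_ : Algebra k B) (T : kˣ × kˣ → (B →ₐ[k] B)) (z : Fin 3 → B),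
      IsPresentedDualizing (RelACY t h) ![(1, 1), (1, 2), (0, 1)] (halfPlane (-1) 1) T
        ((t / h) ^ 3 * (t * h), -(t / h * t)⁻¹) (2, 4) 3 z := by
  obtain ⟨B, _, _, T, z, st⟩ := exists_tower_cy (k := k) t h
  -- Determined by the scalars `t / h` on `c` and `-t` on `y`.
  obtain ⟨u, hu⟩ : ∃ u : kˣ × kˣ, u = ((t * h)⁻¹, -t) := ⟨_, rfl⟩
  have hz := st.homogeneous
  have hr := relCY_iff.1 st.rel
  have hT := relCY_iff.1 (st.natural _ _ (T u) _ st.rel)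
  have h0 : T u (z 0) = (t / h : k) • z 0 := by rw [hz 0, hu]; simp [weight]; field_simp
  have h1 : T u (z 1) = (-t : k) • z 1 := by rw [hz 1, hu]; simp [weight]
  obtain ⟨A, _, _, f, x, σ, δ, H, hσ, hδ⟩ :=
    st.exists_ore u ![0, FreeAlgebra.ι k 0] (relCY_iff.2 (by
      change upper _ _ _ * upper _ _ _ = _ • (upper _ _ _ * upper _ _ _)
      simp only [upper_mul, smul_upper]
      refine upper_congr hT ?_ hr
      simp [h0]))
  obtain ⟨T', hT⟩ := st.step H hσ hδ (χ := ![(t / h : k), -t]) (g := (1, 1))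
    (S' := halfPlane (-1) 1) (by simp [hu, weight, Fin.forall_fin_succ]; field_simp) (by simp)
    (by
      refine Fin.forall_fin_succ.2 ⟨by simp, Fin.forall_fin_succ.2 ⟨?_, fun i => i.elim0⟩⟩
      simpa using hz 0)
    (by simp [Fin.forall_fin_succ]) (by simp)
    (n' := ((t / h) ^ 3 * (t * h), -(t / h * t)⁻¹)) (w' := (2, 4))
    (by rw [hu]; ext <;> simp; field_simp) (by simp) (by rw [hu]; ext; simp [weight]; field_simp)
  exact ⟨A, _, _, T', _, hT⟩

lemma exists_tower_bacy [CharZero k] (t h : kˣ) (r : k) :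
    ∃ (B : Type u) (_ : Ring B) (_ : Algebra k B) (T : kˣ × kˣ → (B →ₐ[k] B)) (z : Fin 4 → B),
      IsPresentedDualizing (RelBACY t h r) ![(2, 1), (1, 1), (1, 2), (0, 1)] (halfPlane (-1) 2) T
        (-t ^ 5, (t ^ 4)⁻¹) (4, 5) 4 z := by
  obtain ⟨B, _, _, T, z, st⟩ := exists_tower_acy (k := k) t h
  -- Determined by the scalars on `a` and `y`; the one on `c` is then automatic.
  obtain ⟨u, hu⟩ : ∃ u : kˣ × kˣ, u = (-(t * h ^ 2)⁻¹, -(t ^ 2 * h)) := ⟨_, rfl⟩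
  have hz := st.homogeneous
  have hR := relACY_iff.1 st.rel
  obtain ⟨r1, r2, r3⟩ := hR
  obtain ⟨T1, T2, T3⟩ := relACY_iff.1 (st.natural _ _ (T u) _ st.rel)
  have h0 : T u (z 0) = (t / h : k) • z 0 := by rw [hz 0, hu]; simp [weight]; field_simp
  have h1 : T u (z 1) = (-t ^ 3 : k) • z 1 := by rw [hz 1, hu]; simp [weight]; field_simp
  have h2 : T u (z 2) = (-t ^ 2 * h : k) • z 2 := by rw [hz 2, hu]; simp [weight]
  have r2' := mul_mul_of_eq r2
  have r3' := mul_mul_of_eq r3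
  obtain ⟨q, hq⟩ : ∃ q : Fin 3 → FreeAlgebra k (Fin 3), q = ![0,
    -(r * (t / h + t)) • FreeAlgebra.ι k 0 ^ 3, -r • FreeAlgebra.ι k 0 ^ 2] := ⟨_, rfl⟩
  have q0 : FreeAlgebra.lift k z (q 0) = 0 := by simp [hq]
  have q1 : FreeAlgebra.lift k z (q 1) = (-(r * (t / h + t))) • z 0 ^ 3 := by simp [hq]
  have q2 : FreeAlgebra.lift k z (q 2) = (-r) • z 0 ^ 2 := by simp [hq]
  obtain ⟨A, _, _, f, x, σ, δ, H, hσ, hδ⟩ := st.exists_ore u q (relACY_iff.2 (by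
      change upper _ _ _ * upper _ _ _ = _ • (upper _ _ _ * upper _ _ _) ∧
        upper _ _ _ * upper _ _ _ = _ • (upper _ _ _ * upper _ _ _) ∧
        upper _ _ _ * upper _ _ _ = _ • (upper _ _ _ * upper _ _ _) + upper _ _ _
      simp only [upper_mul, smul_upper, upper_add]
      refine ⟨upper_congr T1 ?_ r1, upper_congr T2 ?_ r2, upper_congr T3 ?_ r3⟩
      all_goals
        simp only [h0, h1, h2, q0, q1, q2, mul_add, add_mul, smul_mul_assoc, mul_smul_comm,
          mul_assoc, pow_succ, pow_zero, one_mul, smul_add, smul_smul, r2, r2', r3, r3',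
          mul_zero, zero_mul]
        match_scalars <;> field_simp <;> ring))
  obtain ⟨T', hT⟩ := st.step H hσ hδ (χ := ![(t / h : k), -t ^ 3, -t ^ 2 * h]) (g := (2, 1))
    (S' := halfPlane (-1) 2)
    (by
      refine Fin.forall_fin_succ.2 ⟨?_, Fin.forall_fin_succ.2 ⟨?_, Fin.forall_fin_succ.2
        ⟨?_, fun i => i.elim0⟩⟩⟩ <;> simp [weight, hu] <;> field_simp) (by simp)
    (by
      refine Fin.forall_fin_succ.2 ⟨?_, Fin.forall_fin_succ.2 ⟨?_, Fin.forall_fin_succ.2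
        ⟨?_, fun i => i.elim0⟩⟩⟩
      · rw [q0]
        exact Submodule.zero_mem _
      · change FreeAlgebra.lift k z (q 1) ∈ _
        rw [q1]
        exact Submodule.smul_mem _ _ (pow_mem_homog (hz 0) 3)
      · change FreeAlgebra.lift k z (q 2) ∈ _
        rw [q2]
        exact Submodule.smul_mem _ _ (pow_mem_homog (hz 0) 2))
    (by simp [Fin.forall_fin_succ]) (by simp)
    (n' := (-t ^ 5, (t ^ 4)⁻¹)) (w' := (4, 5))
    (by rw [hu]; ext <;> simp <;> field_simp) (by simp) (by rw [hu]; ext; simp [weight]; field_simp)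
  subst hq
  exact ⟨A, _, _, T', _, hT⟩

end Tower

/-! ### Adjoining `x` -/

section FinalStage

variable {k : Type u} [Field k]

/-- Existence of the last skew derivation is what ties `r` to `t` and `h`. The resulting extension
has the same universal property as `A`, so its structure is carried over. -/
theorem exists_dualizing_of_relXBACY [CharZero k] (t h : kˣ) {r : k}
    (hr : r * (h * (h - 1)) = t * (h ^ 3 + 1)) {A : Type u} [Ring A] [Algebra k A] (v : Fin 5 → A)
    (hv : RelXBACY t h r A v) (gen : Algebra.adjoin k (Set.range v) = ⊤)
    (lift : ∀ (C : Type u) [Ring C] [Algebra k C] (v' : Fin 5 → C), RelXBACY t h r C v' →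
      ∃ φ : A →ₐ[k] C, ∀ i, φ (v i) = v' i) :
    ∃ T, IsPresentedDualizing (RelXBACY t h r) ![(1, 0), (2, 1), (1, 1), (1, 2), (0, 1)] ⊤ T
      (t ^ 5 * h, (t ^ 5 * h)⁻¹) (5, 5) 5 v := by
  obtain ⟨B, _, _, T, z, st⟩ := exists_tower_bacy (k := k) t h r
  obtain ⟨u, hu⟩ : ∃ u : kˣ × kˣ, u = (-h⁻¹, t * h) := ⟨_, rfl⟩
  have hz := st.homogeneous
  obtain ⟨⟨r1, r2, r3⟩, r4, r5, r6⟩ := relBACY_iff.1 st.rel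
  obtain ⟨⟨T1, T2, T3⟩, T4, T5, T6⟩ := relBACY_iff.1 (st.natural _ _ (T u) _ st.rel)
  have h0 : T u (z 0) = (t / h : k) • z 0 := by rw [hz 0, hu]; simp [weight]; field_simp
  have h1 : T u (z 1) = (-t : k) • z 1 := by rw [hz 1, hu]; simp [weight]
  have h2 : T u (z 2) = (-t ^ 2 * h : k) • z 2 := by rw [hz 2, hu]; simp [weight]; try field_simp
  have h3 : T u (z 3) = (t * h : k) • z 3 := by rw [hz 3, hu]; simp [weight]
  have r3' := mul_mul_of_eq r3
  have r4' := mul_mul_of_eq r4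
  obtain ⟨q, hq⟩ : ∃ q : Fin 4 → FreeAlgebra k (Fin 4), q =
    ![0, FreeAlgebra.ι k 0, -r • FreeAlgebra.ι k 1 ^ 2, FreeAlgebra.ι k 1] := ⟨_, rfl⟩
  have q0 : FreeAlgebra.lift k z (q 0) = 0 := by simp [hq]
  have q1 : FreeAlgebra.lift k z (q 1) = z 0 := by simp [hq]
  have q2 : FreeAlgebra.lift k z (q 2) = (-r) • z 1 ^ 2 := by simp [hq]
  have q3 : FreeAlgebra.lift k z (q 3) = z 1 := by simp [hq]
  obtain ⟨A', _, _, f, x, σ, δ, H, hσ, hδ⟩ := st.exists_ore u q (relBACY_iff.2 (by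
      have hu2 : ∀ p q s : B, upper p q s ^ 2 = upper (p ^ 2) (p * q + q * s) (s ^ 2) :=
        fun p q s => by rw [pow_two, upper_mul, pow_two, pow_two]
      have hu3 : ∀ p q s : B, upper p q s ^ 3 =
          upper (p ^ 3) (p ^ 2 * q + (p * q + q * s) * s) (s ^ 3) :=
        fun p q s => by rw [pow_succ, hu2, upper_mul, ← pow_succ, ← pow_succ]
      change (upper _ _ _ * upper _ _ _ = _ • (upper _ _ _ * upper _ _ _) ∧
        upper _ _ _ * upper _ _ _ = _ • (upper _ _ _ * upper _ _ _) ∧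
        upper _ _ _ * upper _ _ _ = _ • (upper _ _ _ * upper _ _ _) + upper _ _ _) ∧
        upper _ _ _ * upper _ _ _ = _ • (upper _ _ _ * upper _ _ _) ∧
        upper _ _ _ * upper _ _ _ = _ • (upper _ _ _ * upper _ _ _) + _ • upper _ _ _ ^ 3 ∧
        upper _ _ _ * upper _ _ _ = _ • (upper _ _ _ * upper _ _ _) + _ • upper _ _ _ ^ 2
      simp only [upper_mul, hu2, hu3, smul_upper, upper_add]
      refine ⟨⟨upper_congr T1 ?_ r1, upper_congr T2 ?_ r2, upper_congr T3 ?_ r3⟩,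
        upper_congr T4 ?_ r4, upper_congr T5 ?_ r5, upper_congr T6 ?_ r6⟩
      all_goals
        simp only [h0, h1, h2, h3, q0, q1, q2, q3, mul_add, add_mul, smul_mul_assoc, mul_smul_comm,
          mul_assoc, pow_succ, pow_zero, one_mul, smul_add, smul_smul, r2, r3, r3',
          r4, r4', r5, r6, mul_zero, zero_mul]
        match_scalars <;> field_simp
      -- Coefficients that do not agree identically differ by the equation `hr`.
      all_goals first | ring1 | linear_combination hr | linear_combination -hr))
  -- Stated for any extension with these `σ` and `δ`: it serves first for the model and then for `A`
  -- itself.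
  have hstep : ∀ {A₀ : Type u} [Ring A₀] [Algebra k A₀] {f₀ : B →ₐ[k] A₀} {x₀ : A₀}
      (_ : IsOre f₀ x₀ σ δ),
      ∃ T₀, IsPresentedDualizing (RelXBACY t h r) ![(1, 0), (2, 1), (1, 1), (1, 2), (0, 1)] ⊤ T₀
      (t ^ 5 * h, (t ^ 5 * h)⁻¹) (5, 5) 5 (Fin.cons x₀ fun i => f₀ (z i)) := by
    intro A₀ _ _ f₀ x₀ H₀
    obtain ⟨T', hT⟩ := st.step H₀ hσ hδ (χ := ![(t / h : k), -t, -t ^ 2 * h, t * h]) (g := (1, 0))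
      (S' := ⊤)
      (by
        refine Fin.forall_fin_succ.2 ⟨?_, Fin.forall_fin_succ.2 ⟨?_, Fin.forall_fin_succ.2
          ⟨?_, Fin.forall_fin_succ.2 ⟨?_, fun i => i.elim0⟩⟩⟩⟩ <;> simp [weight, hu] <;>
          field_simp) (by simp)
      (by
        refine Fin.forall_fin_succ.2 ⟨?_, Fin.forall_fin_succ.2 ⟨?_, Fin.forall_fin_succ.2
          ⟨?_, Fin.forall_fin_succ.2 ⟨?_, fun i => i.elim0⟩⟩⟩⟩
        · rw [q0]
          exact Submodule.zero_mem _
        · change FreeAlgebra.lift k z (q 1) ∈ _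
          rw [q1]
          exact hz 0
        · change FreeAlgebra.lift k z (q 2) ∈ _
          rw [q2]
          exact Submodule.smul_mem _ _ (pow_mem_homog (hz 1) 2)
        · change FreeAlgebra.lift k z (q 3) ∈ _
          rw [q3]
          exact hz 1)
      (fun _ => trivial) trivial
      (n' := (t ^ 5 * h, (t ^ 5 * h)⁻¹)) (w' := (5, 5))
      (by rw [hu]; ext <;> simp; field_simp) (by simp)
      (by rw [hu]; ext; simp [weight]; field_simp)
    subst hq
    exact ⟨T', hT⟩
  obtain ⟨T', st'⟩ := hstep H
  obtain ⟨φ, hφ⟩ := st'.lift A v hv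
  obtain ⟨ψ, hψ⟩ := lift A' _ st'.rel
  have h1 : φ.comp ψ = AlgHom.id k A :=
    AlgHom.ext_of_adjoin_eq_top gen (by rintro _ ⟨i, rfl⟩; simp [hψ, hφ])
  have h2 : ψ.comp φ = AlgHom.id k A' :=
    AlgHom.ext_of_adjoin_eq_top st'.gen (by rintro _ ⟨i, rfl⟩; simp [hψ, hφ])
  obtain ⟨T'', st''⟩ := hstep (H.comp_equiv (AlgEquiv.ofAlgHom φ ψ h1 h2))
  refine ⟨T'', ?_⟩
  convert st'' using 1
  funext i
  refine Fin.cases ?_ (fun i => ?_) i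
  · exact (hφ 0).symm
  · exact (hφ i.succ).symm

end FinalStage

/-! ### Reduction from five generators to two -/

section TwoGenerators

variable {k : Type u} [Field k]

/-- The skew commutator of `x` and `y`. -/
def skewA {R : Type u} [Ring R] [Algebra k R] (t h : kˣ) (X Y : R) : R :=
  X * Y - (t * h : k) • (Y * X)

/-- The skew commutator of `x` and `skewA`. -/
def skewB {R : Type u} [Ring R] [Algebra k R] (t h : kˣ) (X Y : R) : R :=
  X * skewA t h X Y + (t : k) • (skewA t h X Y * X)

/-- The skew commutator of `skewA` and `y`. -/
def skewC {R : Type u} [Ring R] [Algebra k R] (t h : kˣ) (X Y : R) : R :=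
  skewA t h X Y * Y + (t : k) • (Y * skewA t h X Y)

/-- Three relations on two generators, in terms of iterated skew commutators. -/
structure SkewRel {R : Type u} [Ring R] [Algebra k R] (t h : kˣ) (r : k) (X Y : R) : Prop where
  xb : X * skewB t h X Y = (t / h : k) • (skewB t h X Y * X)
  cy : skewC t h X Y * Y = (t / h : k) • (Y * skewC t h X Y)
  bY : skewB t h X Y * Y = (-t ^ 2 * h : k) • (Y * skewB t h X Y) + (-r) • skewA t h X Y ^ 2

section

variable {R : Type u} [Ring R] [Algebra k R] {t h : kˣ} {r : k} {X Y : R}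

lemma cubicX_eq : X ^ 3 * Y + (t * (1 - h - 1 / h) : k) • (X ^ 2 * Y * X) +
    (t ^ 2 * (1 - h - 1 / h) : k) • (X * Y * X ^ 2) + (t ^ 3 : k) • (Y * X ^ 3) =
    X * skewB t h X Y - (t / h : k) • (skewB t h X Y * X) := by
  simp only [skewB, skewA, mul_add, add_mul, mul_sub, sub_mul, smul_mul_assoc, mul_smul_comm,
    mul_assoc, pow_succ, pow_zero, one_mul, smul_add, smul_sub, smul_smul]
  match_scalars <;> field_simp <;> ring

lemma cubicY_eq : X * Y ^ 3 + (t * (1 - h - 1 / h) : k) • (Y * X * Y ^ 2) +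
    (t ^ 2 * (1 - h - 1 / h) : k) • (Y ^ 2 * X * Y) + (t ^ 3 : k) • (Y ^ 3 * X) =
    skewC t h X Y * Y - (t / h : k) • (Y * skewC t h X Y) := by
  simp only [skewC, skewA, mul_add, add_mul, mul_sub, sub_mul, smul_mul_assoc, mul_smul_comm,
    mul_assoc, pow_succ, pow_zero, one_mul, smul_add, smul_sub, smul_smul]
  match_scalars <;> field_simp <;> ring

lemma mixed_eq : X ^ 2 * Y ^ 2 + (t - t * h + r : k) • (X * Y * X * Y) +
    (t ^ 3 * h * (1 - h) + t ^ 2 * h ^ 2 * r : k) • (Y * X * Y * X) + (-t ^ 4 * h ^ 2 : k) • (Y ^ 2 * X ^ 2) +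
    (-(t * h * r) : k) • (X * Y ^ 2 * X) +
    (-(t * h * r) : k) • (Y * X ^ 2 * Y) =
    skewB t h X Y * Y - ((-t ^ 2 * h : k) • (Y * skewB t h X Y) + (-r) • skewA t h X Y ^ 2) := by
  simp only [skewB, skewA, mul_add, add_mul, mul_sub, sub_mul, smul_mul_assoc, mul_smul_comm,
    mul_assoc, pow_succ, pow_zero, one_mul, smul_add, smul_sub, smul_smul]
  match_scalars <;> field_simp <;> ring

/-- The missing rules come from reducing one word in two ways. The rules for `a * c` and `b * a`
appear multiplied by `r + t / h`, and `h2` makes this factor nonzero. -/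
lemma SkewRel.relXBACY (H : SkewRel t h r X Y) (hr : r * (h * (h - 1)) = t * (h ^ 3 + 1))
    (h2 : (h : k) ^ 2 + 1 ≠ 0) :
    RelXBACY t h r R ![X, skewB t h X Y, skewA t h X Y, skewC t h X Y, Y] := by
  obtain ⟨xb, cy, bY⟩ := H
  have xy : X * Y = (t * h : k) • (Y * X) + skewA t h X Y := by rw [skewA]; abel
  have xa : X * skewA t h X Y = (-t : k) • (skewA t h X Y * X) + skewB t h X Y := by
    rw [skewB, neg_smul]; abel
  have ay : skewA t h X Y * Y = (-t : k) • (Y * skewA t h X Y) + skewC t h X Y := by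
    rw [skewC, neg_smul]; abel
  have hc : skewC t h X Y = skewA t h X Y * Y + (t : k) • (Y * skewA t h X Y) := rfl
  generalize skewA t h X Y = a at *
  generalize skewB t h X Y = b at *
  generalize skewC t h X Y = c at *
  have hh : (h : k) ≠ 0 := h.ne_zero
  have ht : (t : k) ≠ 0 := t.ne_zero
  have hW : r + t / h ≠ 0 := by
    intro h3
    have h4 : (t : k) * (h * (h ^ 2 + 1)) = 0 := by
      field_simp at h3
      linear_combination (h - 1 : k) * h3 - hr
    exact mul_ne_zero ht (mul_ne_zero hh h2) h4
  -- By `hr` both sides of the overlaps below carry the same factor, so it cancels and leaves the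
  -- scalar `t / h`.
  have hWr : t * r - t ^ 2 * h = (r + t / h) * (t / h : k) := by
    field_simp
    linear_combination hr
  have xy' := mul_mul_of_eq xy
  have xa' := mul_mul_of_eq xa
  have ay' := mul_mul_of_eq ay
  have cy' := mul_mul_of_eq cy
  have xc : X * c = (-t ^ 2 * h : k) • (c * X) + (-r) • a ^ 2 := by
    simp only [hc, mul_add, add_mul, smul_mul_assoc, mul_smul_comm,
      mul_assoc, pow_succ, pow_zero, one_mul, smul_add, smul_smul, xy, xy', xa, xa', bY]
    match_scalars <;> field_simp <;> ring
  have xc' := mul_mul_of_eq xc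
  have bY' := mul_mul_of_eq bY
  have xb' := mul_mul_of_eq xb
  have ac : a * c = (t / h : k) • (c * a) := by
    -- Overlap of the rule for `X * c` with the rule for `c * Y`.
    have e : X * c * Y = (t / h : k) • (X * Y * c) := by rw [mul_assoc, cy, mul_smul_comm, mul_assoc]
    apply smul_right_injective R hW
    dsimp only
    rw [smul_smul, ← hWr]
    rw [xc, xy] at e
    simp only [mul_add, add_mul, smul_mul_assoc, mul_smul_comm,
      mul_assoc, pow_succ, pow_zero, one_mul, smul_add, smul_smul, xy, xc, ay, ay', cy'] at e
    rw [← sub_eq_zero] at e ⊢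
    rw [← neg_eq_zero]
    refine Eq.trans ?_ e
    match_scalars <;> field_simp <;> ring
  have ac' := mul_mul_of_eq ac
  have ba : b * a = (t / h : k) • (a * b) := by
    -- Overlap of the rule for `X * b` with the rule for `b * Y`.
    have e : X * (b * Y) = (t / h : k) • (b * (X * Y)) := by
      rw [← mul_assoc, xb, smul_mul_assoc, mul_assoc]
    apply smul_right_injective R hW
    dsimp only
    rw [smul_smul, ← hWr]
    rw [bY, xy] at e
    simp only [mul_add, add_mul, smul_mul_assoc, mul_smul_comm,
      mul_assoc, pow_succ, pow_zero, one_mul, smul_add, smul_smul, xy', xa, xa', xb, bY'] at e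
    rw [← sub_eq_zero] at e ⊢
    rw [← neg_eq_zero]
    refine Eq.trans ?_ e
    match_scalars <;> field_simp <;> ring
  have bc : b * c = (-t ^ 3 : k) • (c * b) + (-(r * (t / h + t))) • a ^ 3 := by
    -- Moving `X` through the rule for `a * c` just found produces `b * c`.
    have e : X * a * c = (t / h : k) • (X * c * a) := by
      rw [mul_assoc, ac, mul_smul_comm, mul_assoc]
    rw [xa, xc] at e
    simp only [mul_add, add_mul, smul_mul_assoc, mul_smul_comm,
      mul_assoc, pow_succ, pow_zero, one_mul, smul_add, smul_smul, xa, xc, ac'] at e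
    rw [← sub_eq_zero] at e ⊢
    refine Eq.trans ?_ e
    simp only [pow_succ, pow_zero, one_mul, mul_assoc]
    match_scalars <;> field_simp <;> ring
  exact relXBACY_iff.2 ⟨⟨⟨cy, ac, ay⟩, ba, bc, bY⟩, xb, xa, xc, xy⟩

lemma skewRel_of_relXBACY {v : Fin 5 → R} (H : RelXBACY t h r R v) :
    SkewRel t h r (v 0) (v 4) ∧ skewA t h (v 0) (v 4) = v 2 ∧ skewB t h (v 0) (v 4) = v 1 ∧
      skewC t h (v 0) (v 4) = v 3 := by
  obtain ⟨⟨⟨cy, ac, ay⟩, ba, bc, bY⟩, xb, xa, xc, xy⟩ := relXBACY_iff.1 H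
  have ha : skewA t h (v 0) (v 4) = v 2 := by rw [skewA, xy, add_sub_cancel_left]
  have hb : skewB t h (v 0) (v 4) = v 1 := by rw [skewB, ha, xa, neg_smul]; abel
  have hc : skewC t h (v 0) (v 4) = v 3 := by rw [skewC, ha, ay, neg_smul]; abel
  exact ⟨⟨by rw [hb, xb], by rw [hc, cy], by rw [ha, hb, bY]⟩, ha, hb, hc⟩

end

theorem exists_dualizing_of_skewRel [CharZero k] {t h : kˣ} {r : k}
    (hr : r * (h * (h - 1)) = t * (h ^ 3 + 1)) (h2 : (h : k) ^ 2 + 1 ≠ 0)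
    {A : Type u} [Ring A] [Algebra k A] {X Y : A} (H : SkewRel t h r X Y)
    (gen : Algebra.adjoin k {X, Y} = ⊤)
    (lift : ∀ (C : Type u) [Ring C] [Algebra k C] (X' Y' : C), SkewRel t h r X' Y' →
      ∃ φ : A →ₐ[k] C, φ X = X' ∧ φ Y = Y') :
    ∃ ν : A ≃ₐ[k] A, ν X = (t ^ 5 * h : k) • X ∧ ν Y = (t ^ 5 * h : k)⁻¹ • Y ∧
      IsTwistedCalabiYau k ν 5 := by
  obtain ⟨T, st⟩ := exists_dualizing_of_relXBACY t h hr _ (H.relXBACY hr h2)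
    (by
      rw [eq_top_iff, ← gen]
      refine Algebra.adjoin_mono ?_
      rintro _ (rfl | rfl)
      · exact ⟨0, rfl⟩
      · exact ⟨4, rfl⟩)
    (fun C _ _ v' hv' => by
      obtain ⟨hs, ha, hb, hc⟩ := skewRel_of_relXBACY hv'
      obtain ⟨φ, hX, hY⟩ := lift C _ _ hs
      have hA : φ (skewA t h X Y) = skewA t h (φ X) (φ Y) := by simp [skewA]
      have hB : φ (skewB t h X Y) = skewB t h (φ X) (φ Y) := by simp [skewB, hA]
      have hC : φ (skewC t h X Y) = skewC t h (φ X) (φ Y) := by simp [skewC, hA]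
      rw [hX, hY] at hA hB hC
      refine ⟨φ, fun i => ?_⟩
      fin_cases i
      · exact hX
      · exact hB.trans hb
      · exact hA.trans ha
      · exact hC.trans hc
      · exact hY)
  obtain ⟨ι, _, _, h', deg, o, t', D, G⟩ := st.dual
  refine ⟨torusEquiv st.span (t ^ 5 * h, (t ^ 5 * h)⁻¹), ?_, ?_,
    IsDualizing.isTwistedCalabiYau (o := o) (t := t') (D := D) (h := h') ?_ (by norm_num)⟩
  · exact (st.homogeneous 0 _).trans (by simp [weight])
  · exact (st.homogeneous 4 _).trans (by simp [weight])
  · exact G.toIsDualizing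

end TwoGenerators

/-! ### The Calabi–Yau criterion -/

section CalabiYau

variable {k : Type u} [Field k] {A : Type u} [Ring A] [Algebra k A]

/-- If the algebra is also Calabi-Yau, then the Nakayama automorphism is implemented by an element
with a left inverse. -/
lemma IsTwistedCalabiYau.exists_normal [Nontrivial A] {ν : A ≃ₐ[k] A} {d : ℕ}
    (H : IsTwistedCalabiYau k ν d) (H' : IsCalabiYau k A) :
    ∃ w m : A, m * w = 1 ∧ ∀ a, ν a * w = w * a := by
  obtain ⟨d', H'⟩ := H'
  obtain ⟨e, he⟩ := H.ext_top
  -- Otherwise `Ext` in degree `d`, a copy of the nonzero `A`, would vanish.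
  have hd : d = d' := by
    by_contra hd
    refine one_ne_zero (α := A) ?_
    rw [← e.apply_symm_apply 1, H'.ext_eq_zero d hd (e.symm 1), map_zero]
  subst hd
  obtain ⟨e', he'⟩ := H'.ext_top
  have key : ∀ b m a : A, e' (e.symm (b * m * ν a)) = b * e' (e.symm m) * a := fun b m a => by
    have h := he b (e.symm m) a
    rw [e.apply_symm_apply] at h
    rw [← h, e.symm_apply_apply, he']
    rfl
  refine ⟨e' (e.symm 1), e (e'.symm 1), ?_, fun a => ?_⟩
  · have h := key (e (e'.symm 1)) 1 1
    rw [map_one ν, mul_one, mul_one, mul_one, e.symm_apply_apply, e'.apply_symm_apply] at h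
    exact h.symm
  · have h := key 1 1 a
    rw [one_mul, one_mul, one_mul] at h
    have h' := key (ν a) 1 1
    rw [map_one ν, mul_one, mul_one, mul_one] at h'
    rw [← h, ← h']

/-- The element implementing `ν` has a left inverse, so its image in the commutative domain `k[Y]`
is nonzero. It can be cancelled from the image of `ν Y * w = w * Y`, leaving `c⁻¹ = 1`. -/
lemma isCalabiYau_iff {ν : A ≃ₐ[k] A} {d : ℕ} (H : IsTwistedCalabiYau k ν d) {X Y : A}
    (gen : Algebra.adjoin k {X, Y} = ⊤) {c : k} (hX : ν X = c • X) (hY : ν Y = c⁻¹ • Y)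
    (ε : A →ₐ[k] Polynomial k) (hε : ε Y = Polynomial.X) : IsCalabiYau k A ↔ c = 1 := by
  refine ⟨fun H' => ?_, fun hc => ⟨d, ?_⟩⟩
  · have : Nontrivial A := ε.toRingHom.domain_nontrivial
    obtain ⟨w, m, hm, hw⟩ := H.exists_normal H'
    have h1 := congrArg ε (hw Y)
    rw [hY, map_mul, map_mul, map_smul, hε, mul_comm, mul_smul_comm] at h1
    have hw0 : ε w * Polynomial.X ≠ 0 := by
      refine mul_ne_zero (fun h => ?_) Polynomial.X_ne_zero
      have := congrArg ε hm
      rw [map_mul, h, mul_zero, map_one] at this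
      exact zero_ne_one this
    have h2 : (c⁻¹ - 1) • (ε w * Polynomial.X) = 0 := by rw [sub_smul, h1, one_smul, sub_self]
    rcases smul_eq_zero.1 h2 with h2 | h2
    · exact inv_eq_one.1 (sub_eq_zero.1 h2)
    · exact absurd h2 hw0
  · have hν : ν = AlgEquiv.refl := by
      have : (ν : A →ₐ[k] A) = AlgHom.id k A := AlgHom.ext_of_adjoin_eq_top gen (by
        rintro _ (rfl | rfl)
        · simp [hX, hc]
        · simp [hY, hc])
      ext a
      exact DFunLike.congr_fun this a
    rwa [hν] at H

end CalabiYau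

/-! ### The quotient of the free algebra -/

section Quotient

variable {k : Type u} [Field k]

lemma freeAlgebra_adjoin : Algebra.adjoin k {fx k, fy k} = ⊤ := by
  rw [← FreeAlgebra.adjoin_range_ι]
  congr 1
  ext a
  simp [Fin.exists_fin_two, eq_comm]

theorem ringQuot_isTwistedCalabiYau [CharZero k] {t h : kˣ} {r p q s l₂ l₃ l₄ l₅ : k}
    (hr : r * (h * (h - 1)) = t * (h ^ 3 + 1)) (h2 : (h : k) ^ 2 + 1 ≠ 0)
    (hp : p = t * (1 - h - 1 / h)) (hq : q = t ^ 2 * (1 - h - 1 / h)) (hs : s = t ^ 3)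
    (hl₂ : l₂ = t - t * h + r) (hl₃ : l₃ = t ^ 3 * h * (1 - h) + t ^ 2 * h ^ 2 * r)
    (hl₄ : l₄ = -t ^ 4 * h ^ 2) (hl₅ : l₅ = -(t * h * r))
    (R : FreeAlgebra k (Fin 2) → FreeAlgebra k (Fin 2) → Prop)
    (hR : ∀ a b, R a b ↔ (a = cubicX p q s ∨ a = mixed l₂ l₃ l₄ l₅ ∨ a = cubicY p q s) ∧ b = 0) :
    (∃ ν : RingQuot R ≃ₐ[k] RingQuot R,
      ν (RingQuot.mkAlgHom k R (fx k)) = (t ^ 5 * h : k) • RingQuot.mkAlgHom k R (fx k) ∧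
      ν (RingQuot.mkAlgHom k R (fy k)) = (t ^ 5 * h : k)⁻¹ • RingQuot.mkAlgHom k R (fy k) ∧
      IsTwistedCalabiYau k ν 5) ∧ (IsCalabiYau k (RingQuot R) ↔ (t ^ 5 * h : k) = 1) := by
  set π := RingQuot.mkAlgHom k R with hπ
  have rel : ∀ a, R a 0 → π a = 0 := fun a ha => by
    rw [hπ, RingQuot.mkAlgHom_rel k ha, map_zero]
  have gen : Algebra.adjoin k {π (fx k), π (fy k)} = ⊤ := by
    have := congrArg (Subalgebra.map π) (freeAlgebra_adjoin (k := k))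
    rw [AlgHom.map_adjoin, Set.image_pair, Algebra.map_top] at this
    rw [this, AlgHom.range_eq_top]
    exact RingQuot.mkAlgHom_surjective k R
  have hX : ∀ {C : Type u} [Ring C] [Algebra k C] (φ : FreeAlgebra k (Fin 2) →ₐ[k] C),
      φ (cubicX p q s) = φ (fx k) * skewB t h (φ (fx k)) (φ (fy k)) -
        (t / h : k) • (skewB t h (φ (fx k)) (φ (fy k)) * φ (fx k)) := fun φ => by
    rw [← cubicX_eq, cubicX, hp, hq, hs]
    simp only [map_add, map_smul, map_mul, map_pow]
  have hY : ∀ {C : Type u} [Ring C] [Algebra k C] (φ : FreeAlgebra k (Fin 2) →ₐ[k] C),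
      φ (cubicY p q s) = skewC t h (φ (fx k)) (φ (fy k)) * φ (fy k) -
        (t / h : k) • (φ (fy k) * skewC t h (φ (fx k)) (φ (fy k))) := fun φ => by
    rw [← cubicY_eq, cubicY, hp, hq, hs]
    simp only [map_add, map_smul, map_mul, map_pow]
  have hM : ∀ {C : Type u} [Ring C] [Algebra k C] (φ : FreeAlgebra k (Fin 2) →ₐ[k] C),
      φ (mixed l₂ l₃ l₄ l₅) = skewB t h (φ (fx k)) (φ (fy k)) * φ (fy k) -
        ((-t ^ 2 * h : k) • (φ (fy k) * skewB t h (φ (fx k)) (φ (fy k))) +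
          (-r) • skewA t h (φ (fx k)) (φ (fy k)) ^ 2) := fun φ => by
    rw [← mixed_eq, mixed, hl₂, hl₃, hl₄, hl₅]
    simp only [map_add, map_smul, map_mul, map_pow]
  have H : SkewRel t h r (π (fx k)) (π (fy k)) :=
    ⟨sub_eq_zero.1 (by rw [← hX, rel _ ((hR _ _).2 ⟨Or.inl rfl, rfl⟩)]),
      sub_eq_zero.1 (by rw [← hY, rel _ ((hR _ _).2 ⟨Or.inr (Or.inr rfl), rfl⟩)]),
      sub_eq_zero.1 (by rw [← hM, rel _ ((hR _ _).2 ⟨Or.inr (Or.inl rfl), rfl⟩)])⟩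
  have lift : ∀ (C : Type u) [Ring C] [Algebra k C] (X' Y' : C), SkewRel t h r X' Y' →
      ∃ φ : RingQuot R →ₐ[k] C, φ (π (fx k)) = X' ∧ φ (π (fy k)) = Y' := by
    intro C _ _ X' Y' H'
    have hx : FreeAlgebra.lift k ![X', Y'] (fx k) = X' := by simp
    have hy : FreeAlgebra.lift k ![X', Y'] (fy k) = Y' := by simp
    refine ⟨RingQuot.liftAlgHom k ⟨FreeAlgebra.lift k ![X', Y'], ?_⟩, ?_, ?_⟩
    · rintro a b hab
      obtain ⟨ha | ha | ha, rfl⟩ := (hR _ _).1 hab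
      · rw [map_zero, ha, hX, hx, hy, H'.xb, sub_self]
      · rw [map_zero, ha, hM, hx, hy, H'.bY, sub_self]
      · rw [map_zero, ha, hY, hx, hy, H'.cy, sub_self]
    · rw [hπ, RingQuot.liftAlgHom_mkAlgHom_apply, hx]
    · rw [hπ, RingQuot.liftAlgHom_mkAlgHom_apply, hy]
  obtain ⟨ν, hνX, hνY, hν⟩ := exists_dualizing_of_skewRel hr h2 H gen lift
  -- With `X = 0` all the skew commutators vanish, so the relations hold trivially.
  obtain ⟨ε, -, hε⟩ := lift (Polynomial k) 0 Polynomial.X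
    ⟨by simp [skewB, skewA], by simp [skewC, skewA], by simp [skewB, skewA]⟩
  exact ⟨⟨ν, hνX, hνY, hν⟩, isCalabiYau_iff hν gen hνX hνY ε hε⟩

end Quotient

/-! ### Matching the parameters of the two families -/

section Main

variable {k : Type u} [Field k] [CharZero k]

theorem algD_isTwistedCalabiYau {p q : k} (hp : p ≠ 0) (hq : q ≠ 0)
    (hpq : 2 * p ^ 4 - p ^ 2 * q + q ^ 2 = 0) :
    (∃ ν : AlgD p q ≃ₐ[k] AlgD p q,
      ν (AlgD.x p q) = (p⁻¹ ^ 3 * q ^ 4) • AlgD.x p q ∧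
      ν (AlgD.y p q) = (p ^ 3 * q⁻¹ ^ 4) • AlgD.y p q ∧ IsTwistedCalabiYau k ν 5) ∧
    (IsCalabiYau k (AlgD p q) ↔ p⁻¹ ^ 3 * q ^ 4 = 1) := by
  have hc : (q / p) ^ 5 * (p ^ 2 / q) = p⁻¹ ^ 3 * q ^ 4 := by field_simp
  have hc' : ((q / p) ^ 5 * (p ^ 2 / q))⁻¹ = p ^ 3 * q⁻¹ ^ 4 := by rw [hc]; field_simp
  rw [← hc', ← hc]
  have hne : p ^ 2 ≠ q := by
    rintro rfl
    have h1 : 2 * p ^ 4 = 0 := by linear_combination hpq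
    exact mul_ne_zero two_ne_zero (pow_ne_zero 4 hp) h1
  have h4 : (p ^ 2 / q) ^ 2 + 1 ≠ 0 := by
    intro h0
    field_simp at h0
    have h1 : p ^ 2 * (p ^ 2 - q) = 0 := by linear_combination hpq - h0
    exact mul_ne_zero (pow_ne_zero 2 hp) (sub_ne_zero.2 hne) h1
  -- Comparing the coefficients of `r₁` gives `t = q / p`; `l₄ = -t ^ 4 * h ^ 2` is met by `h = p ^
  -- 2 / q`, and `l₂ = 0` forces `r = t * (h - 1)`.
  refine ringQuot_isTwistedCalabiYau (t := Units.mk0 (q / p) (div_ne_zero hq hp))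
    (h := Units.mk0 (p ^ 2 / q) (div_ne_zero (pow_ne_zero 2 hp) hq))
    (r := q / p * (p ^ 2 / q - 1)) (p := p) (q := q) (s := -(p * (2 * p ^ 2 + q)))
    (l₂ := 0) (l₃ := -(p * (p ^ 2 + q))) (l₄ := -q ^ 2) (l₅ := q - p ^ 2)
    ?_ h4 ?_ ?_ ?_ ?_ ?_ ?_ ?_ _ fun a b => ⟨?_, ?_⟩
  · simp only [Units.val_mk0]
    field_simp
    linear_combination -q * hpq
  · simp only [Units.val_mk0]
    field_simp
    linear_combination hpq
  · simp only [Units.val_mk0]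
    field_simp
    linear_combination hpq
  · simp only [Units.val_mk0]
    field_simp
    linear_combination -(p ^ 2 + q) * hpq
  · simp only [Units.val_mk0]
    ring
  · simp only [Units.val_mk0]
    field_simp
    linear_combination -hpq
  · simp only [Units.val_mk0]
    field_simp
  · simp only [Units.val_mk0]
    field_simp
    ring
  · rintro (_ | _ | _)
    · exact ⟨Or.inl rfl, rfl⟩
    · exact ⟨Or.inr (Or.inl rfl), rfl⟩
    · exact ⟨Or.inr (Or.inr rfl), rfl⟩
  · rintro ⟨rfl | rfl | rfl, rfl⟩
    · exact RelD.r₁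
    · exact RelD.r₂
    · exact RelD.r₃

theorem algG_isTwistedCalabiYau {p q s g : k} (hp : p ≠ 0) (hq : q ≠ 0) (hs : s ≠ 0) (hg : g ≠ 0)
    (h1 : p * s ^ 3 * g + q * s * g ^ 2 + s ^ 5 + g ^ 3 = 0) (h2 : p ^ 3 * s = q ^ 3)
    (h3 : p * s ≠ q ^ 2) (h4 : q ^ 2 * s ^ 2 ≠ g ^ 2) (h5 : s ^ 5 + g ^ 3 ≠ 0) :
    (∃ ν : AlgG p q s g ≃ₐ[k] AlgG p q s g,
      ν (AlgG.x p q s g) = g • AlgG.x p q s g ∧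
      ν (AlgG.y p q s g) = g⁻¹ • AlgG.y p q s g ∧ IsTwistedCalabiYau k ν 5) ∧
    (IsCalabiYau k (AlgG p q s g) ↔ g = 1) := by
  obtain ⟨t, ht⟩ : ∃ t : kˣ, (t : k) = q / p := ⟨Units.mk0 _ (div_ne_zero hq hp), rfl⟩
  -- Chosen so that the Nakayama scalar `t ^ 5 * h` equals `g`.
  obtain ⟨h, hh⟩ : ∃ h : kˣ, (h : k) = g / t ^ 5 :=
    ⟨Units.mk0 _ (div_ne_zero hg (pow_ne_zero 5 t.ne_zero)), rfl⟩
  have ht0 : (t : k) ≠ 0 := t.ne_zero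
  have hh0 : (h : k) ≠ 0 := h.ne_zero
  obtain rfl : q = t * p := by rw [ht]; field_simp
  obtain rfl : g = t ^ 5 * h := by rw [hh]; field_simp
  obtain rfl : s = t ^ 3 := by
    apply mul_left_cancel₀ (pow_ne_zero 3 hp)
    linear_combination h2
  clear ht hh h2
  -- After substitution the first equation is divisible by `t ^ 14 * (h + 1)`, and `h5` excludes `h
  -- = -1`. The hypotheses `h4` and `h3` exclude in the same way `h = 1` and `h ^ 2 = -1`.
  have hp' : p * h = t * (h - h ^ 2 - 1) := by
    have e : (h : k) + 1 ≠ 0 := fun e => h5 (by linear_combination t ^ 15 * (h ^ 2 - h + 1) * e)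
    apply mul_left_cancel₀ (mul_ne_zero (pow_ne_zero 14 ht0) e)
    linear_combination h1
  have hne : (h : k) - 1 ≠ 0 := fun e => by
    have e' : (h : k) = 1 := by linear_combination e
    rw [e', mul_one] at hp'
    apply h4
    rw [hp', e']
    ring
  have hne' : (h : k) ^ 2 + 1 ≠ 0 := fun e => h3 (by
    have : p = t := by
      apply mul_right_cancel₀ hh0
      linear_combination hp' - t * e
    rw [this]
    ring)
  have hpe : p = t * (1 - h - 1 / h) := by
    field_simp
    linear_combination hp'
  have hp0 : (h : k) - h ^ 2 - 1 ≠ 0 := fun e => mul_ne_zero hp hh0 (by rw [hp', e, mul_zero])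
  -- The common denominator `q * s + g` of the coefficients `lᵢ`, now visibly nonzero.
  have hd : t * p * t ^ 3 + t ^ 5 * h = (t ^ 5 * (h - 1) / h : k) := by
    rw [hpe]
    field_simp
    ring
  refine ringQuot_isTwistedCalabiYau (t := t) (h := h)
    (r := t * (h ^ 3 + 1) / (h * (h - 1))) (p := p) (q := t * p) (s := t ^ 3)
    (l₂ := -((t ^ 3) ^ 2 * (t * p * t ^ 3 - t ^ 5 * h) / (t ^ 5 * h * (t * p * t ^ 3 + t ^ 5 * h))))
    (l₃ := t ^ 3 - p * (t ^ 5 * h) * (p * t ^ 3 - (t * p) ^ 2) /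
      (t * p * (t * p * t ^ 3 + t ^ 5 * h)))
    (l₄ := -((t ^ 5 * h) ^ 2 / (t ^ 3) ^ 2))
    (l₅ := (p * (t ^ 3) ^ 2 + t * p * (t ^ 5 * h)) / (t * p * t ^ 3 + t ^ 5 * h))
    ?_ hne' hpe ?_ rfl ?_ ?_ ?_ ?_ _ fun a b => ⟨?_, ?_⟩
  rotate_right 2
  · rintro (_ | _ | _)
    · exact ⟨Or.inl rfl, rfl⟩
    · exact ⟨Or.inr (Or.inl rfl), rfl⟩
    · exact ⟨Or.inr (Or.inr rfl), rfl⟩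
  · rintro ⟨rfl | rfl | rfl, rfl⟩
    · exact RelG.r₁
    · exact RelG.r₂
    · exact RelG.r₃
  all_goals try rw [hd]
  · field_simp
  · rw [hpe]; ring
  · rw [hpe]
    field_simp
    ring
  · rw [hpe]
    field_simp
    ring
  · field_simp
  · rw [hpe]
    field_simp
    ring

end Main

end TwistedCY

theorem mainTheorem6 {k : Type u} [Field k] [CharZero k] :
    (∀ p q : k, p ≠ 0 → q ≠ 0 → 2 * p ^ 4 - p ^ 2 * q + q ^ 2 = 0 →
      (∃ ν : TwistedCY.AlgD p q ≃ₐ[k] TwistedCY.AlgD p q,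
        ν (TwistedCY.AlgD.x p q) = (p⁻¹ ^ 3 * q ^ 4) • TwistedCY.AlgD.x p q ∧
        ν (TwistedCY.AlgD.y p q) = (p ^ 3 * q⁻¹ ^ 4) • TwistedCY.AlgD.y p q ∧
        TwistedCY.IsTwistedCalabiYau k ν 5) ∧
      (TwistedCY.IsCalabiYau k (TwistedCY.AlgD p q) ↔
        p ^ 3 = q ^ 4 ∧ 2 * p ^ 4 - p ^ 2 * q + q ^ 2 = 0)) ∧
    (∀ p q s g : k, p ≠ 0 → q ≠ 0 → s ≠ 0 → g ≠ 0 →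
      p * s ^ 3 * g + q * s * g ^ 2 + s ^ 5 + g ^ 3 = 0 → p ^ 3 * s = q ^ 3 →
      p * s ≠ q ^ 2 → q ^ 2 * s ^ 2 ≠ g ^ 2 → s ^ 5 + g ^ 3 ≠ 0 →
      (∃ ν : TwistedCY.AlgG p q s g ≃ₐ[k] TwistedCY.AlgG p q s g,
        ν (TwistedCY.AlgG.x p q s g) = g • TwistedCY.AlgG.x p q s g ∧
        ν (TwistedCY.AlgG.y p q s g) = g⁻¹ • TwistedCY.AlgG.y p q s g ∧
        TwistedCY.IsTwistedCalabiYau k ν 5) ∧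
      (TwistedCY.IsCalabiYau k (TwistedCY.AlgG p q s g) ↔ g = 1)) := by
  refine ⟨fun p q hp hq hpq => ?_, fun p q s g hp hq hs hg h1 h2 h3 h4 h5 =>
    TwistedCY.algG_isTwistedCalabiYau hp hq hs hg h1 h2 h3 h4 h5⟩
  obtain ⟨h1, h2⟩ := TwistedCY.algD_isTwistedCalabiYau hp hq hpq
  refine ⟨h1, h2.trans ?_⟩
  rw [and_iff_left hpq, inv_pow, inv_mul_eq_one₀ (pow_ne_zero 3 hp)]
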